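/- **Setting.** Let $X$ be a totally disconnected compact metric space, $\sigma\colon X\to X$ a surjective local homeomorphism, and $K$ a field with involution. A *partition* of $X$ is a finite family of non-empty, pairwise disjoint clopen sets covering $X$; $\mathcal P\precsim\mathcal Q$ means that each member of $\mathcal Q$ is contained in a member of $\mathcal P$; $\mathcal P\vee\mathcal Q$ is the family of non-empty intersections $Z\cap Z'$ with $Z\in\mathcal P$, $Z'\in\mathcal Q$; $\sigma^{-1}(\mathcal P)=\{\sigma^{-1}(Z): Z\in\mathcal P\}$; and $\mathcal P^\sigma$ is the family of non-empty sets $\big(\sigma(Z_1)\cap\dots\cap\sigma(Z_k)\big)\setminus\{x: |\sigma^{-1}(x)|\ge k+1\}$ with $k\ge 1$ and $Z_1,\dots,Z_k\in\mathcal P$ distinct. Let $(\mathcal P_n)_{n\ge0}$ be a $\sigma$-refined sequence of partitions, that is: $\sigma$ restricts to a homeomorphism of each $Z\in\mathcal P_0$ onto its image; $\mathcal P_n\precsim\mathcal P_{n+1}$ for all $n$; $\bigcup_n\mathcal P_n$ generates the topology of $X$; $\max_{Z\in\mathcal P_n}\operatorname{diam}Z\to0$; and $\mathcal P_{2j}\vee\mathcal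 P_{2j}^{\sigma}\precsim\mathcal P_{2j+1}$ and $\mathcal P_{2j+1}\vee\sigma^{-1}(\mathcal P_{2j+1})\precsim\mathcal P_{2j+2}$ for all $j\ge 0$. **Layers.** For $n\ge0$ let $F_n$ be the finite bipartite graph with vertex set $\mathcal P_n\sqcup\mathcal P_{n+1}$ and the following edges $e$, with source $s(e)=Z'\in\mathcal P_{n+1}$ and range $r(e)=Z\in\mathcal P_n$: one blue edge for each pair with $Z'\subseteq Z$; and one red edge for each pair with $Z'\subseteq\sigma(Z)$ if $n$ is even, with $Z'\subseteq\sigma^{-1}(Z)$ if $n$ is odd. Let $B_Z$ and $R_Z$ be the sets of blue and of red edges with range $Z$. For a red edge $f$ of $F_{2j}$ let $R(f)$ be the set of red edges $g$ of $F_{2j+1}$ with $r(g)=s(f)$ and $s(g)\subseteq r(f)$. The separation $D^n$ is given, for $Z\in\mathcal P_n$, by $D_Z=\{B_Z,R_Z\}$ if $n$ is even, and by $D_{Z}=\{B_{Z}\}\cup\{R(f): f \text{ a red edge of } F_{n-1},\ s(f)=Z\}$ if $n$ is odd; each $D_Z$ is a partition of $r^{-1}(Z)$. These are the layers of the $l$-diagram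 $(F,D)$ of $(X,\sigma)$. **Algebras.** $L_n=L_K(F_n,D^n)$ is the Leavitt path algebra: the $K$-algebra generated by the vertices $v$, the edges $e$ and the elements $e^*$, subject to $vw=\delta_{v,w}v$, $r(e)e=e=e\,s(e)$, $e^*r(e)=e^*=s(e)e^*$, $e^*f=\delta_{e,f}s(e)$ for $e,f$ in the same member of a set $D_Z$, and $Z=\sum_{e\in Y}ee^*$ for $Y\in D_Z$. Its unit is the sum of the vertices, and its conjugate-linear involution fixes the vertices and interchanges $e$ and $e^*$. There are unital $*$-homomorphisms $\widetilde\phi_n\colon L_n\to L_{n+1}$ with $\widetilde\phi_n(w)=w$ for $w\in\mathcal P_{n+1}$, $\widetilde\phi_n(e)=\sum_{g\in X(e)}g^*$ for edges $e$, and $\widetilde\phi_n(v)=\sum_{e\in B_v}\sum_{g\in X(e)}s(g)$ for $v\in\mathcal P_n$, where $X(e)=B_{s(e)}$ if $e$ is blue, and for $e$ red $X(e)=R(e)$ if $n$ is even, $X(e)=R_{s(e)}$ if $n$ is odd. Put $p_{2n}=\sum_{U\in\mathcal P_{2n}}U\in L_{2n}$, where $U \in \mathcal P_{2n}$, seen as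 an element of $L_{2n}$, is denoted $p_U$; $\mathcal A_{2n}=p_{2n}L_{2n}p_{2n}$; $\phi_n\colon\mathcal A_{2n}\to\mathcal A_{2n+2}$ the restriction of $\widetilde\phi_{2n+1}\circ\widetilde\phi_{2n}$; and let $\mathcal A_\infty$ be the colimit of the $*$-algebras $\mathcal A_{2n}$ along the maps $\phi_n$, with canonical maps $\phi_{n,\infty}\colon\mathcal A_{2n}\to\mathcal A_\infty$. Grade $L_{2n}$ by $\mathbb Z$, giving vertices and blue edges degree $0$, red edges degree $1$, and $e^*$ the degree $-\deg e$; the component of degree $d$ of $\mathcal A_\infty$ consists of the images of the elements of the algebras $\mathcal A_{2n}$ which are homogeneous of degree $d$ in $L_{2n}$. **Groupoid.** $\mathcal G(X,\sigma)=\{(x,m-n,y): m,n\in\mathbb N,\ x,y\in X,\ \sigma^m(x)=\sigma^n(y)\}$, with range $x$, source $y$, product $(x,d,y)(y,d',z)=(x,d+d',z)$, inverse $(x,d,y)^{-1}=(y,-d,x)$, and the topology generated by the sets $Z(U,m,n,V)=\{(x,m-n,y): x\in U,\ y\in V,\ \sigma^m(x)=\sigma^n(y)\}$ for $U,V\subseteq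 X$ open. Its Steinberg algebra $A_K(\mathcal G(X,\sigma))$ is the $*$-algebra of locally constant functions $f\colon\mathcal G(X,\sigma)\to K$ with compact support, with $(f*g)(\gamma)=\sum_{s(\alpha)=s(\gamma)}f(\gamma\alpha^{-1})g(\alpha)$ and $f^*(\gamma)=\overline{f(\gamma^{-1})}$, where the bar is the involution of $K$; its component of degree $d$ consists of the functions supported on elements $(x,d,y)$. **Theorem.** There is a $*$-isomorphism of $K$-algebras $\varphi\colon\mathcal A_\infty\to A_K(\mathcal G(X,\sigma))$ which satisfies, for all $n\ge0$, all $U \in\mathcal P_{2n}$, and all edges $e,f$ of $F_{2n}$ with the same source $W\in\mathcal P_{2n+1}$ and with ranges $r(e)=U$, $r(f)=V$: - $\varphi(\phi_{n,\infty}(p_U))=\mathbb 1_{Z(U,0,0,U)}$; - $\varphi(\phi_{n,\infty}(ef^*))=\mathbb 1_{Z(W,0,0,W)}$ if $e,f$ are blue; - $\varphi(\phi_{n,\infty}(ef^*))=\mathbb 1_{Z(U\cap\sigma^{-1}(W),1,1,V\cap\sigma^{-1}(W))}$ if $e,f$ are red; - $\varphi(\phi_{n,\infty}(ef^*))=\mathbb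 1_{Z(U\cap\sigma^{-1}(W),1,0,W)}$ if $e$ is red and $f$ is blue; - $\varphi(\phi_{n,\infty}(ef^*))=\mathbb 1_{Z(W,0,1,V\cap\sigma^{-1}(W))}$ if $e$ is blue and $f$ is red. It is the only $*$-homomorphism $\mathcal A_\infty\to A_K(\mathcal G(X,\sigma))$ with these properties. Moreover $\varphi$ is graded: for all $d\in\mathbb Z$ and $a\in\mathcal A_\infty$, the element $a$ is homogeneous of degree $d$ if and only if $\varphi(a)$ is. -/

import Mathlib

universe u v w

set_option linter.unusedSectionVars false

/-- A finitely separated graph `(E, C)`: a directed graph with vertex set `V` and edge set `E`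
together with, for every vertex `v`, a partition `C v` of `r ⁻¹ (v)` into pairwise disjoint,
non-empty, finite sets. -/
structure SepGraph where
  V : Type u
  E : Type u
  r : E → V
  s : E → V
  C : V → Set (Finset E)
  nonempty_of_mem : ∀ v, ∀ Y ∈ C v, Y.Nonempty
  pairwiseDisjoint : ∀ v, (C v).PairwiseDisjoint id
  exists_mem_iff : ∀ v e, (∃ Y ∈ C v, e ∈ Y) ↔ r e = v

/-- The generators `E⁰ ⊔ E¹ ⊔ (E¹)^*` of the Leavitt path algebra. -/
inductive SepGraph.Gen (G : SepGraph.{u}) : Type u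
  | vertex (v : G.V)
  | edge (e : G.E)
  | ghost (e : G.E)

namespace LPA

open SepGraph.Gen

variable (K : Type v) [Field K] (G : SepGraph.{u}) [Fintype G.V]

/-- Generator of the free algebra. -/
abbrev fgen (x : G.Gen) : FreeAlgebra K G.Gen := FreeAlgebra.ι K x

/-- The defining relations (V), (E), (SCK1), (SCK2) of the Leavitt path algebra, and their adjoints.
The vertex set is finite, so the sum of all vertices is a unit for the (a priori non-unital)
algebra presented by these relations; as we present it as a unital algebra, this is recorded in
the relation `unit`. -/
inductive Rel : FreeAlgebra K G.Gen → FreeAlgebra K G.Gen → Prop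
  | vertex_mul_self (v : G.V) :
      Rel (fgen K G (vertex v) * fgen K G (vertex v)) (fgen K G (vertex v))
  | vertex_mul_ne (v w : G.V) (h : v ≠ w) :
      Rel (fgen K G (vertex v) * fgen K G (vertex w)) 0
  | range_mul (e : G.E) : Rel (fgen K G (vertex (G.r e)) * fgen K G (edge e)) (fgen K G (edge e))
  | mul_source (e : G.E) : Rel (fgen K G (edge e) * fgen K G (vertex (G.s e))) (fgen K G (edge e))
  | ghost_mul_range (e : G.E) :
      Rel (fgen K G (ghost e) * fgen K G (vertex (G.r e))) (fgen K G (ghost e))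
  | source_mul_ghost (e : G.E) :
      Rel (fgen K G (vertex (G.s e)) * fgen K G (ghost e)) (fgen K G (ghost e))
  | ghost_mul_self (e : G.E) :
      Rel (fgen K G (ghost e) * fgen K G (edge e)) (fgen K G (vertex (G.s e)))
  | ghost_mul_ne (v : G.V) (Y : Finset G.E) (hY : Y ∈ G.C v) (e f : G.E) (he : e ∈ Y) (hf : f ∈ Y)
      (h : e ≠ f) : Rel (fgen K G (ghost e) * fgen K G (edge f)) 0
  | sum_edge_mul_ghost (v : G.V) (Y : Finset G.E) (hY : Y ∈ G.C v) :
      Rel (∑ e ∈ Y, fgen K G (edge e) * fgen K G (ghost e)) (fgen K G (vertex v))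
  | unit : Rel (∑ v : G.V, fgen K G (vertex v)) 1

end LPA

/-- The Leavitt path algebra `L_K(E, C)` of a finitely separated graph with finitely many
vertices. -/
def LPA (K : Type v) [Field K] (G : SepGraph.{u}) [Fintype G.V] : Type (max u v) :=
  RingQuot (LPA.Rel K G)

namespace LPA

open SepGraph.Gen

section basic

variable (K : Type v) [Field K] (G : SepGraph.{u}) [Fintype G.V]

noncomputable instance : Ring (LPA K G) := inferInstanceAs (Ring (RingQuot (LPA.Rel K G)))

noncomputable instance : Algebra K (LPA K G) :=
  inferInstanceAs (Algebra K (RingQuot (LPA.Rel K G)))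

/-- The quotient map from the free algebra. -/
noncomputable def mk : FreeAlgebra K G.Gen →ₐ[K] LPA K G := RingQuot.mkAlgHom K (LPA.Rel K G)

/-- The generators as elements of the Leavitt path algebra. -/
noncomputable def gen (x : G.Gen) : LPA K G := mk K G (fgen K G x)

variable {K G}

theorem mk_rel {a b : FreeAlgebra K G.Gen} (h : Rel K G a b) : mk K G a = mk K G b :=
  RingQuot.mkAlgHom_rel K h

theorem gen_vertex_mul_self (v : G.V) :
    gen K G (vertex v) * gen K G (vertex v) = gen K G (vertex v) := by
  simpa [gen] using mk_rel (Rel.vertex_mul_self (K := K) v)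

theorem gen_vertex_mul_ne {v w : G.V} (h : v ≠ w) :
    gen K G (vertex v) * gen K G (vertex w) = 0 := by
  simpa [gen] using mk_rel (Rel.vertex_mul_ne (K := K) v w h)

theorem gen_range_mul (e : G.E) :
    gen K G (vertex (G.r e)) * gen K G (edge e) = gen K G (edge e) := by
  simpa [gen] using mk_rel (Rel.range_mul (K := K) e)

theorem gen_mul_source (e : G.E) :
    gen K G (edge e) * gen K G (vertex (G.s e)) = gen K G (edge e) := by
  simpa [gen] using mk_rel (Rel.mul_source (K := K) e)

theorem gen_ghost_mul_range (e : G.E) :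
    gen K G (ghost e) * gen K G (vertex (G.r e)) = gen K G (ghost e) := by
  simpa [gen] using mk_rel (Rel.ghost_mul_range (K := K) e)

theorem gen_source_mul_ghost (e : G.E) :
    gen K G (vertex (G.s e)) * gen K G (ghost e) = gen K G (ghost e) := by
  simpa [gen] using mk_rel (Rel.source_mul_ghost (K := K) e)

theorem gen_ghost_mul_self (e : G.E) :
    gen K G (ghost e) * gen K G (edge e) = gen K G (vertex (G.s e)) := by
  simpa [gen] using mk_rel (Rel.ghost_mul_self (K := K) e)

theorem gen_ghost_mul_ne {v : G.V} {Y : Finset G.E} (hY : Y ∈ G.C v) {e f : G.E} (he : e ∈ Y)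
    (hf : f ∈ Y) (h : e ≠ f) : gen K G (ghost e) * gen K G (edge f) = 0 := by
  simpa [gen] using mk_rel (Rel.ghost_mul_ne (K := K) v Y hY e f he hf h)

theorem gen_sum {v : G.V} {Y : Finset G.E} (hY : Y ∈ G.C v) :
    ∑ e ∈ Y, gen K G (edge e) * gen K G (ghost e) = gen K G (vertex v) := by
  simpa [gen] using mk_rel (Rel.sum_edge_mul_ghost (K := K) v Y hY)

theorem gen_unit : ∑ v : G.V, gen K G (vertex v) = 1 := by
  simpa [gen] using mk_rel (Rel.unit (K := K) (G := G))

theorem ind {p : LPA K G → Prop} (h0 : ∀ c, p (algebraMap K _ c)) (h1 : ∀ x, p (gen K G x))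
    (h2 : ∀ a b, p a → p b → p (a * b)) (h3 : ∀ a b, p a → p b → p (a + b)) (a : LPA K G) :
    p a := by
  obtain ⟨a, rfl⟩ := RingQuot.mkAlgHom_surjective K (LPA.Rel K G) a
  change p (mk K G a)
  induction a using FreeAlgebra.induction with
  | grade0 c => simpa using h0 c
  | grade1 x => exact h1 x
  | mul a b ha hb => simpa using h2 _ _ ha hb
  | add a b ha hb => simpa using h3 _ _ ha hb

end basic

section star

variable {K : Type v} [Field K] [StarRing K] {G : SepGraph.{u}} [Fintype G.V]

/-- The opposite algebra with scalars acting through the involution of `K`; algebra homomorphisms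
into it are conjugate-linear anti-homomorphisms. -/
def ConjOp (A : Type w) : Type w := Aᵐᵒᵖ

instance (A : Type w) [Ring A] : Ring (ConjOp A) := inferInstanceAs (Ring Aᵐᵒᵖ)

instance (A : Type w) [Ring A] [Algebra K A] : Algebra K (ConjOp A) :=
  RingHom.toAlgebra' (R := K) (S := ConjOp A)
    ((algebraMap K Aᵐᵒᵖ).comp (starRingEnd K) : K →+* Aᵐᵒᵖ)
    fun c x => Algebra.commutes (A := Aᵐᵒᵖ) (starRingEnd K c) x

/-- The identity map `ConjOp A → A`, an additive map reversing products. -/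
def ConjOp.un (A : Type w) [Ring A] : ConjOp A ≃+ A :=
  (MulOpposite.opAddEquiv (α := A)).symm

theorem ConjOp.un_mul {A : Type w} [Ring A] (x y : ConjOp A) :
    ConjOp.un A (x * y) = ConjOp.un A y * ConjOp.un A x := rfl

theorem ConjOp.un_one {A : Type w} [Ring A] : ConjOp.un A 1 = 1 := rfl

theorem ConjOp.un_algebraMap {A : Type w} [Ring A] [Algebra K A] (c : K) :
    ConjOp.un A (algebraMap K _ c) = algebraMap K A (star c) := rfl

/-- The involution on generators: it fixes vertices and exchanges `e` and `e^*`. -/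
def genStar {G : SepGraph.{u}} : G.Gen → G.Gen
  | vertex v => vertex v
  | edge e => ghost e
  | ghost e => edge e

/-- The involution of the Leavitt path algebra as a homomorphism to `ConjOp`. -/
noncomputable def starAux : LPA K G →ₐ[K] ConjOp (LPA K G) :=
  RingQuot.liftAlgHom K
    ⟨FreeAlgebra.lift K fun x => (ConjOp.un (LPA K G)).symm (gen K G (genStar x)), by
    intro a b h
    apply (ConjOp.un (LPA K G)).injective
    cases h with
    | vertex_mul_self v => simpa [ConjOp.un_mul, genStar] using gen_vertex_mul_self v
    | vertex_mul_ne v w h => simpa [ConjOp.un_mul, genStar] using gen_vertex_mul_ne h.symm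
    | range_mul e => simpa [ConjOp.un_mul, genStar] using gen_ghost_mul_range e
    | mul_source e => simpa [ConjOp.un_mul, genStar] using gen_source_mul_ghost e
    | ghost_mul_range e => simpa [ConjOp.un_mul, genStar] using gen_range_mul e
    | source_mul_ghost e => simpa [ConjOp.un_mul, genStar] using gen_mul_source e
    | ghost_mul_self e => simpa [ConjOp.un_mul, genStar] using gen_ghost_mul_self e
    | ghost_mul_ne v Y hY e f he hf h =>
      simpa [ConjOp.un_mul, genStar] using gen_ghost_mul_ne hY hf he h.symm
    | sum_edge_mul_ghost v Y hY => simpa [ConjOp.un_mul, genStar] using gen_sum hY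
    | unit => simpa [ConjOp.un_one, genStar] using gen_unit⟩

noncomputable instance : Star (LPA K G) := ⟨fun a => ConjOp.un _ (starAux a)⟩

theorem star_gen (x : G.Gen) : star (gen K G x) = gen K G (genStar x) := by
  refine (congrArg (ConjOp.un (LPA K G))
    ((RingQuot.liftAlgHom_mkAlgHom_apply K _ _ _).trans (FreeAlgebra.lift_ι_apply _ _))).trans ?_
  simp

theorem star_mul' (a b : LPA K G) : star (a * b) = star b * star a := by
  change ConjOp.un _ (starAux _) = _
  rw [map_mul]; rfl

theorem star_add' (a b : LPA K G) : star (a + b) = star a + star b := by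
  change ConjOp.un _ (starAux _) = _
  rw [map_add]; rfl

theorem star_algebraMap (c : K) :
    star (algebraMap K (LPA K G) c) = algebraMap K (LPA K G) (star c) := by
  change ConjOp.un _ (starAux _) = _
  rw [AlgHom.commutes]; rfl

/-- The conjugate-linear involution of `L_K(E, C)` with `v^* = v` and `(e)^* = e^*`. -/
noncomputable instance : StarRing (LPA K G) where
  star_involutive a := by
    induction a using LPA.ind with
    | h0 c => rw [star_algebraMap, star_algebraMap, star_star]
    | h1 x => rw [star_gen, star_gen]; cases x <;> rfl
    | h2 a b ha hb => rw [star_mul', star_mul', ha, hb]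
    | h3 a b ha hb => rw [star_add', star_add', ha, hb]
  star_mul := star_mul'
  star_add := star_add'

noncomputable instance : StarModule K (LPA K G) where
  star_smul c a := by
    rw [Algebra.smul_def, Algebra.smul_def, star_mul, star_algebraMap, ← Algebra.commutes]

end star

section elements

variable (K : Type v) [Field K] (G : SepGraph.{u}) [Fintype G.V]

/-- A vertex as an element of `L_K(E, C)`. -/
noncomputable def vtx (v : G.V) : LPA K G := gen K G (vertex v)

/-- An edge as an element of `L_K(E, C)`. -/
noncomputable def edg (e : G.E) : LPA K G := gen K G (edge e)

variable {K G}

theorem vtx_mul_self (v : G.V) : vtx K G v * vtx K G v = vtx K G v := gen_vertex_mul_self v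

theorem vtx_mul_ne {v w : G.V} (h : v ≠ w) : vtx K G v * vtx K G w = 0 := gen_vertex_mul_ne h

theorem range_mul_edg (e : G.E) : vtx K G (G.r e) * edg K G e = edg K G e := gen_range_mul e

theorem edg_mul_source (e : G.E) : edg K G e * vtx K G (G.s e) = edg K G e := gen_mul_source e

theorem sum_vtx : ∑ v : G.V, vtx K G v = 1 := gen_unit

variable [StarRing K]

theorem star_vtx (v : G.V) : star (vtx K G v) = vtx K G v := star_gen _

theorem star_edg (e : G.E) : star (edg K G e) = gen K G (ghost e) := star_gen _

theorem star_edg_mul_edg (e : G.E) : star (edg K G e) * edg K G e = vtx K G (G.s e) := by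
  rw [star_edg]; exact gen_ghost_mul_self e

theorem star_edg_mul_edg_ne {v : G.V} {Y : Finset G.E} (hY : Y ∈ G.C v) {e f : G.E} (he : e ∈ Y)
    (hf : f ∈ Y) (h : e ≠ f) : star (edg K G e) * edg K G f = 0 := by
  rw [star_edg]; exact gen_ghost_mul_ne hY he hf h

theorem sum_edg_mul_star {v : G.V} {Y : Finset G.E} (hY : Y ∈ G.C v) :
    ∑ e ∈ Y, edg K G e * star (edg K G e) = vtx K G v := by
  simp only [star_edg]; exact gen_sum hY

end elements

section lift

variable {K : Type v} [Field K] [StarRing K] {G : SepGraph.{u}} [Fintype G.V]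

/-- A family of elements of a *-algebra satisfying the defining relations of `L_K(E, C)`. -/
structure Family (G : SepGraph.{u}) [Fintype G.V] (A : Type w) [Ring A] [StarRing A] where
  p : G.V → A
  x : G.E → A
  star_p : ∀ v, star (p v) = p v
  p_mul_self : ∀ v, p v * p v = p v
  p_mul_ne : ∀ v w, v ≠ w → p v * p w = 0
  range_mul : ∀ e, p (G.r e) * x e = x e
  mul_source : ∀ e, x e * p (G.s e) = x e
  star_mul_self : ∀ e, star (x e) * x e = p (G.s e)
  star_mul_ne : ∀ v, ∀ Y ∈ G.C v, ∀ e ∈ Y, ∀ f ∈ Y, e ≠ f → star (x e) * x f = 0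
  sum_mul_star : ∀ v, ∀ Y ∈ G.C v, ∑ e ∈ Y, x e * star (x e) = p v
  sum_p : ∑ v, p v = 1

variable {A : Type w} [Ring A] [StarRing A] [Algebra K A]

/-- The images of the generators under the homomorphism determined by a family. -/
def Family.onGen (F : Family G A) : G.Gen → A
  | vertex v => F.p v
  | edge e => F.x e
  | ghost e => star (F.x e)

/-- The algebra homomorphism determined by a family. -/
noncomputable def Family.algHom (F : Family G A) : LPA K G →ₐ[K] A :=
  RingQuot.liftAlgHom K ⟨FreeAlgebra.lift K F.onGen, by
    intro a b h
    cases h with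
    | vertex_mul_self v => simpa [Family.onGen] using F.p_mul_self v
    | vertex_mul_ne v w h => simpa [Family.onGen] using F.p_mul_ne v w h
    | range_mul e => simpa [Family.onGen] using F.range_mul e
    | mul_source e => simpa [Family.onGen] using F.mul_source e
    | ghost_mul_range e =>
      simpa [Family.onGen, F.star_p] using congrArg star (F.range_mul e)
    | source_mul_ghost e =>
      simpa [Family.onGen, F.star_p] using congrArg star (F.mul_source e)
    | ghost_mul_self e => simpa [Family.onGen] using F.star_mul_self e
    | ghost_mul_ne v Y hY e f he hf h =>
      simpa [Family.onGen] using F.star_mul_ne v Y hY e he f hf h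
    | sum_edge_mul_ghost v Y hY => simpa [Family.onGen] using F.sum_mul_star v Y hY
    | unit => simpa [Family.onGen] using F.sum_p⟩

theorem Family.algHom_gen (F : Family G A) (x : G.Gen) :
    F.algHom (gen K G x) = F.onGen x :=
  (RingQuot.liftAlgHom_mkAlgHom_apply K _ _ _).trans (FreeAlgebra.lift_ι_apply _ _)

/-- The *-homomorphism `L_K(E, C) → A` determined by a family. -/
noncomputable def Family.hom [StarModule K A] (F : Family G A) : LPA K G →⋆ₐ[K] A where
  __ := F.algHom
  map_star' a := by
    change F.algHom (star a) = star (F.algHom a)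
    induction a using LPA.ind with
    | h0 c => rw [star_algebraMap, AlgHom.commutes, AlgHom.commutes, algebraMap_star_comm]
    | h1 x =>
      rw [star_gen, F.algHom_gen, F.algHom_gen]
      cases x <;> simp [Family.onGen, genStar, F.star_p]
    | h2 a b ha hb => rw [star_mul, map_mul, map_mul, star_mul, ha, hb]
    | h3 a b ha hb => rw [star_add, map_add, map_add, star_add, ha, hb]

theorem Family.hom_vtx [StarModule K A] (F : Family G A) (v : G.V) :
    F.hom (vtx K G v) = F.p v := F.algHom_gen _

theorem Family.hom_edg [StarModule K A] (F : Family G A) (e : G.E) :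
    F.hom (edg K G e) = F.x e := F.algHom_gen _

end lift

section grading

variable (K : Type v) [Field K] (G : SepGraph.{u}) [Fintype G.V]

/-- The degree of a generator when edges have degree `deg`: vertices have degree `0` and `e^*` has
degree `- deg e`. -/
def genDeg {G : SepGraph.{u}} (deg : G.E → ℤ) : G.Gen → ℤ
  | vertex _ => 0
  | edge e => deg e
  | ghost e => - deg e

/-- The homogeneous component of degree `d` of `L_K(E, C)` for the grading in which edges have
degree `deg`: the span of all words in the generators of total degree `d`. -/
noncomputable def component (deg : G.E → ℤ) (d : ℤ) : Submodule K (LPA K G) :=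
  Submodule.span K
    {a | ∃ l : List G.Gen, (l.map (genDeg deg)).sum = d ∧ (l.map (gen K G)).prod = a}

end grading

end LPA

/-! ### Bipartite separated graphs and corners -/

/-- A bipartite finitely separated graph, with vertex set `V₀ ⊔ V₁`, and with `r (E) = V₀` and
`s (E) = V₁`. -/
structure LayerGraph (V₀ V₁ : Type u) where
  E : Type u
  r : E → V₀
  s : E → V₁
  C : V₀ → Set (Finset E)
  nonempty_of_mem : ∀ v, ∀ Y ∈ C v, Y.Nonempty
  pairwiseDisjoint : ∀ v, (C v).PairwiseDisjoint id
  exists_mem_iff : ∀ v e, (∃ Y ∈ C v, e ∈ Y) ↔ r e = v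
  r_surjective : Function.Surjective r
  s_surjective : Function.Surjective s

namespace LayerGraph

variable {V₀ V₁ : Type u}

/-- The separated graph with vertex set `V₀ ⊔ V₁`. -/
def toSepGraph (Γ : LayerGraph V₀ V₁) : SepGraph.{u} where
  V := V₀ ⊕ V₁
  E := Γ.E
  r e := Sum.inl (Γ.r e)
  s e := Sum.inr (Γ.s e)
  C := Sum.elim Γ.C fun _ => ∅
  nonempty_of_mem v := by
    cases v with
    | inl v => exact Γ.nonempty_of_mem v
    | inr w => simp
  pairwiseDisjoint v := by
    cases v with
    | inl v => exact Γ.pairwiseDisjoint v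
    | inr w => simp
  exists_mem_iff v e := by
    cases v with
    | inl v => simpa using Γ.exists_mem_iff v e
    | inr w => simp

instance [Fintype V₀] [Fintype V₁] (Γ : LayerGraph V₀ V₁) : Fintype Γ.toSepGraph.V :=
  inferInstanceAs (Fintype (V₀ ⊕ V₁))

variable (K : Type v) [Field K] [Fintype V₀] [Fintype V₁] (Γ : LayerGraph V₀ V₁)

/-- The Leavitt path algebra of a bipartite separated graph. -/
abbrev L : Type (max u v) := LPA K Γ.toSepGraph

/-- The vertex `v ∈ V₀` in the Leavitt path algebra. -/
noncomputable def v₀ (v : V₀) : Γ.L K := LPA.vtx K Γ.toSepGraph (Sum.inl v)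

/-- The vertex `w ∈ V₁` in the Leavitt path algebra. -/
noncomputable def v₁ (w : V₁) : Γ.L K := LPA.vtx K Γ.toSepGraph (Sum.inr w)

/-- The edge `e` in the Leavitt path algebra. -/
noncomputable def ed (e : Γ.E) : Γ.L K := LPA.edg K Γ.toSepGraph e

/-- The projection `p = ∑ v`, where `v` runs over `V₀`. -/
noncomputable def p : Γ.L K := ∑ v : V₀, Γ.v₀ K v

theorem sum_v₀_add_sum_v₁ : ∑ v : V₀, Γ.v₀ K v + ∑ w : V₁, Γ.v₁ K w = 1 := by
  rw [← LPA.sum_vtx (K := K) (G := Γ.toSepGraph)]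
  exact (Fintype.sum_sum_type (LPA.vtx K Γ.toSepGraph)).symm

theorem v₀_mul_self (v : V₀) : Γ.v₀ K v * Γ.v₀ K v = Γ.v₀ K v := LPA.vtx_mul_self _

theorem v₁_mul_self (v : V₁) : Γ.v₁ K v * Γ.v₁ K v = Γ.v₁ K v := LPA.vtx_mul_self _

theorem v₀_mul_ne {v w : V₀} (h : v ≠ w) : Γ.v₀ K v * Γ.v₀ K w = 0 :=
  LPA.vtx_mul_ne fun h' => h (Sum.inl.inj h')

theorem v₁_mul_ne {v w : V₁} (h : v ≠ w) : Γ.v₁ K v * Γ.v₁ K w = 0 :=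
  LPA.vtx_mul_ne fun h' => h (Sum.inr.inj h')

theorem v₀_mul_v₁ (v : V₀) (w : V₁) : Γ.v₀ K v * Γ.v₁ K w = 0 :=
  LPA.vtx_mul_ne Sum.inl_ne_inr

theorem v₁_mul_v₀ (w : V₁) (v : V₀) : Γ.v₁ K w * Γ.v₀ K v = 0 :=
  LPA.vtx_mul_ne Sum.inr_ne_inl

theorem r_mul_ed (e : Γ.E) : Γ.v₀ K (Γ.r e) * Γ.ed K e = Γ.ed K e := LPA.range_mul_edg _

theorem ed_mul_s (e : Γ.E) : Γ.ed K e * Γ.v₁ K (Γ.s e) = Γ.ed K e := LPA.edg_mul_source _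

theorem p_mul_v₀ (v : V₀) : Γ.p K * Γ.v₀ K v = Γ.v₀ K v := by
  classical
  rw [p, Finset.sum_mul, Finset.sum_eq_single v, v₀_mul_self]
  · exact fun w _ h => Γ.v₀_mul_ne K h
  · simp

theorem v₀_mul_p (v : V₀) : Γ.v₀ K v * Γ.p K = Γ.v₀ K v := by
  classical
  rw [p, Finset.mul_sum, Finset.sum_eq_single v, v₀_mul_self]
  · exact fun w _ h => Γ.v₀_mul_ne K h.symm
  · simp

theorem p_mul_p : Γ.p K * Γ.p K = Γ.p K := by
  conv_lhs => rhs; rw [p]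
  rw [Finset.mul_sum]
  simp only [p_mul_v₀]
  rfl

theorem p_mul_ed (e : Γ.E) : Γ.p K * Γ.ed K e = Γ.ed K e := by
  rw [← r_mul_ed, ← mul_assoc, p_mul_v₀]

section star

variable [StarRing K]

theorem star_v₀ (v : V₀) : star (Γ.v₀ K v) = Γ.v₀ K v := LPA.star_vtx _

theorem star_v₁ (w : V₁) : star (Γ.v₁ K w) = Γ.v₁ K w := LPA.star_vtx _

theorem star_p : star (Γ.p K) = Γ.p K := by simp [p, star_v₀]

theorem s_mul_star_ed (e : Γ.E) : Γ.v₁ K (Γ.s e) * star (Γ.ed K e) = star (Γ.ed K e) := by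
  rw [← star_v₁, ← star_mul, ed_mul_s]

theorem star_ed_mul_r (e : Γ.E) : star (Γ.ed K e) * Γ.v₀ K (Γ.r e) = star (Γ.ed K e) := by
  rw [← star_v₀, ← star_mul, r_mul_ed]

theorem star_ed_mul_p (e : Γ.E) : star (Γ.ed K e) * Γ.p K = star (Γ.ed K e) := by
  rw [← star_p, ← star_mul, p_mul_ed]

theorem star_ed_mul_ed (e : Γ.E) : star (Γ.ed K e) * Γ.ed K e = Γ.v₁ K (Γ.s e) :=
  LPA.star_edg_mul_edg _

theorem star_ed_mul_ed_ne {v : V₀} {Y : Finset Γ.E} (hY : Y ∈ Γ.C v) {e f : Γ.E} (he : e ∈ Y)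
    (hf : f ∈ Y) (h : e ≠ f) : star (Γ.ed K e) * Γ.ed K f = 0 :=
  LPA.star_edg_mul_edg_ne (v := Sum.inl v) hY he hf h

theorem sum_ed_mul_star {v : V₀} {Y : Finset Γ.E} (hY : Y ∈ Γ.C v) :
    ∑ e ∈ Y, Γ.ed K e * star (Γ.ed K e) = Γ.v₀ K v :=
  LPA.sum_edg_mul_star (G := Γ.toSepGraph) (v := Sum.inl v) hY

/-- The corner `p L_K(E, C) p`, as a *-subalgebra of `L_K(E, C)`. -/
def corner : NonUnitalStarSubalgebra K (Γ.L K) where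
  carrier := Set.range fun b => Γ.p K * b * Γ.p K
  zero_mem' := ⟨0, by simp⟩
  add_mem' := by
    rintro _ _ ⟨a, rfl⟩ ⟨b, rfl⟩
    exact ⟨a + b, by simp [mul_add, add_mul]⟩
  mul_mem' := by
    rintro _ _ ⟨a, rfl⟩ ⟨b, rfl⟩
    exact ⟨a * Γ.p K * (Γ.p K * b), by simp only [mul_assoc]⟩
  smul_mem' := by
    rintro c _ ⟨a, rfl⟩
    exact ⟨c • a, by simp⟩
  star_mem' := by
    rintro _ ⟨a, rfl⟩
    exact ⟨star a, by simp [star_p, mul_assoc]⟩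

theorem mem_corner {a : Γ.L K} (h₁ : Γ.p K * a = a) (h₂ : a * Γ.p K = a) : a ∈ Γ.corner K :=
  ⟨a, by simp only [h₁, h₂]⟩

/-- The vertex `v ∈ V₀` as an element of the corner. -/
noncomputable def cv (v : V₀) : Γ.corner K :=
  ⟨Γ.v₀ K v, Γ.mem_corner K (Γ.p_mul_v₀ K v) (Γ.v₀_mul_p K v)⟩

/-- The element `e f^*` of the corner. -/
noncomputable def τ (e f : Γ.E) : Γ.corner K :=
  ⟨Γ.ed K e * star (Γ.ed K f), Γ.mem_corner K (by rw [← mul_assoc, p_mul_ed])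
    (by rw [mul_assoc, star_ed_mul_p])⟩

end star

end LayerGraph

/-! ### Homomorphisms between Leavitt path algebras of consecutive layers -/

/-- The combinatorial data for connecting two consecutive layers: for every vertex `v` a member
`B v` of the separation at `v`, and for each edge `e` of the first layer a member `X e` of the
separation at the vertex `s e` of the second one, such that for each `Y ∈ C v` the assignment
`(e, e') ↦ s e'` is a bijection from `{(e, e') | e ∈ Y, e' ∈ X e}` onto a set `S v` not depending
on `Y`, and the sets `S v` form a partition of the last vertex set. -/
structure LayerMap {V₀ V₁ V₂ : Type u} (Γ : LayerGraph V₀ V₁) (Δ : LayerGraph V₁ V₂) where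
  B : V₀ → Finset Γ.E
  X : Γ.E → Finset Δ.E
  S : V₀ → Set V₂
  B_mem : ∀ v, B v ∈ Γ.C v
  X_mem : ∀ e, X e ∈ Δ.C (Γ.s e)
  s_mem : ∀ e, ∀ e' ∈ X e, Δ.s e' ∈ S (Γ.r e)
  exists_of_mem : ∀ v, ∀ Y ∈ Γ.C v, ∀ w ∈ S v, ∃ e ∈ Y, ∃ e' ∈ X e, Δ.s e' = w
  inj : ∀ v, ∀ Y ∈ Γ.C v, ∀ e ∈ Y, ∀ f ∈ Y, ∀ e' ∈ X e, ∀ f' ∈ X f, Δ.s e' = Δ.s f' →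
    e = f ∧ e' = f'
  exists_mem : ∀ w, ∃ v, w ∈ S v
  unique : ∀ w v v', w ∈ S v → w ∈ S v' → v = v'

namespace LayerMap

variable {V₀ V₁ V₂ : Type u} {Γ : LayerGraph V₀ V₁} {Δ : LayerGraph V₁ V₂} (M : LayerMap Γ Δ)
variable (K : Type v) [Field K] [Fintype V₀] [Fintype V₁] [Fintype V₂]

/-- The image of a vertex `v ∈ V₀`: the sum `∑_{e ∈ B v} ∑_{e' ∈ X e} s(e')`. -/
noncomputable def imV (v : V₀) : Δ.L K := ∑ e ∈ M.B v, ∑ e' ∈ M.X e, Δ.v₁ K (Δ.s e')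

open Classical in
theorem sum_eq {v : V₀} {Y : Finset Γ.E} (hY : Y ∈ Γ.C v) :
    ∑ e ∈ Y, ∑ e' ∈ M.X e, Δ.v₁ K (Δ.s e') = ∑ w with w ∈ M.S v, Δ.v₁ K w := by
  rw [Finset.sum_sigma']
  refine Finset.sum_bij (fun x _ => Δ.s x.2) ?_ ?_ ?_ ?_
  · rintro ⟨e, e'⟩ h
    simp only [Finset.mem_sigma] at h
    have hr : Γ.r e = v := (Γ.exists_mem_iff v e).1 ⟨Y, hY, h.1⟩
    simpa [← hr] using M.s_mem e e' h.2
  · rintro ⟨e, e'⟩ h ⟨f, f'⟩ h' heq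
    simp only [Finset.mem_sigma] at h h' heq
    obtain ⟨rfl, rfl⟩ := M.inj v Y hY e h.1 f h'.1 e' h.2 f' h'.2 heq
    rfl
  · intro w hw
    obtain ⟨e, he, e', he', h⟩ := M.exists_of_mem v Y hY w (by simpa using hw)
    exact ⟨⟨e, e'⟩, by simp [he, he'], h⟩
  · intros; rfl

open Classical in
theorem imV_eq (v : V₀) : M.imV K v = ∑ w with w ∈ M.S v, Δ.v₁ K w := M.sum_eq K (M.B_mem v)

theorem sum_imV : ∑ v, M.imV K v = ∑ w, Δ.v₁ K w := by
  classical
  simp only [imV_eq, Finset.sum_filter]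
  rw [Finset.sum_comm]
  refine Finset.sum_congr rfl fun w _ => ?_
  obtain ⟨v, hv⟩ := M.exists_mem w
  rw [Finset.sum_eq_single v, if_pos hv]
  · intro v' _ h
    exact if_neg fun h' => h (M.unique w _ _ h' hv)
  · simp

theorem v₁_mul_imV {v : V₀} {w : V₂} (h : w ∈ M.S v) : Δ.v₁ K w * M.imV K v = Δ.v₁ K w := by
  classical
  rw [imV_eq, Finset.mul_sum, Finset.sum_eq_single w, LayerGraph.v₁_mul_self]
  · exact fun w' _ h => Δ.v₁_mul_ne K h.symm
  · intro h'; simp [h] at h'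

theorem v₁_mul_imV_of_notMem {v : V₀} {w : V₂} (h : w ∉ M.S v) : Δ.v₁ K w * M.imV K v = 0 := by
  classical
  rw [imV_eq, Finset.mul_sum]
  refine Finset.sum_eq_zero fun w' hw' => Δ.v₁_mul_ne K ?_
  rintro rfl
  exact h (by simpa using hw')

variable [StarRing K]

/-- The image of an edge `e`: the sum of the ghost edges `(e')^*`, for `e' ∈ X e`. -/
noncomputable def imE (e : Γ.E) : Δ.L K := ∑ e' ∈ M.X e, star (Δ.ed K e')

theorem star_imV (v : V₀) : star (M.imV K v) = M.imV K v := by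
  simp [imV, LayerGraph.star_v₁]

theorem star_imE (e : Γ.E) : star (M.imE K e) = ∑ e' ∈ M.X e, Δ.ed K e' := by simp [imE]

theorem imV_mul_v₁ {v : V₀} {w : V₂} (h : w ∈ M.S v) : M.imV K v * Δ.v₁ K w = Δ.v₁ K w := by
  rw [← M.star_imV, ← Δ.star_v₁ K, ← star_mul, M.v₁_mul_imV K h]

theorem imV_mul_self (v : V₀) : M.imV K v * M.imV K v = M.imV K v := by
  classical
  conv_lhs => lhs; rw [imV_eq]
  rw [Finset.sum_mul, imV_eq]
  refine Finset.sum_congr rfl fun w hw => ?_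
  rw [← imV_eq, M.v₁_mul_imV K (by simpa using hw)]

theorem imV_mul_ne {v v' : V₀} (h : v ≠ v') : M.imV K v * M.imV K v' = 0 := by
  classical
  conv_lhs => lhs; rw [imV_eq]
  rw [Finset.sum_mul]
  refine Finset.sum_eq_zero fun w hw => M.v₁_mul_imV_of_notMem K fun hw' => h ?_
  exact M.unique w _ _ (by simpa using hw) hw'

theorem imV_mul_v₀ (v : V₀) (w : V₁) : M.imV K v * Δ.v₀ K w = 0 := by
  classical
  rw [imV_eq, Finset.sum_mul]
  exact Finset.sum_eq_zero fun _ _ => Δ.v₁_mul_v₀ K _ _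

theorem v₀_mul_imV (v : V₀) (w : V₁) : Δ.v₀ K w * M.imV K v = 0 := by
  classical
  rw [imV_eq, Finset.mul_sum]
  exact Finset.sum_eq_zero fun _ _ => Δ.v₀_mul_v₁ K _ _

theorem imV_mul_imE (e : Γ.E) : M.imV K (Γ.r e) * M.imE K e = M.imE K e := by
  rw [imE, Finset.mul_sum]
  refine Finset.sum_congr rfl fun e' he' => ?_
  rw [← Δ.s_mul_star_ed K, ← mul_assoc, M.imV_mul_v₁ K (M.s_mem e e' he')]

theorem r_of_mem {e : Γ.E} {e' : Δ.E} (h : e' ∈ M.X e) : Δ.r e' = Γ.s e :=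
  (Δ.exists_mem_iff _ _).1 ⟨_, M.X_mem e, h⟩

theorem imE_mul_v₀ (e : Γ.E) : M.imE K e * Δ.v₀ K (Γ.s e) = M.imE K e := by
  rw [imE, Finset.sum_mul]
  refine Finset.sum_congr rfl fun e' he' => ?_
  rw [← M.r_of_mem he', Δ.star_ed_mul_r K]

theorem ed_mul_star_ed_ne {e' f' : Δ.E} (h : Δ.s e' ≠ Δ.s f') :
    Δ.ed K e' * star (Δ.ed K f') = 0 := by
  rw [← Δ.ed_mul_s K, ← Δ.s_mul_star_ed K, mul_assoc, ← mul_assoc (Δ.v₁ K _), Δ.v₁_mul_ne K h,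
    zero_mul, mul_zero]

theorem star_imE_mul_imE (e : Γ.E) : star (M.imE K e) * M.imE K e = Δ.v₀ K (Γ.s e) := by
  classical
  rw [star_imE, imE, Finset.sum_mul, ← Δ.sum_ed_mul_star K (M.X_mem e)]
  refine Finset.sum_congr rfl fun e' he' => ?_
  rw [Finset.mul_sum, Finset.sum_eq_single_of_mem e' he']
  intro f' hf' hne
  refine ed_mul_star_ed_ne K fun h => hne ?_
  obtain ⟨Y, hY, heY⟩ := (Γ.exists_mem_iff (Γ.r e) e).2 rfl
  exact (M.inj _ Y hY e heY e heY f' hf' e' he' h.symm).2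

theorem star_imE_mul_imE_ne {v : V₀} {Y : Finset Γ.E} (hY : Y ∈ Γ.C v) {e f : Γ.E} (he : e ∈ Y)
    (hf : f ∈ Y) (hne : e ≠ f) : star (M.imE K e) * M.imE K f = 0 := by
  rw [star_imE, imE, Finset.sum_mul]
  refine Finset.sum_eq_zero fun e' he' => ?_
  rw [Finset.mul_sum]
  refine Finset.sum_eq_zero fun f' hf' => ed_mul_star_ed_ne K fun h => hne ?_
  exact (M.inj _ Y hY e he f hf e' he' f' hf' h).1

theorem imE_mul_star_imE (e : Γ.E) :
    M.imE K e * star (M.imE K e) = ∑ e' ∈ M.X e, Δ.v₁ K (Δ.s e') := by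
  classical
  rw [star_imE, imE, Finset.sum_mul]
  refine Finset.sum_congr rfl fun e' he' => ?_
  rw [Finset.mul_sum, Finset.sum_eq_single_of_mem e' he', Δ.star_ed_mul_ed K]
  intro f' hf' hne
  exact Δ.star_ed_mul_ed_ne K (M.X_mem e) he' hf' hne.symm

/-- The images of the generators satisfy the defining relations. -/
noncomputable def family : LPA.Family Γ.toSepGraph (Δ.L K) where
  p := Sum.elim (M.imV K) (Δ.v₀ K)
  x := M.imE K
  star_p v := by
    cases v with
    | inl v => exact M.star_imV K v
    | inr w => exact Δ.star_v₀ K w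
  p_mul_self v := by
    cases v with
    | inl v => exact M.imV_mul_self K v
    | inr w => exact Δ.v₀_mul_self K w
  p_mul_ne v w h := by
    cases v with
    | inl v =>
      cases w with
      | inl w => exact M.imV_mul_ne K fun h' => h (congrArg _ h')
      | inr w => exact M.imV_mul_v₀ K v w
    | inr v =>
      cases w with
      | inl w => exact M.v₀_mul_imV K w v
      | inr w => exact Δ.v₀_mul_ne K fun h' => h (congrArg _ h')
  range_mul := M.imV_mul_imE K
  mul_source := M.imE_mul_v₀ K
  star_mul_self := M.star_imE_mul_imE K
  star_mul_ne v Y hY e he f hf hne := by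
    cases v with
    | inl v => exact M.star_imE_mul_imE_ne K hY he hf hne
    | inr w => exact absurd hY (Set.notMem_empty _)
  sum_mul_star v Y hY := by
    cases v with
    | inl v =>
      exact (Finset.sum_congr rfl fun e _ => M.imE_mul_star_imE K e).trans
        ((M.sum_eq K hY).trans (M.imV_eq K v).symm)
    | inr w => exact absurd hY (Set.notMem_empty _)
  sum_p := by
    refine (Fintype.sum_sum_type _).trans ?_
    simp only [Sum.elim_inl, Sum.elim_inr, M.sum_imV]
    rw [add_comm, Δ.sum_v₀_add_sum_v₁ K]

/-- The *-homomorphism between the Leavitt path algebras of consecutive layers, given by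
`v ↦ ∑_{e ∈ B v} ∑_{e' ∈ X e} s(e')` for `v ∈ V₀`, `w ↦ w` for `w ∈ V₁`, and
`e ↦ ∑_{e' ∈ X e} (e')^*` for an edge `e`. -/
noncomputable def hom : Γ.L K →⋆ₐ[K] Δ.L K := (M.family K).hom

theorem hom_v₀ (v : V₀) : M.hom K (Γ.v₀ K v) = ∑ e ∈ M.B v, ∑ e' ∈ M.X e, Δ.v₁ K (Δ.s e') :=
  (M.family K).hom_vtx _

theorem hom_v₁ (w : V₁) : M.hom K (Γ.v₁ K w) = Δ.v₀ K w := (M.family K).hom_vtx _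

theorem hom_ed (e : Γ.E) : M.hom K (Γ.ed K e) = ∑ e' ∈ M.X e, star (Δ.ed K e') :=
  (M.family K).hom_edg _

theorem hom_p : M.hom K (Γ.p K) = ∑ w, Δ.v₁ K w := by
  rw [LayerGraph.p, map_sum, ← M.sum_imV K]
  exact Finset.sum_congr rfl fun v _ => M.hom_v₀ K v

theorem hom_sum_v₁ : M.hom K (∑ w, Γ.v₁ K w) = Δ.p K := by
  rw [map_sum]
  exact Finset.sum_congr rfl fun v _ => M.hom_v₁ K v

end LayerMap

/-! ### Dynamical systems and refined sequences of partitions -/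

/-- A surjective local homeomorphism of a topological space onto itself. -/
structure LHomeo (X : Type u) [TopologicalSpace X] where
  σ : X → X
  isLocalHomeomorph : IsLocalHomeomorph σ
  surjective : Function.Surjective σ

/-- A partition of `X`: a finite family of non-empty, pairwise disjoint clopen sets covering `X`. -/
structure ClopenPartition (X : Type u) [TopologicalSpace X] where
  parts : Finset (Set X)
  nonempty_of_mem : ∀ Z ∈ parts, Z.Nonempty
  isClopen : ∀ Z ∈ parts, IsClopen Z
  pairwiseDisjoint : (parts : Set (Set X)).PairwiseDisjoint id
  cover : ∀ x, ∃ Z ∈ parts, x ∈ Z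

/-- The family `ℬ` is finer than `𝒜`: each member of `ℬ` is contained in a member of `𝒜`. -/
def Finer {X : Type u} (𝒜 ℬ : Set (Set X)) : Prop := ∀ Z ∈ ℬ, ∃ Z' ∈ 𝒜, Z ⊆ Z'

/-- The wedge `𝒜 ∨ ℬ`. -/
def wedge {X : Type u} (𝒜 ℬ : Set (Set X)) : Set (Set X) :=
  {W | W.Nonempty ∧ ∃ Z₁ ∈ 𝒜, ∃ Z₂ ∈ ℬ, W = Z₁ ∩ Z₂}

/-- The set of points with at least `i` preimages under `σ`. -/
def manyPreimages {X : Type u} (σ : X → X) (i : ℕ) : Set X := {x | (i : ℕ∞) ≤ (σ ⁻¹' {x}).encard}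

/-- The family `𝒜^σ`, consisting of the non-empty sets of the form
`σ(Z₁) ∩ ⋯ ∩ σ(Z_k) ∖ 𝒰_{≥ k+1}` for distinct `Z₁, …, Z_k ∈ 𝒜`, `k ≥ 1`. -/
def sigmaPartition {X : Type u} (σ : X → X) (𝒜 : Set (Set X)) : Set (Set X) :=
  {W | W.Nonempty ∧ ∃ T : Finset (Set X), (T : Set (Set X)) ⊆ 𝒜 ∧ T.Nonempty ∧
    W = (⋂ Z ∈ T, σ '' Z) \ manyPreimages σ (T.card + 1)}

/-- The family `σ⁻¹(𝒜)`. -/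
def preimagePartition {X : Type u} (σ : X → X) (𝒜 : Set (Set X)) : Set (Set X) :=
  (fun Z => σ ⁻¹' Z) '' 𝒜

/-- A `σ`-refined sequence of partitions of `X`. -/
structure SigmaRefined {X : Type u} [MetricSpace X] (S : LHomeo X) (P : ℕ → ClopenPartition X) :
    Prop where
  /-- `σ` restricts to a homeomorphism of each `Z ∈ 𝒫₀` onto its image. -/
  isEmbedding : ∀ Z ∈ (P 0).parts, Topology.IsEmbedding (Z.domRestrict S.σ)
  finer : ∀ n, Finer ((P n).parts : Set (Set X)) ((P (n + 1)).parts : Set (Set X))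
  generate : TopologicalSpace.generateFrom (⋃ n, ((P n).parts : Set (Set X))) =
    (inferInstance : TopologicalSpace X)
  diam : Filter.Tendsto (fun n => ⨆ Z : (P n).parts, Metric.diam (Z : Set X)) Filter.atTop (nhds 0)
  finer_odd : ∀ j, Finer
    (wedge ((P (2 * j)).parts : Set (Set X)) (sigmaPartition S.σ ((P (2 * j)).parts : Set (Set X))))
    ((P (2 * j + 1)).parts : Set (Set X))
  finer_even : ∀ j, Finer
    (wedge ((P (2 * j + 1)).parts : Set (Set X))
      (preimagePartition S.σ ((P (2 * j + 1)).parts : Set (Set X))))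
    ((P (2 * (j + 1))).parts : Set (Set X))

section partitions

variable {X : Type u}

theorem ClopenPartition.eq_of_mem [TopologicalSpace X] (Q : ClopenPartition X) {Z Z' : Set X}
    (hZ : Z ∈ Q.parts) (hZ' : Z' ∈ Q.parts) {x : X} (hx : x ∈ Z) (hx' : x ∈ Z') : Z = Z' := by
  by_contra h
  exact Set.disjoint_left.1 (Q.pairwiseDisjoint hZ hZ' h) hx hx'

/-- A member of `𝒫^σ` meeting `σ(Z)`, where `Z ∈ Q`, is contained in `σ(Z)`. -/
theorem subset_image_of_mem_sigmaPartition [TopologicalSpace X] (σ : X → X)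
    (Q : ClopenPartition X) {W Z : Set X}
    (hW : W ∈ sigmaPartition σ (Q.parts : Set (Set X))) (hZ : Z ∈ Q.parts) {y : X} (hy : y ∈ W)
    (hy' : y ∈ σ '' Z) : W ⊆ σ '' Z := by
  classical
  obtain ⟨_, T, hT, _, rfl⟩ := hW
  by_cases h : Z ∈ T
  · exact fun x hx => Set.mem_iInter₂.1 hx.1 Z h
  exfalso
  refine hy.2 ?_
  have hall : ∀ A : (insert Z T : Finset (Set X)), ∃ x ∈ (A : Set X), σ x = y := by
    rintro ⟨A, hA⟩
    rcases Finset.mem_insert.1 hA with rfl | hA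
    · exact hy'
    · exact Set.mem_iInter₂.1 hy.1 A hA
  have hmem : ∀ A ∈ (insert Z T : Finset (Set X)), A ∈ Q.parts := by
    intro A hA
    rcases Finset.mem_insert.1 hA with rfl | hA
    · exact hZ
    · exact hT hA
  choose g hg hgy using hall
  have hinj : Function.Injective g := by
    rintro ⟨A, hA⟩ ⟨A', hA'⟩ heq
    have h2 := hg ⟨A', hA'⟩
    rw [← heq] at h2
    exact Subtype.ext (Q.eq_of_mem (hmem A hA) (hmem A' hA') (hg ⟨A, hA⟩) h2)
  have h1 : (Set.range g).encard ≤ (σ ⁻¹' {y}).encard :=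
    Set.encard_le_encard (by rintro _ ⟨A, rfl⟩; exact hgy A)
  refine le_trans (le_of_eq ?_) h1
  rw [← Set.image_univ, hinj.encard_image, Set.encard_univ, ENat.card_eq_coe_fintype_card,
    Fintype.card_coe, Finset.card_insert_of_notMem h]

end partitions

namespace SigmaRefined

variable {X : Type u} [MetricSpace X] {S : LHomeo X} {P : ℕ → ClopenPartition X}

theorem subset_of_mem (h : SigmaRefined S P) {n : ℕ} {Z Z' : Set X} (hZ : Z ∈ (P n).parts)
    (hZ' : Z' ∈ (P (n + 1)).parts) {x : X} (hx : x ∈ Z) (hx' : x ∈ Z') : Z' ⊆ Z := by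
  obtain ⟨Z₁, hZ₁, hsub⟩ := h.finer n Z' hZ'
  rwa [(P n).eq_of_mem hZ hZ₁ hx (hsub hx')]

theorem injOn (h : SigmaRefined S P) (n : ℕ) : ∀ Z ∈ (P n).parts, Set.InjOn S.σ Z := by
  induction n with
  | zero => exact fun Z hZ => Set.injOn_iff_injective.2 (h.isEmbedding Z hZ).injective
  | succ n ih =>
    intro Z hZ
    obtain ⟨Z', hZ', hsub⟩ := h.finer n Z hZ
    exact (ih Z' hZ').mono hsub

theorem subset_image (h : SigmaRefined S P) {j : ℕ} {Z Z' : Set X}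
    (hZ : Z ∈ (P (2 * j)).parts) (hZ' : Z' ∈ (P (2 * j + 1)).parts) {y : X} (hy : y ∈ Z') (hy' : y ∈ S.σ '' Z) :
    Z' ⊆ S.σ '' Z := by
  obtain ⟨_, ⟨_, Z₁, _, W, hW, rfl⟩, hsub⟩ := h.finer_odd j Z' hZ'
  exact (hsub.trans Set.inter_subset_right).trans
    (subset_image_of_mem_sigmaPartition S.σ (P (2 * j)) hW hZ (hsub hy).2 hy')

theorem subset_preimage (h : SigmaRefined S P) {j : ℕ} {Z' Z'' : Set X}
    (hZ' : Z' ∈ (P (2 * j + 1)).parts)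
    (hZ'' : Z'' ∈ (P (2 * (j + 1))).parts) {x : X} (hx : x ∈ Z'') (hx' : S.σ x ∈ Z') :
    Z'' ⊆ S.σ ⁻¹' Z' := by
  obtain ⟨_, ⟨_, Z₁, _, _, ⟨W, hW, rfl⟩, rfl⟩, hsub⟩ := h.finer_even j Z'' hZ''
  have := (P (2 * j + 1)).eq_of_mem hZ' hW hx' (hsub hx).2
  subst this
  exact hsub.trans Set.inter_subset_right

end SigmaRefined

/-! ### The layers of the diagram associated with a refined sequence of partitions -/

section layers

variable {X : Type u} [MetricSpace X]

/-- Blue edges, from `Z' ∈ Q` to `Z ∈ P`, for `Z' ⊆ Z`. The pair is `(source, range)`. -/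
abbrev BlueEdge (Q P : ClopenPartition X) : Type u :=
  {q : Q.parts × P.parts // (q.1 : Set X) ⊆ q.2}

/-- Red edges at even layers, from `Z' ∈ Q` to `Z ∈ P`, for `Z' ⊆ σ(Z)`. -/
abbrev RedEdgeEven (S : LHomeo X) (Q P : ClopenPartition X) : Type u :=
  {q : Q.parts × P.parts // (q.1 : Set X) ⊆ S.σ '' q.2}

/-- Red edges at odd layers, from `Z'' ∈ Q` to `Z' ∈ P`, for `Z'' ⊆ σ⁻¹(Z')`. -/
abbrev RedEdgeOdd (S : LHomeo X) (Q P : ClopenPartition X) : Type u :=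
  {q : Q.parts × P.parts // (q.1 : Set X) ⊆ S.σ ⁻¹' q.2}

/-- Edges of an even layer. -/
abbrev EvenEdge (S : LHomeo X) (Q P : ClopenPartition X) : Type u :=
  BlueEdge Q P ⊕ RedEdgeEven S Q P

/-- Edges of an odd layer. -/
abbrev OddEdge (S : LHomeo X) (Q P : ClopenPartition X) : Type u :=
  BlueEdge Q P ⊕ RedEdgeOdd S Q P

variable (S : LHomeo X) (P : ℕ → ClopenPartition X) (j : ℕ)

open Classical in
/-- The set `B_Z` of blue edges with range `Z`, at an even layer. -/
noncomputable def evenB (Z : (P (2 * j)).parts) :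
    Finset (EvenEdge S (P (2 * j + 1)) (P (2 * j))) :=
  {e | ∃ q : BlueEdge (P (2 * j + 1)) (P (2 * j)), e = Sum.inl q ∧ q.1.2 = Z}

open Classical in
/-- The set `R_Z` of red edges with range `Z`, at an even layer. -/
noncomputable def evenR (Z : (P (2 * j)).parts) :
    Finset (EvenEdge S (P (2 * j + 1)) (P (2 * j))) :=
  {e | ∃ q : RedEdgeEven S (P (2 * j + 1)) (P (2 * j)), e = Sum.inr q ∧ q.1.2 = Z}

open Classical in
/-- The set `B_{Z'}` of blue edges with range `Z'`, at an odd layer. -/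
noncomputable def oddB (Z' : (P (2 * j + 1)).parts) :
    Finset (OddEdge S (P (2 * (j + 1))) (P (2 * j + 1))) :=
  {e | ∃ q : BlueEdge (P (2 * (j + 1))) (P (2 * j + 1)), e = Sum.inl q ∧ q.1.2 = Z'}

open Classical in
/-- For a red edge `f` of an even layer, the set `R(f)` of red edges `g` of the next layer such that
`r(g) = s(f)` and `s(g) ⊆ r(f)`. -/
noncomputable def oddR (f : RedEdgeEven S (P (2 * j + 1)) (P (2 * j))) :
    Finset (OddEdge S (P (2 * (j + 1))) (P (2 * j + 1))) :=
  {e | ∃ q : RedEdgeOdd S (P (2 * (j + 1))) (P (2 * j + 1)),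
    e = Sum.inr q ∧ q.1.2 = f.1.1 ∧ (q.1.1 : Set X) ⊆ f.1.2}

variable {S P}

/-- The even layer `(F_{2j}, D^{2j})`: its vertices are the members of `𝒫_{2j}` and of `𝒫_{2j+1}`,
and the separation at `Z ∈ 𝒫_{2j}` is `{B_Z, R_Z}`. -/
noncomputable def evenLayer (h : SigmaRefined S P) (j : ℕ) :
    LayerGraph (P (2 * j)).parts (P (2 * j + 1)).parts where
  E := EvenEdge S (P (2 * j + 1)) (P (2 * j))
  r := Sum.elim (fun q => q.1.2) (fun q => q.1.2)
  s := Sum.elim (fun q => q.1.1) (fun q => q.1.1)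
  C Z := {evenB S P j Z, evenR S P j Z}
  nonempty_of_mem := by
    rintro Z Y (rfl | rfl)
    · obtain ⟨x, hx⟩ := (P (2 * j)).nonempty_of_mem _ Z.2
      obtain ⟨Z', hZ', hx'⟩ := (P (2 * j + 1)).cover x
      exact ⟨Sum.inl ⟨(⟨Z', hZ'⟩, Z), h.subset_of_mem Z.2 hZ' hx hx'⟩, by simp [evenB]⟩
    · obtain ⟨x, hx⟩ := (P (2 * j)).nonempty_of_mem _ Z.2
      obtain ⟨Z', hZ', hx'⟩ := (P (2 * j + 1)).cover (S.σ x)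
      exact ⟨Sum.inr ⟨(⟨Z', hZ'⟩, Z), h.subset_image Z.2 hZ' hx' ⟨x, hx, rfl⟩⟩, by simp [evenR]⟩
  pairwiseDisjoint := by
    have key : ∀ Z, Disjoint (evenB S P j Z) (evenR S P j Z) := by
      intro Z
      rw [Finset.disjoint_left]
      intro e he he'
      simp only [evenB, evenR, Finset.mem_filter] at he he'
      obtain ⟨_, q, rfl, _⟩ := he
      obtain ⟨_, q', h', _⟩ := he'
      cases h'
    rintro Z Y (rfl | rfl) Y' (rfl | rfl) hne
    · exact absurd rfl hne
    · exact key Z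
    · exact (key Z).symm
    · exact absurd rfl hne
  exists_mem_iff := by
    intro Z e
    cases e with
    | inl q => simp [evenB, evenR]
    | inr q => simp [evenB, evenR]
  r_surjective := by
    intro Z
    obtain ⟨x, hx⟩ := (P (2 * j)).nonempty_of_mem _ Z.2
    obtain ⟨Z', hZ', hx'⟩ := (P (2 * j + 1)).cover x
    exact ⟨Sum.inl ⟨(⟨Z', hZ'⟩, Z), h.subset_of_mem Z.2 hZ' hx hx'⟩, rfl⟩
  s_surjective := by
    intro Z'
    obtain ⟨Z, hZ, hsub⟩ := h.finer (2 * j) _ Z'.2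
    exact ⟨Sum.inl ⟨(Z', ⟨Z, hZ⟩), hsub⟩, rfl⟩

/-- The odd layer `(F_{2j+1}, D^{2j+1})`: its vertices are the members of `𝒫_{2j+1}` and of
`𝒫_{2j+2}`, and the separation at `Z' ∈ 𝒫_{2j+1}` consists of `B_{Z'}` and of the sets `R(f)`, where
`f` runs over the red edges with source `Z'` of the previous layer. -/
noncomputable def oddLayer (h : SigmaRefined S P) (j : ℕ) :
    LayerGraph (P (2 * j + 1)).parts (P (2 * (j + 1))).parts where
  E := OddEdge S (P (2 * (j + 1))) (P (2 * j + 1))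
  r := Sum.elim (fun q => q.1.2) (fun q => q.1.2)
  s := Sum.elim (fun q => q.1.1) (fun q => q.1.1)
  C Z' := {oddB S P j Z'} ∪
    {Y | ∃ f : RedEdgeEven S (P (2 * j + 1)) (P (2 * j)), f.1.1 = Z' ∧ Y = oddR S P j f}
  nonempty_of_mem := by
    rintro Z' Y (rfl | ⟨f, rfl, rfl⟩)
    · obtain ⟨x, hx⟩ := (P (2 * j + 1)).nonempty_of_mem _ Z'.2
      obtain ⟨Z'', hZ'', hx'⟩ := (P (2 * (j + 1))).cover x
      exact ⟨Sum.inl ⟨(⟨Z'', hZ''⟩, Z'), h.subset_of_mem Z'.2 hZ'' hx hx'⟩, by simp [oddB]⟩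
    · obtain ⟨y, hy⟩ := (P (2 * j + 1)).nonempty_of_mem _ f.1.1.2
      obtain ⟨x, hx, rfl⟩ := f.2 hy
      obtain ⟨Z'', hZ'', hx'⟩ := (P (2 * (j + 1))).cover x
      obtain ⟨Z₁, hZ₁, hx₁⟩ := (P (2 * j + 1)).cover x
      refine ⟨Sum.inr ⟨(⟨Z'', hZ''⟩, f.1.1), h.subset_preimage f.1.1.2 hZ'' hx' hy⟩, ?_⟩
      simp only [oddR, Finset.mem_filter, Finset.mem_univ, true_and]
      exact ⟨_, rfl, rfl, (h.subset_of_mem hZ₁ hZ'' hx₁ hx').trans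
        (h.subset_of_mem f.1.2.2 hZ₁ hx hx₁)⟩
  pairwiseDisjoint := by
    have key : ∀ Z' f, Disjoint (oddB S P j Z') (oddR S P j f) := by
      intro Z f
      rw [Finset.disjoint_left]
      intro e he he'
      simp only [oddB, oddR, Finset.mem_filter] at he he'
      obtain ⟨_, q, rfl, _⟩ := he
      obtain ⟨_, q', h', _⟩ := he'
      cases h'
    rintro Z Y (rfl | ⟨f, hf, rfl⟩) Y' (rfl | ⟨f', hf', rfl⟩) hne
    · exact absurd rfl hne
    · exact key _ _
    · exact (key _ _).symm
    · rw [Function.onFun, id, id, Finset.disjoint_left]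
      intro e he he'
      simp only [oddR, Finset.mem_filter] at he he'
      obtain ⟨_, q, rfl, _, hq⟩ := he
      obtain ⟨_, q', h', _, hq'⟩ := he'
      obtain rfl := Sum.inr_injective h'
      obtain ⟨x, hx⟩ := (P (2 * (j + 1))).nonempty_of_mem _ q.1.1.2
      refine hne (congrArg _ (Subtype.ext (Prod.ext (hf.trans hf'.symm) (Subtype.ext ?_))))
      exact (P (2 * j)).eq_of_mem f.1.2.2 f'.1.2.2 (hq hx) (hq' hx)
  exists_mem_iff := by
    intro Z e
    constructor
    · rintro ⟨Y, (rfl | ⟨f, rfl, rfl⟩), he⟩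
      · simp only [oddB, Finset.mem_filter] at he
        obtain ⟨_, q, rfl, rfl⟩ := he
        rfl
      · simp only [oddR, Finset.mem_filter] at he
        obtain ⟨_, q, rfl, hq, _⟩ := he
        exact hq
    · rintro rfl
      cases e with
      | inl q =>
        refine ⟨_, Or.inl rfl, ?_⟩
        simp only [oddB, Finset.mem_filter, Finset.mem_univ, true_and]
        exact ⟨q, rfl, rfl⟩
      | inr q =>
        obtain ⟨x, hx⟩ := (P (2 * (j + 1))).nonempty_of_mem _ q.1.1.2
        obtain ⟨Z, hZ, hxZ⟩ := (P (2 * j)).cover x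
        obtain ⟨Z₁, hZ₁, hx₁⟩ := (P (2 * j + 1)).cover x
        refine ⟨_, Or.inr ⟨⟨(q.1.2, ⟨Z, hZ⟩),
          h.subset_image hZ q.1.2.2 (q.2 hx) ⟨x, hxZ, rfl⟩⟩, rfl, rfl⟩, ?_⟩
        simp only [oddR, Finset.mem_filter, Finset.mem_univ, true_and]
        exact ⟨q, rfl, rfl, (h.subset_of_mem hZ₁ q.1.1.2 hx₁ hx).trans
          (h.subset_of_mem hZ hZ₁ hxZ hx₁)⟩
  r_surjective := by
    intro Z'
    obtain ⟨x, hx⟩ := (P (2 * j + 1)).nonempty_of_mem _ Z'.2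
    obtain ⟨Z'', hZ'', hx'⟩ := (P (2 * (j + 1))).cover x
    exact ⟨Sum.inl ⟨(⟨Z'', hZ''⟩, Z'), h.subset_of_mem Z'.2 hZ'' hx hx'⟩, rfl⟩
  s_surjective := by
    intro Z''
    obtain ⟨Z', hZ', hsub⟩ := h.finer (2 * j + 1) _ Z''.2
    exact ⟨Sum.inl ⟨(Z'', ⟨Z', hZ'⟩), hsub⟩, rfl⟩

theorem mem_evenB {Z : (P (2 * j)).parts} {e : EvenEdge S (P (2 * j + 1)) (P (2 * j))} :
    e ∈ evenB S P j Z ↔ ∃ q : BlueEdge (P (2 * j + 1)) (P (2 * j)), e = Sum.inl q ∧ q.1.2 = Z := by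
  simp only [evenB, Finset.mem_filter, Finset.mem_univ, true_and]

theorem mem_evenR {Z : (P (2 * j)).parts} {e : EvenEdge S (P (2 * j + 1)) (P (2 * j))} :
    e ∈ evenR S P j Z ↔
      ∃ q : RedEdgeEven S (P (2 * j + 1)) (P (2 * j)), e = Sum.inr q ∧ q.1.2 = Z := by
  simp only [evenR, Finset.mem_filter, Finset.mem_univ, true_and]

theorem mem_oddB {Z' : (P (2 * j + 1)).parts}
    {e : OddEdge S (P (2 * (j + 1))) (P (2 * j + 1))} :
    e ∈ oddB S P j Z' ↔
      ∃ q : BlueEdge (P (2 * (j + 1))) (P (2 * j + 1)), e = Sum.inl q ∧ q.1.2 = Z' := by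
  simp only [oddB, Finset.mem_filter, Finset.mem_univ, true_and]

theorem mem_oddR {f : RedEdgeEven S (P (2 * j + 1)) (P (2 * j))}
    {e : OddEdge S (P (2 * (j + 1))) (P (2 * j + 1))} :
    e ∈ oddR S P j f ↔ ∃ q : RedEdgeOdd S (P (2 * (j + 1))) (P (2 * j + 1)),
      e = Sum.inr q ∧ q.1.2 = f.1.1 ∧ (q.1.1 : Set X) ⊆ f.1.2 := by
  simp only [oddR, Finset.mem_filter, Finset.mem_univ, true_and]

/-- The connecting data from an even layer to the next odd layer: a blue edge `e` is sent to
`B_{s(e)}`, and a red edge `f` to `R(f)`. -/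
noncomputable def evenMap (h : SigmaRefined S P) (j : ℕ) :
    LayerMap (evenLayer h j) (oddLayer h j) where
  B := evenB S P j
  X := Sum.elim (fun q => oddB S P j q.1.1) (fun f => oddR S P j f)
  S Z := {Z'' | (Z'' : Set X) ⊆ Z}
  B_mem Z := Or.inl rfl
  X_mem := by
    rintro (q | f)
    · exact Or.inl rfl
    · exact Or.inr ⟨f, rfl, rfl⟩
  s_mem := by
    rintro (q | f) e' he'
    · obtain ⟨q', rfl, h'⟩ := (mem_oddB j).1 he'
      refine q'.2.trans ?_
      rw [h']
      exact q.2
    · obtain ⟨q', rfl, _, h'⟩ := (mem_oddR j).1 he'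
      exact h'
  exists_of_mem := by
    rintro Z Y (rfl | rfl) Z'' hZ''
    · obtain ⟨x, hx⟩ := (P (2 * (j + 1))).nonempty_of_mem _ Z''.2
      obtain ⟨Z', hZ', hx'⟩ := (P (2 * j + 1)).cover x
      exact ⟨Sum.inl ⟨(⟨Z', hZ'⟩, Z), h.subset_of_mem Z.2 hZ' (hZ'' hx) hx'⟩,
        (mem_evenB j).2 ⟨_, rfl, rfl⟩,
        Sum.inl ⟨(Z'', ⟨Z', hZ'⟩), h.subset_of_mem hZ' Z''.2 hx' hx⟩,
        (mem_oddB j).2 ⟨_, rfl, rfl⟩, rfl⟩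
    · obtain ⟨x, hx⟩ := (P (2 * (j + 1))).nonempty_of_mem _ Z''.2
      obtain ⟨Z', hZ', hx'⟩ := (P (2 * j + 1)).cover (S.σ x)
      exact ⟨Sum.inr ⟨(⟨Z', hZ'⟩, Z), h.subset_image Z.2 hZ' hx' ⟨x, hZ'' hx, rfl⟩⟩,
        (mem_evenR j).2 ⟨_, rfl, rfl⟩,
        Sum.inr ⟨(Z'', ⟨Z', hZ'⟩), h.subset_preimage hZ' Z''.2 hx hx'⟩,
        (mem_oddR j).2 ⟨_, rfl, rfl, hZ''⟩, rfl⟩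
  inj := by
    rintro Z Y (rfl | rfl) e he f hf e' he' f' hf' heq
    · obtain ⟨⟨⟨Z₁, Z₂⟩, h₁⟩, rfl, rfl⟩ := (mem_evenB j).1 he
      obtain ⟨⟨⟨W₁, W₂⟩, h₂⟩, rfl, rfl⟩ := (mem_evenB j).1 hf
      obtain ⟨⟨⟨Z₃, Z₁⟩, h₃⟩, rfl, rfl⟩ := (mem_oddB j).1 he'
      obtain ⟨⟨⟨W₃, W₁⟩, h₄⟩, rfl, rfl⟩ := (mem_oddB j).1 hf'
      obtain rfl : Z₃ = W₃ := heq
      obtain ⟨x, hx⟩ := (P (2 * (j + 1))).nonempty_of_mem _ Z₃.2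
      obtain rfl : Z₁ = W₁ := Subtype.ext ((P (2 * j + 1)).eq_of_mem Z₁.2 W₁.2 (h₃ hx) (h₄ hx))
      exact ⟨rfl, rfl⟩
    · obtain ⟨⟨⟨Z₁, Z₂⟩, h₁⟩, rfl, rfl⟩ := (mem_evenR j).1 he
      obtain ⟨⟨⟨W₁, W₂⟩, h₂⟩, rfl, rfl⟩ := (mem_evenR j).1 hf
      obtain ⟨⟨⟨Z₃, Z₁⟩, h₃⟩, rfl, rfl, _⟩ := (mem_oddR j).1 he'
      obtain ⟨⟨⟨W₃, W₁⟩, h₄⟩, rfl, rfl, _⟩ := (mem_oddR j).1 hf'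
      obtain rfl : Z₃ = W₃ := heq
      obtain ⟨x, hx⟩ := (P (2 * (j + 1))).nonempty_of_mem _ Z₃.2
      obtain rfl : Z₁ = W₁ := Subtype.ext ((P (2 * j + 1)).eq_of_mem Z₁.2 W₁.2 (h₃ hx) (h₄ hx))
      exact ⟨rfl, rfl⟩
  exists_mem Z'' := by
    obtain ⟨Z', hZ', h₁⟩ := h.finer (2 * j + 1) _ Z''.2
    obtain ⟨Z, hZ, h₂⟩ := h.finer (2 * j) _ hZ'
    exact ⟨⟨Z, hZ⟩, h₁.trans h₂⟩
  unique := by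
    intro Z'' Z Z₁ h₁ h₂
    obtain ⟨x, hx⟩ := (P (2 * (j + 1))).nonempty_of_mem _ Z''.2
    exact Subtype.ext ((P (2 * j)).eq_of_mem Z.2 Z₁.2 (h₁ hx) (h₂ hx))

/-- The connecting data from an odd layer to the next even layer: a blue edge `e` is sent to
`B_{s(e)}`, and a red edge `f` to `R_{s(f)}`. -/
noncomputable def oddMap (h : SigmaRefined S P) (j : ℕ) :
    LayerMap (oddLayer h j) (evenLayer h (j + 1)) where
  B := oddB S P j
  X := Sum.elim (fun q => evenB S P (j + 1) q.1.1) (fun f => evenR S P (j + 1) f.1.1)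
  S Z' := {T | (T : Set X) ⊆ Z'}
  B_mem Z' := Or.inl rfl
  X_mem := by
    rintro (q | f)
    · exact Or.inl rfl
    · exact Or.inr rfl
  s_mem := by
    rintro (q | f) e' he'
    · obtain ⟨q', rfl, h'⟩ := (mem_evenB _).1 he'
      refine q'.2.trans ?_
      rw [h']
      exact q.2
    · obtain ⟨q', rfl, h'⟩ := (mem_evenR _).1 he'
      refine q'.2.trans ?_
      rw [h']
      exact Set.image_subset_iff.2 f.2
  exists_of_mem := by
    rintro Z' Y (rfl | ⟨g, rfl, rfl⟩) T hT
    · obtain ⟨x, hx⟩ := (P (2 * (j + 1) + 1)).nonempty_of_mem _ T.2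
      obtain ⟨Z'', hZ'', hx'⟩ := (P (2 * (j + 1))).cover x
      exact ⟨Sum.inl ⟨(⟨Z'', hZ''⟩, Z'), h.subset_of_mem Z'.2 hZ'' (hT hx) hx'⟩,
        (mem_oddB j).2 ⟨_, rfl, rfl⟩,
        Sum.inl ⟨(T, ⟨Z'', hZ''⟩), h.subset_of_mem hZ'' T.2 hx' hx⟩,
        (mem_evenB _).2 ⟨_, rfl, rfl⟩, rfl⟩
    · obtain ⟨y, hy⟩ := (P (2 * (j + 1) + 1)).nonempty_of_mem _ T.2
      obtain ⟨x, hx, rfl⟩ := g.2 (hT hy)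
      obtain ⟨Z'', hZ'', hx'⟩ := (P (2 * (j + 1))).cover x
      obtain ⟨Z₁, hZ₁, hx₁⟩ := (P (2 * j + 1)).cover x
      exact ⟨Sum.inr ⟨(⟨Z'', hZ''⟩, g.1.1), h.subset_preimage g.1.1.2 hZ'' hx' (hT hy)⟩,
        (mem_oddR j).2 ⟨_, rfl, rfl, (h.subset_of_mem hZ₁ hZ'' hx₁ hx').trans
          (h.subset_of_mem g.1.2.2 hZ₁ hx hx₁)⟩,
        Sum.inr ⟨(T, ⟨Z'', hZ''⟩), h.subset_image hZ'' T.2 hy ⟨x, hx', rfl⟩⟩,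
        (mem_evenR _).2 ⟨_, rfl, rfl⟩, rfl⟩
  inj := by
    rintro Z Y (rfl | ⟨g, rfl, rfl⟩) e he f hf e' he' f' hf' heq
    · obtain ⟨⟨⟨Z₁, Z₂⟩, h₁⟩, rfl, rfl⟩ := (mem_oddB j).1 he
      obtain ⟨⟨⟨W₁, W₂⟩, h₂⟩, rfl, rfl⟩ := (mem_oddB j).1 hf
      obtain ⟨⟨⟨Z₃, Z₁⟩, h₃⟩, rfl, rfl⟩ := (mem_evenB _).1 he'
      obtain ⟨⟨⟨W₃, W₁⟩, h₄⟩, rfl, rfl⟩ := (mem_evenB _).1 hf'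
      obtain rfl : Z₃ = W₃ := heq
      obtain ⟨x, hx⟩ := (P (2 * (j + 1) + 1)).nonempty_of_mem _ Z₃.2
      obtain rfl : Z₁ = W₁ :=
        Subtype.ext ((P (2 * (j + 1))).eq_of_mem Z₁.2 W₁.2 (h₃ hx) (h₄ hx))
      exact ⟨rfl, rfl⟩
    · obtain ⟨⟨⟨Z₁, Z₂⟩, h₁⟩, rfl, hZ₂, hZ₁⟩ := (mem_oddR j).1 he
      obtain ⟨⟨⟨W₁, W₂⟩, h₂⟩, rfl, hW₂, hW₁⟩ := (mem_oddR j).1 hf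
      obtain ⟨⟨⟨Z₃, Z₁⟩, h₃⟩, rfl, rfl⟩ := (mem_evenR _).1 he'
      obtain ⟨⟨⟨W₃, W₁⟩, h₄⟩, rfl, rfl⟩ := (mem_evenR _).1 hf'
      obtain rfl : Z₃ = W₃ := heq
      obtain rfl : Z₂ = W₂ := hZ₂.trans hW₂.symm
      obtain ⟨y, hy⟩ := (P (2 * (j + 1) + 1)).nonempty_of_mem _ Z₃.2
      obtain ⟨x, hx, hxy⟩ := h₃ hy
      obtain ⟨x', hx', hxy'⟩ := h₄ hy
      obtain rfl : x = x' :=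
        h.injOn _ _ g.1.2.2 (hZ₁ hx) (hW₁ hx') (hxy.trans hxy'.symm)
      obtain rfl : Z₁ = W₁ := Subtype.ext ((P (2 * (j + 1))).eq_of_mem Z₁.2 W₁.2 hx hx')
      exact ⟨rfl, rfl⟩
  exists_mem T := by
    obtain ⟨Z'', hZ'', h₁⟩ := h.finer (2 * (j + 1)) _ T.2
    obtain ⟨Z', hZ', h₂⟩ := h.finer (2 * j + 1) _ hZ''
    exact ⟨⟨Z', hZ'⟩, h₁.trans h₂⟩
  unique := by
    intro T Z Z₁ h₁ h₂
    obtain ⟨x, hx⟩ := (P (2 * (j + 1) + 1)).nonempty_of_mem _ T.2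
    exact Subtype.ext ((P (2 * j + 1)).eq_of_mem Z.2 Z₁.2 (h₁ hx) (h₂ hx))

end layers

/-! ### The colimit of the corners -/

section colimit

variable {X : Type u} [MetricSpace X] {S : LHomeo X} {P : ℕ → ClopenPartition X}
variable (K : Type v) [Field K] [StarRing K] (h : SigmaRefined S P)

/-- The composition `L_{2j} → L_{2j+1} → L_{2j+2}` of two consecutive connecting maps. -/
noncomputable def twoStep (j : ℕ) : (evenLayer h j).L K →⋆ₐ[K] (evenLayer h (j + 1)).L K :=
  ((oddMap h j).hom K).comp ((evenMap h j).hom K)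

theorem twoStep_p (j : ℕ) : twoStep K h j ((evenLayer h j).p K) = (evenLayer h (j + 1)).p K := by
  rw [twoStep, StarAlgHom.comp_apply, LayerMap.hom_p, LayerMap.hom_sum_v₁]

/-- The corner `𝒜_{2j} = p_{2j} L_K(F_{2j}, D^{2j}) p_{2j}`. -/
def CornerAlg (j : ℕ) : Type (max u v) := (evenLayer h j).corner K

namespace CornerAlg

noncomputable instance (j : ℕ) : NonUnitalRing (CornerAlg K h j) :=
  inferInstanceAs (NonUnitalRing ((evenLayer h j).corner K))

noncomputable instance (j : ℕ) : Module K (CornerAlg K h j) :=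
  inferInstanceAs (Module K ((evenLayer h j).corner K))

noncomputable instance (j : ℕ) : StarRing (CornerAlg K h j) :=
  inferInstanceAs (StarRing ((evenLayer h j).corner K))

instance (j : ℕ) : StarModule K (CornerAlg K h j) :=
  inferInstanceAs (StarModule K ((evenLayer h j).corner K))

instance (j : ℕ) : IsScalarTower K (CornerAlg K h j) (CornerAlg K h j) :=
  inferInstanceAs (IsScalarTower K ((evenLayer h j).corner K) ((evenLayer h j).corner K))

instance (j : ℕ) : SMulCommClass K (CornerAlg K h j) (CornerAlg K h j) :=
  inferInstanceAs (SMulCommClass K ((evenLayer h j).corner K) ((evenLayer h j).corner K))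

end CornerAlg

/-- The connecting map `φ_j : 𝒜_{2j} → 𝒜_{2j+2}`, a restriction of `L_{2j} → L_{2j+2}`. -/
noncomputable def connect (j : ℕ) : CornerAlg K h j →⋆ₙₐ[K] CornerAlg K h (j + 1) where
  toFun a := ⟨twoStep K h j a.1, by
    obtain ⟨_, b, rfl⟩ := a
    exact ⟨twoStep K h j b, by simp only [map_mul, twoStep_p]⟩⟩
  map_smul' c a := Subtype.ext (map_smul (twoStep K h j) c a.1)
  map_zero' := Subtype.ext (map_zero (twoStep K h j))
  map_add' a b := Subtype.ext (map_add (twoStep K h j) a.1 b.1)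
  map_mul' a b := Subtype.ext (map_mul (twoStep K h j) a.1 b.1)
  map_star' a := Subtype.ext (map_star (twoStep K h j) a.1)

/-- The iterated connecting maps `φ_{i,j} : 𝒜_{2i} → 𝒜_{2j}`, for `i ≤ j`. -/
noncomputable def transition (i j : ℕ) (hij : i ≤ j) : CornerAlg K h i →⋆ₙₐ[K] CornerAlg K h j :=
  Nat.leRec (motive := fun j _ => CornerAlg K h i →⋆ₙₐ[K] CornerAlg K h j) (NonUnitalStarAlgHom.id K (CornerAlg K h i))
    (fun k _ g => (connect K h k).comp g) hij

theorem transition_self (i : ℕ) : transition K h i i le_rfl = NonUnitalStarAlgHom.id K (CornerAlg K h i) :=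
  Nat.leRec_self _ _

theorem transition_succ (i j : ℕ) (hij : i ≤ j) :
    transition K h i (j + 1) (hij.trans (Nat.le_succ j)) =
      (connect K h j).comp (transition K h i j hij) :=
  Nat.leRec_succ _ _ hij

instance transition_directedSystem :
    DirectedSystem (CornerAlg K h) (fun i j hij => (transition K h i j hij : CornerAlg K h i → CornerAlg K h j)) where
  map_self i x := by rw [transition_self]; rfl
  map_map k j i hij hjk x := by
    induction k, hjk using Nat.le_induction with
    | base => rw [transition_self]; rfl
    | succ k hk ih =>
      rw [transition_succ K h j k hk, transition_succ K h i k (hij.trans hk),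
        NonUnitalStarAlgHom.comp_apply, ih]
      rfl

/-- The colimit `𝒜_∞` of the sequence of *-algebras `𝒜_{2j}`. -/
abbrev AInf : Type (max u v) := DirectLimit (CornerAlg K h) (transition K h)

noncomputable instance : NonUnitalRing (AInf K h) := inferInstance
noncomputable instance : Module K (AInf K h) := inferInstance
noncomputable instance : StarRing (AInf K h) := inferInstance
noncomputable instance : StarModule K (AInf K h) := inferInstance
noncomputable instance : IsScalarTower K (AInf K h) (AInf K h) := inferInstance
noncomputable instance : SMulCommClass K (AInf K h) (AInf K h) := inferInstance

variable {K h}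

/-- The canonical map `φ_{j,∞} : 𝒜_{2j} → 𝒜_∞`. -/
noncomputable def toAInf (j : ℕ) (a : CornerAlg K h j) : AInf K h := ⟦⟨j, a⟩⟧

end colimit

/-! ### The Deaconu–Renault groupoid -/

/-- The Deaconu–Renault groupoid `𝒢(X, σ)`: the triples `(x, m - n, y)` with
`σ^m (x) = σ^n (y)`. The range of `(x, d, y)` is `x`, its source is `y`, and its degree is `d`. -/
@[ext]
structure DRGroupoid {X : Type u} [TopologicalSpace X] (S : LHomeo X) : Type u where
  r : X
  deg : ℤ
  s : X
  exists_eq : ∃ m n : ℕ, deg = m - n ∧ S.σ^[m] r = S.σ^[n] s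

namespace DRGroupoid

variable {X : Type u} [TopologicalSpace X] {S : LHomeo X}

/-- The inverse `(x, d, y)⁻¹ = (y, -d, x)`. -/
def inv (γ : DRGroupoid S) : DRGroupoid S where
  r := γ.s
  deg := -γ.deg
  s := γ.r
  exists_eq := by
    obtain ⟨m, n, h, h'⟩ := γ.exists_eq
    exact ⟨n, m, by omega, h'.symm⟩

/-- The product `(x, d, y) (y, e, z) = (x, d + e, z)` of composable elements. -/
def mul (γ α : DRGroupoid S) (h : γ.s = α.r) : DRGroupoid S where
  r := γ.r
  deg := γ.deg + α.deg
  s := α.s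
  exists_eq := by
    obtain ⟨m, n, h₁, h₂⟩ := γ.exists_eq
    obtain ⟨k, l, h₃, h₄⟩ := α.exists_eq
    refine ⟨m + k, n + l, by push_cast; omega, ?_⟩
    rw [add_comm m k, Function.iterate_add_apply, h₂, h, ← Function.iterate_add_apply,
      add_comm k n, Function.iterate_add_apply, h₄, ← Function.iterate_add_apply]

variable (S) in
/-- The set `𝒵(U, m, n, V)` of all `(x, m - n, y)` with `x ∈ U`, `y ∈ V`, `σ^m (x) = σ^n (y)`. -/
def Z (U : Set X) (m n : ℕ) (V : Set X) : Set (DRGroupoid S) :=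
  {γ | γ.deg = m - n ∧ γ.r ∈ U ∧ γ.s ∈ V ∧ S.σ^[m] γ.r = S.σ^[n] γ.s}

/-- The topology generated by the sets `𝒵(U, m, n, V)`, for open `U` and `V`. -/
instance : TopologicalSpace (DRGroupoid S) :=
  TopologicalSpace.generateFrom {W | ∃ U m n V, IsOpen U ∧ IsOpen V ∧ W = Z S U m n V}

theorem inv_inv (γ : DRGroupoid S) : γ.inv.inv = γ := by
  ext <;> simp [inv]

theorem isOpen_Z {U V : Set X} (hU : IsOpen U) (hV : IsOpen V) (m n : ℕ) : IsOpen (Z S U m n V) :=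
  TopologicalSpace.isOpen_generateFrom_of_mem ⟨U, m, n, V, hU, hV, rfl⟩

theorem continuous_r : Continuous (r : DRGroupoid S → X) := by
  refine continuous_def.2 fun U hU => ?_
  have : (r : DRGroupoid S → X) ⁻¹' U = ⋃ m, ⋃ n, Z S U m n Set.univ := by
    ext γ
    simp only [Set.mem_preimage, Set.mem_iUnion]
    constructor
    · intro hγ
      obtain ⟨m, n, h, h'⟩ := γ.exists_eq
      exact ⟨m, n, h, hγ, trivial, h'⟩
    · rintro ⟨m, n, h⟩
      exact h.2.1
  rw [this]
  exact isOpen_iUnion fun m => isOpen_iUnion fun n => isOpen_Z hU isOpen_univ m n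

theorem continuous_s : Continuous (s : DRGroupoid S → X) := by
  refine continuous_def.2 fun V hV => ?_
  have : (s : DRGroupoid S → X) ⁻¹' V = ⋃ m, ⋃ n, Z S Set.univ m n V := by
    ext γ
    simp only [Set.mem_preimage, Set.mem_iUnion]
    constructor
    · intro hγ
      obtain ⟨m, n, h, h'⟩ := γ.exists_eq
      exact ⟨m, n, h, trivial, hγ, h'⟩
    · rintro ⟨m, n, h⟩
      exact h.2.2.1
  rw [this]
  exact isOpen_iUnion fun m => isOpen_iUnion fun n => isOpen_Z isOpen_univ hV m n

theorem continuous_deg : Continuous (deg : DRGroupoid S → ℤ) := by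
  refine continuous_def.2 fun D _ => ?_
  have : (deg : DRGroupoid S → ℤ) ⁻¹' D =
      ⋃ m : ℕ, ⋃ n : ℕ, ⋃ _ : (m : ℤ) - n ∈ D, Z S Set.univ m n Set.univ := by
    ext γ
    simp only [Set.mem_preimage, Set.mem_iUnion]
    constructor
    · intro hγ
      obtain ⟨m, n, h, h'⟩ := γ.exists_eq
      exact ⟨m, n, h ▸ hγ, h, trivial, trivial, h'⟩
    · rintro ⟨m, n, h, h'⟩
      exact h'.1 ▸ h
  rw [this]
  exact isOpen_iUnion fun m => isOpen_iUnion fun n => isOpen_iUnion fun _ =>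
    isOpen_Z isOpen_univ isOpen_univ m n

instance [T2Space X] : T2Space (DRGroupoid S) :=
  T2Space.of_injective_continuous (f := fun γ : DRGroupoid S => (γ.r, γ.deg, γ.s))
    (fun γ α h => by
      simp only [Prod.mk.injEq] at h
      exact DRGroupoid.ext h.1 h.2.1 h.2.2)
    (continuous_r.prodMk (continuous_deg.prodMk continuous_s))

theorem isLocalHomeomorph_iterate (S : LHomeo X) (m : ℕ) : IsLocalHomeomorph S.σ^[m] := by
  induction m with
  | zero => exact (Homeomorph.refl X).isLocalHomeomorph
  | succ m ih => exact ih.comp S.isLocalHomeomorph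

theorem exists_injOn (S : LHomeo X) (m : ℕ) (x : X) :
    ∃ U : Set X, IsOpen U ∧ x ∈ U ∧ Set.InjOn S.σ^[m] U := by
  obtain ⟨e, hx, he⟩ := isLocalHomeomorph_iterate S m x
  exact ⟨e.source, e.open_source, hx, he ▸ e.injOn⟩

theorem isCompact_Z [CompactSpace X] [T2Space X] {U V : Set X} (hU : IsClosed U) (hV : IsClosed V)
    (m n : ℕ) : IsCompact (Z S U m n V) := by
  have cont : ∀ k, Continuous S.σ^[k] := fun k => (isLocalHomeomorph_iterate S k).continuous
  let T : Set (X × X) := {p | p.1 ∈ U ∧ p.2 ∈ V ∧ S.σ^[m] p.1 = S.σ^[n] p.2}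
  have hT : IsCompact T := by
    refine IsClosed.isCompact ?_
    exact (hU.preimage continuous_fst).inter ((hV.preimage continuous_snd).inter
      (isClosed_eq ((cont m).comp continuous_fst) ((cont n).comp continuous_snd)))
  let F : T → DRGroupoid S := fun p => ⟨p.1.1, m - n, p.1.2, m, n, rfl, p.2.2.2⟩
  have hF : Continuous F := by
    refine continuous_generateFrom_iff.2 ?_
    rintro _ ⟨U', m', n', V', hU', hV', rfl⟩
    rw [isOpen_iff_mem_nhds]
    rintro p ⟨h₁, h₂, h₃, h₄⟩
    change (m : ℤ) - n = m' - n' at h₁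
    have hp₁ : Continuous fun q : T => q.1.1 := continuous_fst.comp continuous_subtype_val
    have hp₂ : Continuous fun q : T => q.1.2 := continuous_snd.comp continuous_subtype_val
    have e₁ := hp₁.continuousAt.preimage_mem_nhds (hU'.mem_nhds h₂)
    have e₂ := hp₂.continuousAt.preimage_mem_nhds (hV'.mem_nhds h₃)
    rcases le_total m m' with hm | hm
    · obtain ⟨k, rfl⟩ := Nat.exists_eq_add_of_le' hm
      obtain rfl : n' = k + n := by push_cast at h₁; omega
      filter_upwards [e₁, e₂] with q hq₁ hq₂
      refine ⟨h₁, hq₁, hq₂, ?_⟩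
      change S.σ^[k + m] q.1.1 = S.σ^[k + n] q.1.2
      rw [Function.iterate_add_apply, Function.iterate_add_apply, q.2.2.2]
    · obtain ⟨k, rfl⟩ := Nat.exists_eq_add_of_le' hm
      obtain rfl : n = k + n' := by push_cast at h₁; omega
      obtain ⟨O, hO, hxO, hinj⟩ := exists_injOn S k (S.σ^[m'] p.1.1)
      have e₃ := ((cont m').comp hp₁).continuousAt.preimage_mem_nhds (hO.mem_nhds hxO)
      have hxO' : S.σ^[n'] p.1.2 ∈ O := by
        change S.σ^[m'] p.1.1 = S.σ^[n'] p.1.2 at h₄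
        exact h₄ ▸ hxO
      have e₄ := ((cont n').comp hp₂).continuousAt.preimage_mem_nhds (hO.mem_nhds hxO')
      filter_upwards [e₁, e₂, e₃, e₄] with q hq₁ hq₂ hq₃ hq₄
      refine ⟨h₁, hq₁, hq₂, hinj hq₃ hq₄ ?_⟩
      have := q.2.2.2
      rwa [Function.iterate_add_apply, Function.iterate_add_apply] at this
  have : Z S U m n V = F '' Set.univ := by
    ext γ
    simp only [Set.mem_image, Set.mem_univ, true_and]
    constructor
    · rintro ⟨h₁, h₂, h₃, h₄⟩
      exact ⟨⟨(γ.r, γ.s), h₂, h₃, h₄⟩, DRGroupoid.ext rfl h₁.symm rfl⟩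
    · rintro ⟨p, rfl⟩
      exact ⟨rfl, p.2.1, p.2.2.1, p.2.2.2⟩
  rw [this]
  have : CompactSpace T := isCompact_iff_compactSpace.1 hT
  exact isCompact_univ.image hF

/-- The sets `𝒵(U, m, n, V)` with `U`, `V` clopen, `σ^m` injective on `U` and `σ^n` injective
on `V`. -/
def IsCyl (B : Set (DRGroupoid S)) : Prop :=
  ∃ U m n V, IsClopen U ∧ IsClopen V ∧ Set.InjOn S.σ^[m] U ∧ Set.InjOn S.σ^[n] V ∧ B = Z S U m n V

theorem IsCyl.isOpen {B : Set (DRGroupoid S)} (hB : IsCyl B) : IsOpen B := by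
  obtain ⟨U, m, n, V, hU, hV, _, _, rfl⟩ := hB
  exact isOpen_Z hU.isOpen hV.isOpen m n

theorem IsCyl.isCompact [CompactSpace X] [T2Space X] {B : Set (DRGroupoid S)} (hB : IsCyl B) :
    IsCompact B := by
  obtain ⟨U, m, n, V, hU, hV, _, _, rfl⟩ := hB
  exact isCompact_Z hU.isClosed hV.isClosed m n

theorem isCyl_empty : IsCyl (∅ : Set (DRGroupoid S)) :=
  ⟨∅, 0, 0, ∅, isClopen_empty, isClopen_empty, by simp, by simp, by ext; simp [Z]⟩

theorem Z_inter_Z {U V U' V' : Set X} (m n k : ℕ) :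
    Z S U m n V ∩ Z S U' (k + m) (k + n) V' = Z S (U ∩ U') m n (V ∩ V') := by
  ext γ
  constructor
  · rintro ⟨⟨h₁, h₂, h₃, h₄⟩, _, h₅, h₆, _⟩
    exact ⟨h₁, ⟨h₂, h₅⟩, ⟨h₃, h₆⟩, h₄⟩
  · rintro ⟨h₁, h₂, h₃, h₄⟩
    refine ⟨⟨h₁, h₂.1, h₃.1, h₄⟩, by push_cast; omega, h₂.2, h₃.2, ?_⟩
    rw [Function.iterate_add_apply, Function.iterate_add_apply, h₄]

theorem IsCyl.inter {B B' : Set (DRGroupoid S)} (hB : IsCyl B) (hB' : IsCyl B') :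
    IsCyl (B ∩ B') := by
  obtain ⟨U, m, n, V, hU, hV, hm, hn, rfl⟩ := hB
  obtain ⟨U', m', n', V', hU', hV', hm', hn', rfl⟩ := hB'
  by_cases hd : (m : ℤ) - n = m' - n'
  · rcases le_total m m' with h | h
    · obtain ⟨k, rfl⟩ := Nat.exists_eq_add_of_le' h
      obtain rfl : n' = k + n := by push_cast at hd; omega
      rw [Z_inter_Z]
      exact ⟨_, m, n, _, hU.inter hU', hV.inter hV', hm.mono Set.inter_subset_left,
        hn.mono Set.inter_subset_left, rfl⟩
    · obtain ⟨k, rfl⟩ := Nat.exists_eq_add_of_le' h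
      obtain rfl : n = k + n' := by push_cast at hd; omega
      rw [Set.inter_comm, Z_inter_Z]
      exact ⟨_, m', n', _, hU'.inter hU, hV'.inter hV, hm'.mono Set.inter_subset_left,
        hn'.mono Set.inter_subset_left, rfl⟩
  · convert isCyl_empty (S := S)
    ext γ
    simp only [Set.mem_inter_iff, Set.mem_empty_iff_false, iff_false]
    rintro ⟨h, h'⟩
    exact hd (h.1.symm.trans h'.1)

theorem exists_clopen [CompactSpace X] [T2Space X] [TotallyDisconnectedSpace X] (S : LHomeo X)
    (m : ℕ) {U : Set X} (hU : IsOpen U) {x : X} (hx : x ∈ U) :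
    ∃ U' : Set X, IsClopen U' ∧ x ∈ U' ∧ U' ⊆ U ∧ Set.InjOn S.σ^[m] U' := by
  obtain ⟨O, hO, hxO, hinj⟩ := exists_injOn S m x
  obtain ⟨U', hU', hxU', hsub⟩ := compact_exists_isClopen_in_isOpen (hU.inter hO) ⟨hx, hxO⟩
  exact ⟨U', hU', hxU', hsub.trans Set.inter_subset_left, hinj.mono (hsub.trans
    Set.inter_subset_right)⟩

theorem exists_isCyl [CompactSpace X] [T2Space X] [TotallyDisconnectedSpace X]
    {W : Set (DRGroupoid S)} (hW : IsOpen W) : ∀ γ ∈ W, ∃ B, IsCyl B ∧ γ ∈ B ∧ B ⊆ W := by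
  have key : ∀ {γ : DRGroupoid S} {U m n V}, IsOpen U → IsOpen V → γ ∈ Z S U m n V →
      ∃ B, IsCyl B ∧ γ ∈ B ∧ B ⊆ Z S U m n V := by
    rintro γ U m n V hU hV ⟨h₁, h₂, h₃, h₄⟩
    obtain ⟨U', hU', hxU, hsU, hiU⟩ := exists_clopen S m hU h₂
    obtain ⟨V', hV', hxV, hsV, hiV⟩ := exists_clopen S n hV h₃
    exact ⟨_, ⟨U', m, n, V', hU', hV', hiU, hiV, rfl⟩, ⟨h₁, hxU, hxV, h₄⟩,
      fun α hα => ⟨hα.1, hsU hα.2.1, hsV hα.2.2.1, hα.2.2.2⟩⟩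
  induction hW with
  | basic W hW =>
    obtain ⟨U, m, n, V, hU, hV, rfl⟩ := hW
    exact fun γ hγ => key hU hV hγ
  | univ =>
    intro γ _
    obtain ⟨m, n, h, h'⟩ := γ.exists_eq
    obtain ⟨B, hB, hγ, _⟩ := key isOpen_univ isOpen_univ
      (show γ ∈ Z S Set.univ m n Set.univ from ⟨h, trivial, trivial, h'⟩)
    exact ⟨B, hB, hγ, Set.subset_univ _⟩
  | inter W W' _ _ ih ih' =>
    rintro γ ⟨hγ, hγ'⟩
    obtain ⟨B, hB, hγB, hs⟩ := ih γ hγ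
    obtain ⟨B', hB', hγB', hs'⟩ := ih' γ hγ'
    exact ⟨B ∩ B', hB.inter hB', ⟨hγB, hγB'⟩, Set.inter_subset_inter hs hs'⟩
  | sUnion T _ ih =>
    rintro γ ⟨W, hW, hγ⟩
    obtain ⟨B, hB, hγB, hs⟩ := ih W hW γ hγ
    exact ⟨B, hB, hγB, hs.trans (Set.subset_sUnion_of_mem hW)⟩

/-- The product `A B = {α β | α ∈ A, β ∈ B, s(α) = r(β)}` of sets of groupoid elements. -/
def setMul (A B : Set (DRGroupoid S)) : Set (DRGroupoid S) :=
  {γ | ∃ α ∈ A, ∃ β ∈ B, ∃ h : α.s = β.r, γ = α.mul β h}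

theorem setMul_assoc (A B C : Set (DRGroupoid S)) :
    setMul (setMul A B) C = setMul A (setMul B C) := by
  ext γ
  constructor
  · rintro ⟨_, ⟨α, hα, β, hβ, h, rfl⟩, δ, hδ, h', rfl⟩
    exact ⟨α, hα, _, ⟨β, hβ, δ, hδ, h', rfl⟩, h, DRGroupoid.ext rfl (add_assoc _ _ _) rfl⟩
  · rintro ⟨α, hα, _, ⟨β, hβ, δ, hδ, h', rfl⟩, h, rfl⟩
    exact ⟨_, ⟨α, hα, β, hβ, h, rfl⟩, δ, hδ, h', DRGroupoid.ext rfl (add_assoc _ _ _).symm rfl⟩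

theorem setMul_inv (A B : Set (DRGroupoid S)) :
    inv ⁻¹' setMul A B = setMul (inv ⁻¹' B) (inv ⁻¹' A) := by
  ext γ
  constructor
  · rintro ⟨α, hα, β, hβ, h, heq⟩
    refine ⟨β.inv, by rwa [Set.mem_preimage, inv_inv], α.inv, by rwa [Set.mem_preimage, inv_inv],
      h.symm, ?_⟩
    rw [← inv_inv γ, heq]
    exact DRGroupoid.ext rfl (by simp only [inv, mul]; ring) rfl
  · rintro ⟨β, hβ, α, hα, h, rfl⟩
    exact ⟨α.inv, hα, β.inv, hβ, h.symm, DRGroupoid.ext rfl (by simp only [inv, mul]; ring) rfl⟩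

theorem inv_preimage_Z (U : Set X) (m n : ℕ) (V : Set X) :
    inv ⁻¹' Z S U m n V = Z S V n m U := by
  ext γ
  constructor
  · rintro ⟨h₁, h₂, h₃, h₄⟩
    simp only [inv] at h₁
    exact ⟨by omega, h₃, h₂, h₄.symm⟩
  · rintro ⟨h₁, h₂, h₃, h₄⟩
    exact ⟨by simp only [inv]; omega, h₃, h₂, h₄.symm⟩

theorem IsCyl.inv {B : Set (DRGroupoid S)} (hB : IsCyl B) : IsCyl (DRGroupoid.inv ⁻¹' B) := by
  obtain ⟨U, m, n, V, hU, hV, hm, hn, rfl⟩ := hB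
  exact ⟨V, n, m, U, hV, hU, hn, hm, inv_preimage_Z U m n V⟩

theorem IsCyl.injOn_s {B : Set (DRGroupoid S)} (hB : IsCyl B) : Set.InjOn s B := by
  obtain ⟨U, m, n, V, hU, hV, hm, hn, rfl⟩ := hB
  rintro γ ⟨h₁, h₂, _, h₄⟩ γ' ⟨h₁', h₂', _, h₄'⟩ h
  exact DRGroupoid.ext (hm h₂ h₂' (by rw [h₄, h₄', h])) (h₁.trans h₁'.symm) h

theorem setMul_Z [CompactSpace X] [T2Space X] {U V U' V' : Set X} (hU : IsClopen U)
    (hV : IsClopen V) (hU' : IsClopen U') (hV' : IsClopen V') (m n r n' : ℕ)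
    (hm : Set.InjOn S.σ^[m] U) (hm' : Set.InjOn S.σ^[r + n] U') (hn' : Set.InjOn S.σ^[n'] V') :
    IsCyl (setMul (Z S U m n V) (Z S U' (r + n) n' V')) := by
  have lh := isLocalHomeomorph_iterate S
  refine ⟨U ∩ S.σ^[m] ⁻¹' (S.σ^[n] '' (V ∩ U')), r + m, n', V', ?_, hV', ?_, hn', ?_⟩
  · refine hU.inter (IsClopen.preimage ⟨?_, ?_⟩ (lh m).continuous)
    · exact ((hV.inter hU').isClosed.isCompact.image (lh n).continuous).isClosed
    · exact (lh n).isOpenMap _ (hV.inter hU').isOpen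
  · rintro x ⟨hx, y, ⟨_, hy⟩, hxy⟩ x' ⟨hx', y', ⟨_, hy'⟩, hxy'⟩ h
    rw [Function.iterate_add_apply, Function.iterate_add_apply, ← hxy, ← hxy',
      ← Function.iterate_add_apply, ← Function.iterate_add_apply] at h
    refine hm hx hx' ?_
    rw [← hxy, ← hxy', hm' hy hy' h]
  · ext γ
    constructor
    · rintro ⟨α, ⟨h₁, h₂, h₃, h₄⟩, β, ⟨h₅, h₆, h₇, h₈⟩, h, rfl⟩
      refine ⟨?_, ⟨h₂, α.s, ⟨h₃, h ▸ h₆⟩, h₄.symm⟩, h₇, ?_⟩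
      · simp only [mul, h₁, h₅]; push_cast; ring
      · change S.σ^[r + m] α.r = S.σ^[n'] β.s
        rw [Function.iterate_add_apply, h₄, h, ← Function.iterate_add_apply, h₈]
    · rintro ⟨h₁, ⟨h₂, y, ⟨h₃, h₃'⟩, h₄⟩, h₅, h₆⟩
      have h₇ : S.σ^[r + n] y = S.σ^[n'] γ.s := by
        rw [Function.iterate_add_apply, h₄, ← Function.iterate_add_apply, h₆]
      refine ⟨⟨γ.r, m - n, y, m, n, rfl, h₄.symm⟩, ⟨rfl, h₂, h₃, h₄.symm⟩,
        ⟨y, (r + n : ℕ) - n', γ.s, r + n, n', rfl, h₇⟩, ⟨rfl, h₃', h₅, h₇⟩, rfl, ?_⟩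
      refine DRGroupoid.ext rfl ?_ rfl
      simp only [mul, h₁]; push_cast; ring

theorem IsCyl.mul [CompactSpace X] [T2Space X] {A B : Set (DRGroupoid S)} (hA : IsCyl A)
    (hB : IsCyl B) : IsCyl (setMul A B) := by
  obtain ⟨U, m, n, V, hU, hV, hm, hn, rfl⟩ := hA
  obtain ⟨U', m', n', V', hU', hV', hm', hn', rfl⟩ := hB
  rcases le_total n m' with h | h
  · obtain ⟨k, rfl⟩ := Nat.exists_eq_add_of_le' h
    exact setMul_Z hU hV hU' hV' m n k n' hm hm' hn'
  · obtain ⟨k, rfl⟩ := Nat.exists_eq_add_of_le' h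
    have := (setMul_Z hV' hU' hV hU n' m' k m hn' hn hm).inv
    rwa [setMul_inv, inv_preimage_Z, inv_preimage_Z] at this

end DRGroupoid

/-! ### The Steinberg algebra -/

section steinberg

open DRGroupoid

variable {X : Type u} [TopologicalSpace X] (K : Type v) [Field K] (S : LHomeo X)

/-- The locally constant functions with compact support `𝒢(X, σ) → K`. -/
def steinberg : Submodule K (DRGroupoid S → K) where
  carrier := {f | IsLocallyConstant f ∧ HasCompactSupport f}
  zero_mem' := ⟨IsLocallyConstant.const 0, HasCompactSupport.zero⟩
  add_mem' h h' := ⟨h.1.add h'.1, h.2.add h'.2⟩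
  smul_mem' c f h := ⟨h.1.comp (c • ·), h.2.mono fun γ hγ hf => hγ (by simp_all)⟩

/-- The Steinberg algebra `A_K(𝒢(X, σ))`. -/
def SteinbergAlgebra : Type (max u v) := steinberg K S

namespace SteinbergAlgebra

noncomputable instance : AddCommGroup (SteinbergAlgebra K S) :=
  inferInstanceAs (AddCommGroup (steinberg K S))

noncomputable instance : Module K (SteinbergAlgebra K S) :=
  inferInstanceAs (Module K (steinberg K S))

variable {K S}

instance : CoeFun (SteinbergAlgebra K S) fun _ => DRGroupoid S → K := ⟨Subtype.val⟩

@[ext]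
theorem ext {f g : SteinbergAlgebra K S} (h : ∀ γ, f γ = g γ) : f = g := Subtype.ext (funext h)

theorem zero_apply (γ : DRGroupoid S) : (0 : SteinbergAlgebra K S) γ = 0 := rfl

theorem add_apply (f g : SteinbergAlgebra K S) (γ : DRGroupoid S) : (f + g) γ = f γ + g γ := rfl

theorem smul_apply (c : K) (f : SteinbergAlgebra K S) (γ : DRGroupoid S) :
    (c • f) γ = c * f γ := rfl

open Classical in
/-- The characteristic function of a set. -/
noncomputable def ind (K : Type v) [Field K] {S : LHomeo X} (B : Set (DRGroupoid S)) :
    DRGroupoid S → K :=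
  fun γ => if γ ∈ B then 1 else 0

theorem ind_mem {B : Set (DRGroupoid S)} (hB : IsClopen B) (hB' : IsCompact B) :
    ind K B ∈ steinberg K S := by
  classical
  refine ⟨?_, ?_⟩
  · refine (IsLocallyConstant.iff_exists_open _).2 fun γ => ?_
    by_cases h : γ ∈ B
    · exact ⟨B, hB.isOpen, h, fun α hα => by simp [ind, h, hα]⟩
    · exact ⟨Bᶜ, hB.compl.isOpen, h, fun α hα => by simp [ind, h, show α ∉ B from hα]⟩
  · exact HasCompactSupport.intro' hB' hB.isClosed fun γ hγ => by simp [ind, hγ]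

section span

variable [CompactSpace X] [T2Space X]

theorem ind_mem_of_isCyl {B : Set (DRGroupoid S)} (hB : IsCyl B) : ind K B ∈ steinberg K S :=
  ind_mem ⟨hB.isCompact.isClosed, hB.isOpen⟩ hB.isCompact

variable (K S) in
/-- The span of the characteristic functions of cylinders. -/
def cylSpan : Submodule K (DRGroupoid S → K) :=
  Submodule.span K {f | ∃ B, IsCyl B ∧ f = ind K B}

theorem ind_mul_mem {B : Set (DRGroupoid S)} (hB : IsCyl B) {f : DRGroupoid S → K}
    (hf : f ∈ cylSpan K S) : (fun γ => ind K B γ * f γ) ∈ cylSpan K S := by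
  classical
  induction hf using Submodule.span_induction with
  | mem f hf =>
    obtain ⟨B', hB', rfl⟩ := hf
    refine Submodule.subset_span ⟨B ∩ B', hB.inter hB', ?_⟩
    funext γ
    by_cases h : γ ∈ B <;> by_cases h' : γ ∈ B' <;> simp [ind, h, h']
  | zero =>
    convert (cylSpan K S).zero_mem using 1
    funext γ
    simp
  | add f g _ _ ihf ihg =>
    convert (cylSpan K S).add_mem ihf ihg using 1
    funext γ
    simp [mul_add]
  | smul c f _ ih =>
    convert (cylSpan K S).smul_mem c ih using 1
    funext γ
    simp only [Pi.smul_apply, smul_eq_mul]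
    ring

/-- The Steinberg algebra is spanned by the characteristic functions of cylinders. -/
theorem steinberg_eq [TotallyDisconnectedSpace X] : steinberg K S = cylSpan K S := by
  classical
  refine le_antisymm ?_ (Submodule.span_le.2 ?_)
  · rintro f ⟨hf, hc⟩
    have h₁ : ∀ γ, ∃ B, IsCyl B ∧ γ ∈ B ∧ ∀ α ∈ B, f α = f γ := by
      intro γ
      obtain ⟨B, hB, hγ, hs⟩ := exists_isCyl (hf.isOpen_fiber (f γ)) γ rfl
      exact ⟨B, hB, hγ, hs⟩
    choose B hB hγB hfB using h₁
    have h₂ : ∀ t : Finset (DRGroupoid S),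
        (fun γ => if γ ∈ ⋃ α ∈ t, B α then f γ else 0) ∈ cylSpan K S := by
      intro t
      induction t using Finset.induction_on with
      | empty =>
        convert (cylSpan K S).zero_mem using 1
        funext γ
        simp
      | insert α t _ ih =>
        have i₁ := (cylSpan K S).smul_mem (f α) (Submodule.subset_span ⟨B α, hB α, rfl⟩)
        have i₂ := ind_mul_mem (hB α) ih
        convert (cylSpan K S).sub_mem ((cylSpan K S).add_mem i₁ ih) i₂ using 1
        funext γ
        simp only [Finset.mem_insert, Set.iUnion_iUnion_eq_or_left, Set.mem_union, Pi.sub_apply,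
          Pi.add_apply, Pi.smul_apply, smul_eq_mul, ind]
        by_cases h : γ ∈ B α
        · simp [h, hfB α γ h]
        · simp [h]
    obtain ⟨t, ht⟩ := hc.isCompact.elim_finite_subcover B (fun γ => (hB γ).isOpen)
      fun γ _ => Set.mem_iUnion.2 ⟨γ, hγB γ⟩
    convert h₂ t using 1
    funext γ
    by_cases h : γ ∈ ⋃ α ∈ t, B α
    · simp only [h, if_true]
    · simp only [h, if_false]
      exact image_eq_zero_of_notMem_tsupport fun h' => h (ht h')
  · rintro _ ⟨B, hB, rfl⟩
    exact ind_mem_of_isCyl hB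

/-- The characteristic function of a cylinder. -/
noncomputable def cyl (B : Set (DRGroupoid S)) (hB : IsCyl B) : SteinbergAlgebra K S :=
  ⟨ind K B, ind_mem_of_isCyl hB⟩

theorem induction [TotallyDisconnectedSpace X] {p : SteinbergAlgebra K S → Prop}
    (h₀ : p 0) (h₁ : ∀ B hB, p (cyl B hB)) (h₂ : ∀ f g, p f → p g → p (f + g))
    (h₃ : ∀ (c : K) f, p f → p (c • f)) (f : SteinbergAlgebra K S) : p f := by
  obtain ⟨f, hf⟩ := f
  suffices h : ∃ hf, p ⟨f, hf⟩ from h.2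
  rw [steinberg_eq] at hf
  induction hf using Submodule.span_induction with
  | mem f hf =>
    obtain ⟨B, hB, rfl⟩ := hf
    exact ⟨_, h₁ B hB⟩
  | zero => exact ⟨_, h₀⟩
  | add f g _ _ ihf ihg => exact ⟨_, h₂ _ _ ihf.2 ihg.2⟩
  | smul c f _ ih => exact ⟨_, h₃ c _ ih.2⟩

end span

/-- The element `γ α⁻¹`, for `α` with the same source as `γ`. -/
def divR (γ : DRGroupoid S) (α : {α : DRGroupoid S // α.s = γ.s}) : DRGroupoid S :=
  γ.mul α.1.inv α.2.symm

/-- The convolution product `(f * g)(γ) = ∑_{s(α) = s(γ)} f(γ α⁻¹) g(α)`. -/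
noncomputable def conv (f g : DRGroupoid S → K) : DRGroupoid S → K :=
  fun γ => ∑ᶠ α : {α : DRGroupoid S // α.s = γ.s}, f (divR γ α) * g α

/-- The involution `f^* (γ) = f(γ⁻¹)^*`. -/
def invol [StarRing K] (f : DRGroupoid S → K) : DRGroupoid S → K := fun γ => star (f γ.inv)

theorem divR_mem_iff {A : Set (DRGroupoid S)} {γ : DRGroupoid S}
    {α : {α : DRGroupoid S // α.s = γ.s}} :
    divR γ α ∈ A ↔ ∃ β ∈ A, ∃ h : β.s = α.1.r, γ = β.mul α h := by
  constructor
  · intro h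
    refine ⟨_, h, rfl, DRGroupoid.ext rfl ?_ α.2.symm⟩
    simp only [divR, DRGroupoid.mul, DRGroupoid.inv]
    ring
  · rintro ⟨β, hβ, h, h'⟩
    have hr := congrArg DRGroupoid.r h'
    have := congrArg DRGroupoid.deg h'
    convert hβ
    refine DRGroupoid.ext hr ?_ h.symm
    simp only [divR, DRGroupoid.mul, DRGroupoid.inv] at this ⊢
    omega

theorem conv_ind {A B : Set (DRGroupoid S)} (hB : Set.InjOn DRGroupoid.s B) :
    conv (ind K A) (ind K B) = ind K (setMul A B) := by
  classical
  funext γ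
  rw [conv]
  by_cases h : ∃ α : {α : DRGroupoid S // α.s = γ.s}, α.1 ∈ B
  · obtain ⟨α, hα⟩ := h
    rw [finsum_eq_single _ α]
    · have : γ ∈ setMul A B ↔ divR γ α ∈ A := by
        rw [divR_mem_iff]
        constructor
        · rintro ⟨β, hβ, α', hα', h, h'⟩
          obtain rfl : α' = α.1 := hB hα' hα (by rw [α.2, h']; rfl)
          exact ⟨β, hβ, h, h'⟩
        · rintro ⟨β, hβ, h, h'⟩
          exact ⟨β, hβ, α, hα, h, h'⟩
      simp [ind, this, hα]
    · intro α' hne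
      have : α'.1 ∉ B := fun h' => hne (Subtype.ext (hB h' hα (α'.2.trans α.2.symm)))
      simp [ind, this]
  · have h' : γ ∉ setMul A B := by
      rintro ⟨β, hβ, α', hα', h₁, rfl⟩
      exact h ⟨⟨α', rfl⟩, hα'⟩
    have : ∀ α : {α : DRGroupoid S // α.s = γ.s}, ind K A (divR γ α) * ind K B α.1 = 0 := by
      intro α
      have : α.1 ∉ B := fun h' => h ⟨α, h'⟩
      simp [ind, this]
    rw [finsum_congr this, finsum_zero]
    simp [ind, h']

/-- Functions which are finitely supported on each fibre of the source map. -/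
def FinFib (g : DRGroupoid S → K) : Prop :=
  ∀ γ : DRGroupoid S, Set.Finite {α : {α : DRGroupoid S // α.s = γ.s} | g α ≠ 0}

theorem FinFib.supp {g : DRGroupoid S → K} (hg : FinFib g) (f : DRGroupoid S → K)
    (γ : DRGroupoid S) : (Function.support
      fun α : {α : DRGroupoid S // α.s = γ.s} => f (divR γ α) * g α).Finite :=
  (hg γ).subset fun _ h h' => h (by simp [h'])

theorem conv_zero (f : DRGroupoid S → K) : conv f 0 = 0 := by
  funext γ
  simp [conv]

theorem zero_conv (f : DRGroupoid S → K) : conv 0 f = 0 := by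
  funext γ
  simp [conv]

theorem conv_add (f : DRGroupoid S → K) {g g' : DRGroupoid S → K} (hg : FinFib g)
    (hg' : FinFib g') : conv f (g + g') = conv f g + conv f g' := by
  funext γ
  rw [Pi.add_apply, conv, conv, conv, ← finsum_add_distrib (hg.supp f γ) (hg'.supp f γ)]
  exact finsum_congr fun α => mul_add _ _ _

theorem add_conv (f f' : DRGroupoid S → K) {g : DRGroupoid S → K} (hg : FinFib g) :
    conv (f + f') g = conv f g + conv f' g := by
  funext γ
  rw [Pi.add_apply, conv, conv, conv, ← finsum_add_distrib (hg.supp f γ) (hg.supp f' γ)]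
  exact finsum_congr fun α => add_mul _ _ _

theorem smul_conv (c : K) (f g : DRGroupoid S → K) : conv (c • f) g = c • conv f g := by
  funext γ
  rw [Pi.smul_apply, conv, conv, smul_eq_mul, ← smul_eq_mul, smul_finsum]
  exact finsum_congr fun α => mul_assoc _ _ _

theorem conv_smul (c : K) (f g : DRGroupoid S → K) : conv f (c • g) = c • conv f g := by
  funext γ
  rw [Pi.smul_apply, conv, conv, smul_eq_mul, ← smul_eq_mul, smul_finsum]
  exact finsum_congr fun α => mul_left_comm _ _ _

section algebra

variable [CompactSpace X] [T2Space X] [TotallyDisconnectedSpace X]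

theorem finFib (f : SteinbergAlgebra K S) : FinFib (f : DRGroupoid S → K) := by
  classical
  induction f using SteinbergAlgebra.induction with
  | h₀ => intro γ; simp [zero_apply]
  | h₁ B hB =>
    refine fun γ => Set.Subsingleton.finite fun α hα β hβ => ?_
    have key : ∀ α : {α : DRGroupoid S // α.s = γ.s}, ind K B α ≠ 0 → α.1 ∈ B := by
      intro α h
      by_contra h'
      exact h (by simp [ind, h'])
    exact Subtype.ext (hB.injOn_s (key α hα) (key β hβ) (α.2.trans β.2.symm))
  | h₂ f g hf hg =>
    refine fun γ => ((hf γ).union (hg γ)).subset fun α hα => ?_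
    by_contra h
    simp only [Set.mem_union, Set.mem_ofPred_eq, not_or, not_not] at h
    exact hα (by rw [add_apply, h.1, h.2, add_zero])
  | h₃ c f hf =>
    refine fun γ => (hf γ).subset fun α hα h => hα ?_
    rw [smul_apply, h, mul_zero]

theorem conv_mem (f g : SteinbergAlgebra K S) :
    conv (f : DRGroupoid S → K) g ∈ steinberg K S := by
  induction g using SteinbergAlgebra.induction with
  | h₀ => exact (conv_zero (f : DRGroupoid S → K)).symm ▸ (steinberg K S).zero_mem
  | h₁ B hB =>
    induction f using SteinbergAlgebra.induction with
    | h₀ => exact (zero_conv (ind K B)).symm ▸ (steinberg K S).zero_mem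
    | h₁ A hA => exact (conv_ind (K := K) hB.injOn_s).symm ▸ ind_mem_of_isCyl (hA.mul hB)
    | h₂ f f' hf hf' =>
      exact (add_conv (f : DRGroupoid S → K) f' (finFib (cyl B hB))).symm ▸
        (steinberg K S).add_mem hf hf'
    | h₃ c f hf =>
      exact (smul_conv c (f : DRGroupoid S → K) (ind K B)).symm ▸ (steinberg K S).smul_mem c hf
  | h₂ g g' hg hg' =>
    exact (conv_add (f : DRGroupoid S → K) (finFib g) (finFib g')).symm ▸
      (steinberg K S).add_mem hg hg'
  | h₃ c g hg =>
    exact (conv_smul c (f : DRGroupoid S → K) g).symm ▸ (steinberg K S).smul_mem c hg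

noncomputable instance : Mul (SteinbergAlgebra K S) := ⟨fun f g => ⟨conv f.1 g.1, conv_mem f g⟩⟩

theorem mul_apply (f g : SteinbergAlgebra K S) (γ : DRGroupoid S) :
    (f * g) γ = ∑ᶠ α : {α : DRGroupoid S // α.s = γ.s}, f (divR γ α) * g α := rfl

theorem cyl_mul_cyl {A B : Set (DRGroupoid S)} (hA : IsCyl A) (hB : IsCyl B) :
    (cyl A hA * cyl B hB : SteinbergAlgebra K S) = cyl (setMul A B) (hA.mul hB) :=
  Subtype.ext (conv_ind hB.injOn_s)

theorem mul_add' (f g g' : SteinbergAlgebra K S) : f * (g + g') = f * g + f * g' :=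
  Subtype.ext (conv_add f.1 (finFib g) (finFib g'))

theorem add_mul' (f f' g : SteinbergAlgebra K S) : (f + f') * g = f * g + f' * g :=
  Subtype.ext (add_conv f.1 f'.1 (finFib g))

theorem zero_mul' (f : SteinbergAlgebra K S) : 0 * f = 0 := Subtype.ext (zero_conv f.1)

theorem mul_zero' (f : SteinbergAlgebra K S) : f * 0 = 0 := Subtype.ext (conv_zero f.1)

theorem smul_mul' (c : K) (f g : SteinbergAlgebra K S) : (c • f) * g = c • (f * g) :=
  Subtype.ext (smul_conv c f.1 g.1)

theorem mul_smul' (c : K) (f g : SteinbergAlgebra K S) : f * (c • g) = c • (f * g) :=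
  Subtype.ext (conv_smul c f.1 g.1)

theorem mul_assoc' (f g k : SteinbergAlgebra K S) : f * g * k = f * (g * k) := by
  induction k using SteinbergAlgebra.induction with
  | h₀ => simp only [mul_zero']
  | h₂ k k' hk hk' => simp only [mul_add', hk, hk']
  | h₃ c k hk => simp only [mul_smul', hk]
  | h₁ C hC =>
    induction g using SteinbergAlgebra.induction with
    | h₀ => simp only [mul_zero', zero_mul']
    | h₂ g g' hg hg' => simp only [mul_add', add_mul', hg, hg']
    | h₃ c g hg => simp only [mul_smul', smul_mul', hg]
    | h₁ B hB =>
      induction f using SteinbergAlgebra.induction with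
      | h₀ => simp only [zero_mul']
      | h₂ f f' hf hf' => simp only [add_mul', hf, hf']
      | h₃ c f hf => simp only [smul_mul', hf]
      | h₁ A hA =>
        rw [cyl_mul_cyl, cyl_mul_cyl, cyl_mul_cyl, cyl_mul_cyl]
        exact Subtype.ext (congrArg (ind K) (setMul_assoc A B C))

noncomputable instance : NonUnitalRing (SteinbergAlgebra K S) where
  left_distrib := mul_add'
  right_distrib := add_mul'
  zero_mul := zero_mul'
  mul_zero := mul_zero'
  mul_assoc := mul_assoc'

instance : IsScalarTower K (SteinbergAlgebra K S) (SteinbergAlgebra K S) := ⟨smul_mul'⟩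

instance : SMulCommClass K (SteinbergAlgebra K S) (SteinbergAlgebra K S) :=
  ⟨fun c f g => (mul_smul' c f g).symm⟩

variable [StarRing K]

theorem invol_ind (B : Set (DRGroupoid S)) : invol (ind K B) = ind K (DRGroupoid.inv ⁻¹' B) := by
  classical
  funext γ
  by_cases h : γ.inv ∈ B <;> simp [invol, ind, h]

theorem invol_mem (f : SteinbergAlgebra K S) : invol (f : DRGroupoid S → K) ∈ steinberg K S := by
  induction f using SteinbergAlgebra.induction with
  | h₀ =>
    convert (steinberg K S).zero_mem
    funext γ
    exact star_zero K
  | h₁ B hB => exact (invol_ind (K := K) B).symm ▸ ind_mem_of_isCyl hB.inv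
  | h₂ f g hf hg =>
    convert (steinberg K S).add_mem hf hg
    funext γ
    exact star_add _ _
  | h₃ c f hf =>
    convert (steinberg K S).smul_mem (star c) hf
    funext γ
    exact StarMul.star_mul _ _ |>.trans (mul_comm _ _)

instance : Star (SteinbergAlgebra K S) := ⟨fun f => ⟨invol f.1, invol_mem f⟩⟩

theorem star_apply (f : SteinbergAlgebra K S) (γ : DRGroupoid S) : star f γ = star (f γ.inv) := rfl

theorem star_add' (f g : SteinbergAlgebra K S) : star (f + g) = star f + star g :=
  SteinbergAlgebra.ext fun _ => star_add _ _

theorem star_smul' (c : K) (f : SteinbergAlgebra K S) : star (c • f) = star c • star f :=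
  SteinbergAlgebra.ext fun _ => (StarMul.star_mul _ _).trans (mul_comm _ _)

theorem star_zero' : star (0 : SteinbergAlgebra K S) = 0 :=
  SteinbergAlgebra.ext fun _ => star_zero K

theorem star_cyl {B : Set (DRGroupoid S)} (hB : IsCyl B) :
    star (cyl B hB : SteinbergAlgebra K S) = cyl _ hB.inv := Subtype.ext (invol_ind B)

theorem star_mul' (f g : SteinbergAlgebra K S) : star (f * g) = star g * star f := by
  induction g using SteinbergAlgebra.induction with
  | h₀ => simp only [mul_zero, zero_mul, star_zero']
  | h₂ g g' hg hg' => simp only [mul_add, add_mul, star_add', hg, hg']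
  | h₃ c g hg => simp only [mul_smul', smul_mul', star_smul', hg]
  | h₁ B hB =>
    induction f using SteinbergAlgebra.induction with
    | h₀ => simp only [mul_zero, zero_mul, star_zero']
    | h₂ f f' hf hf' => simp only [mul_add, add_mul, star_add', hf, hf']
    | h₃ c f hf => simp only [mul_smul', smul_mul', star_smul', hf]
    | h₁ A hA =>
      rw [cyl_mul_cyl, star_cyl, star_cyl, star_cyl, cyl_mul_cyl]
      exact Subtype.ext (congrArg (ind K) (setMul_inv A B))

instance : StarRing (SteinbergAlgebra K S) where
  star_involutive f := SteinbergAlgebra.ext fun γ => by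
    rw [star_apply, star_apply, star_star, DRGroupoid.inv_inv]
  star_mul := star_mul'
  star_add := star_add'

instance : StarModule K (SteinbergAlgebra K S) := ⟨star_smul'⟩

end algebra

variable (K S) in
/-- The homogeneous component of degree `d`: the functions supported on elements of degree `d`. -/
def component (d : ℤ) : Submodule K (SteinbergAlgebra K S) where
  carrier := {f | ∀ γ, f γ ≠ 0 → γ.deg = d}
  zero_mem' _ h := absurd rfl h
  add_mem' {f g} hf hg γ h := by
    by_cases h' : f γ = 0
    · exact hg γ fun h'' => h (by rw [add_apply, h', h'', add_zero])
    · exact hf γ h'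
  smul_mem' c f hf γ h := hf γ fun h' => h (by rw [smul_apply, h', mul_zero])

end SteinbergAlgebra

end steinberg

/-! ### The grading of the colimit and the canonical map -/

section main

variable {X : Type u} [MetricSpace X] {S : LHomeo X} {P : ℕ → ClopenPartition X}
variable {K : Type v} [Field K] [StarRing K] {h : SigmaRefined S P}

/-- The degree of an edge of an even layer: blue edges have degree `0`, red edges degree `1`. -/
def edgeDeg {Q R : ClopenPartition X} : EvenEdge S Q R → ℤ := Sum.elim (fun _ => 0) fun _ => 1

variable (K h) in
/-- The homogeneous component of degree `d` of `𝒜_∞`: the image of all elements of the corners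
`𝒜_{2j}` which are homogeneous of degree `d` in `L_K(F_{2j}, D^{2j})`. -/
def AInf.component (d : ℤ) : Set (AInf K h) :=
  {x | ∃ (j : ℕ) (a : CornerAlg K h j),
    a.1 ∈ LPA.component K (evenLayer h j).toSepGraph edgeDeg d ∧ toAInf j a = x}

variable (K h) in
/-- The element `p_U` of `𝒜_{2j}`, for `U ∈ 𝒫_{2j}`. -/
noncomputable def cornerVertex (j : ℕ) (U : (P (2 * j)).parts) : CornerAlg K h j :=
  (evenLayer h j).cv K U

variable (K h) in
/-- The element `e f^*` of `𝒜_{2j}`, for edges `e`, `f` of the layer. -/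
noncomputable def cornerPair (j : ℕ) (e f : EvenEdge S (P (2 * j + 1)) (P (2 * j))) :
    CornerAlg K h j :=
  (evenLayer h j).τ K e f

/-- The blue edge `e` of the layer `(F_{2j}, D^{2j})`. -/
def blue {j : ℕ} (e : BlueEdge (P (2 * j + 1)) (P (2 * j))) :
    EvenEdge S (P (2 * j + 1)) (P (2 * j)) := Sum.inl e

/-- The red edge `e` of the layer `(F_{2j}, D^{2j})`. -/
def red {j : ℕ} (e : RedEdgeEven S (P (2 * j + 1)) (P (2 * j))) :
    EvenEdge S (P (2 * j + 1)) (P (2 * j)) := Sum.inr e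

variable [CompactSpace X] [TotallyDisconnectedSpace X]

open DRGroupoid SteinbergAlgebra in
/-- The formulas describing the canonical map `φ : 𝒜_∞ → A_K(𝒢(X, σ))` on the images of the
elements `p_U` and `e f^*` of the corners, where `e` and `f` have the same source `W`. -/
structure IsCanonical (φ : AInf K h → SteinbergAlgebra K S) : Prop where
  vertex : ∀ (j : ℕ) (U : (P (2 * j)).parts),
    ⇑(φ (toAInf j (cornerVertex K h j U))) = ind K (Z S (U : Set X) 0 0 (U : Set X))
  blue_blue : ∀ (j : ℕ) (W : (P (2 * j + 1)).parts) (U V : (P (2 * j)).parts)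
    (e f : BlueEdge (P (2 * j + 1)) (P (2 * j))), e.1 = (W, U) → f.1 = (W, V) →
    ⇑(φ (toAInf j (cornerPair K h j (blue e) (blue f)))) = ind K (Z S (W : Set X) 0 0 (W : Set X))
  red_red : ∀ (j : ℕ) (W : (P (2 * j + 1)).parts) (U V : (P (2 * j)).parts)
    (e f : RedEdgeEven S (P (2 * j + 1)) (P (2 * j))), e.1 = (W, U) → f.1 = (W, V) →
    ⇑(φ (toAInf j (cornerPair K h j (red e) (red f)))) =
      ind K (Z S (U ∩ S.σ ⁻¹' W) 1 1 (V ∩ S.σ ⁻¹' W))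
  red_blue : ∀ (j : ℕ) (W : (P (2 * j + 1)).parts) (U V : (P (2 * j)).parts)
    (e : RedEdgeEven S (P (2 * j + 1)) (P (2 * j))) (f : BlueEdge (P (2 * j + 1)) (P (2 * j))),
    e.1 = (W, U) → f.1 = (W, V) →
    ⇑(φ (toAInf j (cornerPair K h j (red e) (blue f)))) =
      ind K (Z S (U ∩ S.σ ⁻¹' W) 1 0 (W : Set X))
  blue_red : ∀ (j : ℕ) (W : (P (2 * j + 1)).parts) (U V : (P (2 * j)).parts)
    (e : BlueEdge (P (2 * j + 1)) (P (2 * j))) (f : RedEdgeEven S (P (2 * j + 1)) (P (2 * j))),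
    e.1 = (W, U) → f.1 = (W, V) →
    ⇑(φ (toAInf j (cornerPair K h j (blue e) (red f)))) =
      ind K (Z S (W : Set X) 0 1 (V ∩ S.σ ⁻¹' W))

end main

/-! Both algebras are compared through covariant representations of $(X,\sigma)$: projections $p_U$,
additive in the clopen set $U$ and with $p_{U\cap V}=p_Up_V$, and an element $t$ with
$tp_U=p_{\sigma^{-1}(U)}t$ and, whenever $\sigma$ is injective on $U$, with $t^*p_Ut=p_{\sigma(U)}$
and $p_Utt^*p_U=p_U$.

The Steinberg algebra has such a representation (`SteinbergAlgebra.covRep`): $p_U$ is the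
characteristic function of $Z(U,0,0,U)$ and $t$ that of $Z(X,1,0,X)$; then $p_Ut^m(t^*)^np_V$ is the
characteristic function of $Z(U,m,n,V)$ (`covRep_E`). The colimit has one too (`AInf.covRep`): $p_U$
is the sum of the vertices of $\mathcal P_{2j}$ contained in $U$, for any $j$ so large that $U$ is a
union of members of $\mathcal P_{2j}$, and $t$ is the sum of all $ef^*$ with $e$ red and $f$ blue.
The connecting maps carry these sums to the corresponding sums of the next layer, so they define
elements of the colimit; this is where the refinement conditions enter.

Conversely, a covariant representation in $A$ gives a homomorphism $L_{2j}\to M_2(A)$: vertices of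
the two levels go to the two diagonal positions, and edges to position $(0,1)$, a blue edge with
source $W$ as $p_W$ and a red edge from $W$ to $U$ as $p_Utp_W$. The corner lands in position
$(0,0)$. These maps agree with the connecting maps (`CovRep.cornerRep_connect`), because a corner is
generated by its vertices and by the products $ff^*$, $ef^*$, $fe^*$ with $e$ red, $f$ blue and a
common source (`CornerAlg.eq_top_of_mem`). The same generation statement gives uniqueness. For the
Steinberg algebra the result is `canonicalHom`.

Surjectivity: the characteristic functions of the sets $Z(U,m,n,V)$ span. Injectivity: the elements
$p_Ut^m(t^*)^np_V$ span the colimit (`AInf.mem_iSup_spanE`). By degree one may fix $m-n$; raising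
$m$ and $n$ together one may fix $m$ and $n$; refining one may take $U,V$ in a single partition
$\mathcal P_k$. The images are then characteristic functions of disjoint sets, and where such a set
is empty the element itself vanishes (`CovRep.E_eq_zero`).

Grading: `canonicalHom` respects degrees on generators. The converse follows by splitting an element
of a corner into homogeneous parts and using injectivity. -/

/-! ### Partitions and saturated sets -/

/-- A set is saturated for a partition if it is a union of members of the partition. -/
def ClopenPartition.Saturates {X : Type u} [TopologicalSpace X] (Q : ClopenPartition X)
    (U : Set X) : Prop :=
  ∀ Z ∈ Q.parts, ∀ x ∈ Z, x ∈ U → Z ⊆ U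

namespace ClopenPartition

variable {X : Type u} [TopologicalSpace X] {Q : ClopenPartition X} {U V : Set X}

theorem Saturates.inter (hU : Q.Saturates U) (hV : Q.Saturates V) : Q.Saturates (U ∩ V) :=
  fun Z hZ x hx hxU => Set.subset_inter (hU Z hZ x hx hxU.1) (hV Z hZ x hx hxU.2)

theorem Saturates.union (hU : Q.Saturates U) (hV : Q.Saturates V) : Q.Saturates (U ∪ V) := by
  rintro Z hZ x hx (hxU | hxV)
  · exact (hU Z hZ x hx hxU).trans Set.subset_union_left
  · exact (hV Z hZ x hx hxV).trans Set.subset_union_right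

theorem saturates_part {Z : Set X} (hZ : Z ∈ Q.parts) : Q.Saturates Z :=
  fun _ hZ' _ hx hx' => (Q.eq_of_mem hZ' hZ hx hx').subset

theorem saturates_univ : Q.Saturates Set.univ := fun _ _ _ _ _ => Set.subset_univ _

end ClopenPartition

namespace SigmaRefined

variable {X : Type u} [MetricSpace X] {S : LHomeo X} {P : ℕ → ClopenPartition X}

theorem saturates_mono (h : SigmaRefined S P) {U : Set X} {m n : ℕ} (hmn : m ≤ n)
    (hU : (P m).Saturates U) : (P n).Saturates U := by
  induction n, hmn using Nat.le_induction with
  | base => exact hU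
  | succ n _ ih =>
    intro Z hZ x hx hxU
    obtain ⟨Z', hZ', hsub⟩ := h.finer n Z hZ
    exact hsub.trans (ih Z' hZ' x (hsub hx) hxU)

/-- The cover of $X$ by $U$ and its complement has a Lebesgue number $\delta$; once all members of
$\mathcal P_n$ have diameter below $\delta$, none of them meets both. -/
theorem exists_saturates [CompactSpace X] (h : SigmaRefined S P) {U : Set X} (hU : IsClopen U) :
    ∃ n, (P n).Saturates U := by
  obtain ⟨δ, hδ, hball⟩ := lebesgue_number_lemma_of_metric (s := Set.univ)
    (c := fun b : Bool => if b then U else Uᶜ) isCompact_univ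
    (by rintro (_ | _); exacts [by simpa using hU.compl.isOpen, by simpa using hU.isOpen])
    (fun x _ => by
      by_cases hx : x ∈ U
      · exact Set.mem_iUnion.2 ⟨true, by simpa using hx⟩
      · exact Set.mem_iUnion.2 ⟨false, by simpa using hx⟩)
  obtain ⟨n, hn⟩ := (h.diam.eventually (gt_mem_nhds hδ)).exists
  refine ⟨n, fun Z hZ x hx hxU => ?_⟩
  have hd : Metric.diam Z < δ := lt_of_le_of_lt
    (le_ciSup (f := fun Z : (P n).parts => Metric.diam (Z : Set X))
      (Set.finite_range _).bddAbove ⟨Z, hZ⟩) hn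
  have hsub : Z ⊆ Metric.ball x δ := fun y hy => Metric.mem_ball.2
    ((Metric.dist_le_diam_of_mem (isCompact_univ.isBounded.subset (Set.subset_univ Z)) hy hx).trans_lt
      hd)
  obtain ⟨b, hb⟩ := hball x trivial
  cases b with
  | true => exact hsub.trans (by simpa using hb)
  | false => exact absurd hxU (by simpa using hb (Metric.mem_ball_self hδ))

end SigmaRefined

theorem LHomeo.isClopen_image {X : Type u} [TopologicalSpace X] [CompactSpace X] [T2Space X]
    (S : LHomeo X) {U : Set X} (hU : IsClopen U) : IsClopen (S.σ '' U) :=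
  ⟨(hU.isClosed.isCompact.image S.isLocalHomeomorph.continuous).isClosed,
    S.isLocalHomeomorph.isOpenMap _ hU.isOpen⟩

theorem LHomeo.isClopen_preimage {X : Type u} [TopologicalSpace X] (S : LHomeo X) {U : Set X}
    (hU : IsClopen U) : IsClopen (S.σ ⁻¹' U) :=
  hU.preimage S.isLocalHomeomorph.continuous

theorem LHomeo.isClopen_preimage_iterate {X : Type u} [TopologicalSpace X] (S : LHomeo X)
    {U : Set X} (hU : IsClopen U) (m : ℕ) : IsClopen (S.σ^[m] ⁻¹' U) :=
  hU.preimage (DRGroupoid.isLocalHomeomorph_iterate S m).continuous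

theorem LHomeo.isClopen_image_iterate {X : Type u} [TopologicalSpace X] [CompactSpace X]
    [T2Space X] (S : LHomeo X) {U : Set X} (hU : IsClopen U) (m : ℕ) :
    IsClopen (S.σ^[m] '' U) :=
  ⟨(hU.isClosed.isCompact.image (DRGroupoid.isLocalHomeomorph_iterate S m).continuous).isClosed,
    (DRGroupoid.isLocalHomeomorph_iterate S m).isOpenMap _ hU.isOpen⟩

/-! ### Covariant representations -/

/-- A covariant representation of `(X, σ)` in a unital *-ring: projections `p U` for the clopen
sets `U`, and an element `t` implementing `σ`. -/
structure CovRep {X : Type u} [TopologicalSpace X] (S : LHomeo X) (A : Type w) [Ring A]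
    [StarRing A] where
  p : Set X → A
  t : A
  p_univ : p Set.univ = 1
  star_p : ∀ {U}, IsClopen U → star (p U) = p U
  p_inter : ∀ {U V}, IsClopen U → IsClopen V → p (U ∩ V) = p U * p V
  p_union : ∀ {U V}, IsClopen U → IsClopen V → Disjoint U V → p (U ∪ V) = p U + p V
  t_mul_p : ∀ {U}, IsClopen U → t * p U = p (S.σ ⁻¹' U) * t
  -- Injectivity cannot be dropped: in the Steinberg algebra $t^*p_Ut$ takes at the unit $y$ the
  -- value $|U\cap\sigma^{-1}(y)|$, and $p_Utt^*p_U$ is the characteristic function of $Z(U,1,1,U)$,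
  -- which consists of units only if $\sigma$ is injective on $U$.
  star_t_mul_p_mul_t : ∀ {U}, IsClopen U → Set.InjOn S.σ U → star t * p U * t = p (S.σ '' U)
  p_mul_t_mul_star_t_mul_p : ∀ {U}, IsClopen U → Set.InjOn S.σ U → p U * t * (star t * p U) = p U

namespace CovRep

section ring

variable {X : Type u} [TopologicalSpace X] {S : LHomeo X} {A : Type w} [Ring A] [StarRing A]
variable (C : CovRep S A) {U V : Set X}

theorem p_empty : C.p ∅ = 0 := by
  have := C.p_union isClopen_empty isClopen_empty (Set.disjoint_empty (∅ : Set X))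
  rwa [Set.union_empty, left_eq_add] at this

theorem p_mul_self (hU : IsClopen U) : C.p U * C.p U = C.p U := by
  rw [← C.p_inter hU hU, Set.inter_self]

theorem p_mul_of_disjoint (hU : IsClopen U) (hV : IsClopen V) (h : Disjoint U V) :
    C.p U * C.p V = 0 := by
  rw [← C.p_inter hU hV, h.inter_eq, C.p_empty]

theorem p_mul_of_subset (hU : IsClopen U) (hV : IsClopen V) (h : U ⊆ V) :
    C.p U * C.p V = C.p U := by
  rw [← C.p_inter hU hV, Set.inter_eq_left.2 h]

theorem p_mul_of_superset (hU : IsClopen U) (hV : IsClopen V) (h : V ⊆ U) :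
    C.p U * C.p V = C.p V := by
  rw [← C.p_inter hU hV, Set.inter_eq_right.2 h]

theorem p_biUnion {ι : Type*} (s : Finset ι) (f : ι → Set X) (hf : ∀ i ∈ s, IsClopen (f i))
    (hd : (s : Set ι).PairwiseDisjoint f) : C.p (⋃ i ∈ s, f i) = ∑ i ∈ s, C.p (f i) := by
  classical
  induction s using Finset.induction_on with
  | empty => simp [p_empty]
  | insert a s ha ih =>
    rw [Finset.set_biUnion_insert, Finset.sum_insert ha, C.p_union (hf a (by simp)), ih]
    · exact fun i hi => hf i (by simp [hi])
    · exact hd.subset (by simp)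
    · exact s.finite_toSet.isClopen_biUnion fun i hi => hf i (by simp [Finset.mem_coe.1 hi])
    · refine Set.disjoint_iUnion₂_right.2 fun i hi => hd (by simp) (by simp [hi]) ?_
      rintro rfl
      exact ha hi

theorem p_eq_sum (Q : ClopenPartition X) (hU : IsClopen U) :
    C.p U = ∑ Z ∈ Q.parts, C.p (U ∩ Z) := by
  rw [← C.p_biUnion Q.parts (fun Z => U ∩ Z) (fun Z hZ => hU.inter (Q.isClopen Z hZ))]
  · congr 1
    ext x
    obtain ⟨Z, hZ, hx⟩ := Q.cover x
    simp only [Set.mem_iUnion, Set.mem_inter_iff, exists_prop]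
    exact ⟨fun h => ⟨Z, hZ, h, hx⟩, fun ⟨_, _, h, _⟩ => h⟩
  · exact fun Z hZ Z' hZ' hne =>
      (Q.pairwiseDisjoint hZ hZ' hne).mono Set.inter_subset_right Set.inter_subset_right

theorem sum_p_parts (Q : ClopenPartition X) : ∑ Z ∈ Q.parts, C.p Z = 1 := by
  rw [← C.p_univ, C.p_eq_sum Q isClopen_univ]
  simp

theorem t_pow_mul_p (hU : IsClopen U) (m : ℕ) :
    C.t ^ m * C.p U = C.p (S.σ^[m] ⁻¹' U) * C.t ^ m := by
  induction m generalizing U with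
  | zero => simp
  | succ m ih =>
    rw [pow_succ, mul_assoc, C.t_mul_p hU, ← mul_assoc, ih (S.isClopen_preimage hU), mul_assoc,
      Function.iterate_succ', Set.preimage_comp]

theorem p_mul_star_t_pow (hU : IsClopen U) (m : ℕ) :
    C.p U * star C.t ^ m = star C.t ^ m * C.p (S.σ^[m] ⁻¹' U) := by
  rw [← C.star_p hU, ← star_pow, ← star_mul, C.t_pow_mul_p hU, star_mul,
    C.star_p (S.isClopen_preimage_iterate hU m)]

/-- The element `p_U t^m (t^*)^n p_V`. -/
def E (m n : ℕ) (U V : Set X) : A := C.p U * C.t ^ m * (star C.t ^ n * C.p V)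

theorem E_eq_sum (Q : ClopenPartition X) (m n : ℕ) (hU : IsClopen U) (hV : IsClopen V) :
    C.E m n U V = ∑ Z ∈ Q.parts, ∑ Z' ∈ Q.parts, C.E m n (U ∩ Z) (V ∩ Z') := by
  simp only [E]
  rw [C.p_eq_sum Q hU, C.p_eq_sum Q hV, Finset.sum_mul, Finset.sum_mul]
  simp only [Finset.mul_sum]

/-- Insert $1=\sum_Zp_Z=\sum_Zp_Ztt^*p_Z$ between $t^m$ and $(t^*)^n$ and move the outer factors
$p_Z$ past the powers. In the groupoid: $Z(U,m,n,V)$ is the disjoint union over $Z$ of the parts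
where $\sigma^m(x)=\sigma^n(y)\in Z$, and there one more application of $\sigma$ loses nothing. -/
theorem E_eq_sum_succ (Q : ClopenPartition X) (hQ : ∀ Z ∈ Q.parts, Set.InjOn S.σ Z) (m n : ℕ)
    (hU : IsClopen U) (hV : IsClopen V) :
    C.E m n U V = ∑ Z ∈ Q.parts,
      C.E (m + 1) (n + 1) (U ∩ S.σ^[m] ⁻¹' Z) (V ∩ S.σ^[n] ⁻¹' Z) := by
  have key : C.E m n U V = C.p U * C.t ^ m * 1 * (star C.t ^ n * C.p V) := by rw [mul_one, E]
  rw [key, ← C.sum_p_parts Q, Finset.mul_sum, Finset.sum_mul]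
  refine Finset.sum_congr rfl fun Z hZ => ?_
  have hc := Q.isClopen Z hZ
  rw [E, C.p_inter hU (S.isClopen_preimage_iterate hc m), Set.inter_comm V,
    C.p_inter (S.isClopen_preimage_iterate hc n) hV, pow_succ C.t, pow_succ' (star C.t),
    ← C.p_mul_t_mul_star_t_mul_p hc (hQ Z hZ)]
  have h₁ : C.p U * C.p (S.σ^[m] ⁻¹' Z) * (C.t ^ m * C.t) = C.p U * C.t ^ m * (C.p Z * C.t) := by
    rw [mul_assoc, ← mul_assoc _ (C.t ^ m), ← C.t_pow_mul_p hc]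
    simp only [mul_assoc]
  have h₂ : star C.t * star C.t ^ n * (C.p (S.σ^[n] ⁻¹' Z) * C.p V) =
      star C.t * C.p Z * (star C.t ^ n * C.p V) := by
    rw [mul_assoc, ← mul_assoc _ _ (C.p V), ← C.p_mul_star_t_pow hc]
    simp only [mul_assoc]
  rw [h₁, h₂]
  simp only [mul_assoc]

theorem p_mul_E (m n : ℕ) {W : Set X} (hW : IsClopen W) (hU : IsClopen U) :
    C.p W * C.E m n U V = C.E m n (W ∩ U) V := by
  rw [E, E, C.p_inter hW hU]
  simp only [mul_assoc]

theorem t_mul_E (m n : ℕ) (hU : IsClopen U) :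
    C.t * C.E m n U V = C.E (m + 1) n (S.σ ⁻¹' U) V := by
  rw [E, E, pow_succ', ← mul_assoc _ C.t, ← C.t_mul_p hU]
  simp only [mul_assoc]

/-- There is no $t$ to cancel, so $p_U$ is moved to the right past $(t^*)^n$ to let the new $t^*$
join the power. -/
theorem star_t_mul_E_zero (n : ℕ) (hU : IsClopen U) (hV : IsClopen V) :
    star C.t * C.E 0 n U V = C.E 0 (n + 1) Set.univ (S.σ^[n] ⁻¹' U ∩ V) := by
  have h : C.p U * (star C.t ^ n * C.p V) =
      star C.t ^ n * (C.p (S.σ^[n] ⁻¹' U) * C.p V) := by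
    rw [← mul_assoc, C.p_mul_star_t_pow hU, mul_assoc]
  rw [E, E, C.p_inter (S.isClopen_preimage_iterate hU n) hV, C.p_univ, pow_zero, mul_one, mul_one,
    one_mul, h, pow_succ', mul_assoc]

/-- Cutting $U$ along $Q$ into pieces on which $\sigma$ is injective gives
$t^*p_Ut=\sum_Zp_{\sigma(U\cap Z)}$, which absorbs one factor $t$. -/
theorem star_t_mul_E_succ (m n : ℕ) (hU : IsClopen U) (Q : ClopenPartition X)
    (hQ : ∀ Z ∈ Q.parts, Set.InjOn S.σ Z) :
    star C.t * C.E (m + 1) n U V = ∑ Z ∈ Q.parts, C.E m n (S.σ '' (U ∩ Z)) V := by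
  have h : star C.t * C.p U * C.t = ∑ Z ∈ Q.parts, C.p (S.σ '' (U ∩ Z)) := by
    rw [C.p_eq_sum Q hU, Finset.mul_sum, Finset.sum_mul]
    exact Finset.sum_congr rfl fun Z hZ => C.star_t_mul_p_mul_t (hU.inter (Q.isClopen Z hZ))
      ((hQ Z hZ).mono Set.inter_subset_right)
  simp only [E]
  rw [← Finset.sum_mul, ← Finset.sum_mul, ← h, pow_succ']
  simp only [mul_assoc]

/-- Since $p_Ut^m=p_Ut^mp_{\sigma^m(U)}$, and dually on the right, the element contains the factor
$p_{\sigma^m(U)}p_{\sigma^n(V)}$. A common point of the two images would yield an element of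
$Z(U,m,n,V)$. -/
theorem E_eq_zero [CompactSpace X] [T2Space X] {m n : ℕ} (hU : IsClopen U) (hV : IsClopen V)
    (h : DRGroupoid.Z S U m n V = ∅) : C.E m n U V = 0 := by
  have hU' := S.isClopen_image_iterate hU m
  have hV' := S.isClopen_image_iterate hV n
  have h₁ : C.p U * C.t ^ m = C.p U * C.t ^ m * C.p (S.σ^[m] '' U) := by
    rw [mul_assoc, C.t_pow_mul_p hU', ← mul_assoc,
      C.p_mul_of_subset hU (S.isClopen_preimage_iterate hU' m) (Set.subset_preimage_image _ _)]
  have h₂ : star C.t ^ n * C.p V = C.p (S.σ^[n] '' V) * (star C.t ^ n * C.p V) := by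
    rw [← mul_assoc, C.p_mul_star_t_pow hV', mul_assoc,
      C.p_mul_of_superset (S.isClopen_preimage_iterate hV' n) hV (Set.subset_preimage_image _ _)]
  rw [E, h₁, h₂, mul_assoc, ← mul_assoc (C.p _) (C.p _), C.p_mul_of_disjoint hU' hV', zero_mul,
    mul_zero]
  rw [Set.disjoint_left]
  rintro _ ⟨x, hx, rfl⟩ ⟨y, hy, hxy⟩
  have : (⟨x, m - n, y, m, n, rfl, hxy.symm⟩ : DRGroupoid S) ∈ DRGroupoid.Z S U m n V :=
    ⟨rfl, hx, hy, hxy.symm⟩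
  rwa [h] at this

end ring

end CovRep

/-! ### The span of the elements $p_Ut^m(t^*)^np_V$ -/

namespace CovRep

section span

variable {X : Type u} [TopologicalSpace X] {S : LHomeo X} {A : Type w} [Ring A] [StarRing A]
variable (C : CovRep S A) {U V : Set X}
variable (K : Type v) [Field K] [Module K A]

/-- The span of the elements `p_U t^m (t^*)^n p_V`, for fixed `m` and `n`. -/
def spanE (m n : ℕ) : Submodule K A :=
  Submodule.span K {a | ∃ U V, IsClopen U ∧ IsClopen V ∧ a = C.E m n U V}

variable {K}

theorem E_mem_spanE (m n : ℕ) (hU : IsClopen U) (hV : IsClopen V) :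
    C.E m n U V ∈ C.spanE K m n :=
  Submodule.subset_span ⟨U, V, hU, hV, rfl⟩

theorem E_mem_iSup_spanE (m n : ℕ) (hU : IsClopen U) (hV : IsClopen V) :
    C.E m n U V ∈ ⨆ k : ℕ × ℕ, C.spanE K k.1 k.2 :=
  Submodule.mem_iSup_of_mem (m, n) (C.E_mem_spanE m n hU hV)

theorem spanE_le_add (Q : ClopenPartition X) (hQ : ∀ Z ∈ Q.parts, Set.InjOn S.σ Z) (m n k : ℕ) :
    C.spanE K m n ≤ C.spanE K (m + k) (n + k) := by
  induction k with
  | zero => exact le_rfl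
  | succ k ih =>
    refine ih.trans (Submodule.span_le.2 ?_)
    rintro _ ⟨U, V, hU, hV, rfl⟩
    rw [C.E_eq_sum_succ Q hQ _ _ hU hV]
    exact Submodule.sum_mem _ fun Z hZ => C.E_mem_spanE _ _
      (hU.inter (S.isClopen_preimage_iterate (Q.isClopen Z hZ) _))
      (hV.inter (S.isClopen_preimage_iterate (Q.isClopen Z hZ) _))

variable (K) in
/-- The elements which multiply the span of the elements `p_U t^m (t^*)^n p_V` into itself. -/
def multipliers [IsScalarTower K A A] : NonUnitalSubalgebra K A where
  carrier := {a | ∀ b ∈ ⨆ k : ℕ × ℕ, C.spanE K k.1 k.2, a * b ∈ ⨆ k : ℕ × ℕ, C.spanE K k.1 k.2}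
  zero_mem' b _ := by rw [zero_mul]; exact Submodule.zero_mem _
  add_mem' ha ha' b hb := by rw [add_mul]; exact Submodule.add_mem _ (ha b hb) (ha' b hb)
  mul_mem' ha ha' b hb := by rw [mul_assoc]; exact ha _ (ha' b hb)
  smul_mem' c a ha b hb := by rw [smul_mul_assoc]; exact Submodule.smul_mem _ c (ha b hb)

theorem mem_multipliers_of_E [IsScalarTower K A A] [SMulCommClass K A A] {a : A}
    (h : ∀ m n U V, IsClopen U → IsClopen V →
      a * C.E m n U V ∈ ⨆ k : ℕ × ℕ, C.spanE K k.1 k.2) : a ∈ C.multipliers K := by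
  have key : (⨆ k : ℕ × ℕ, C.spanE K k.1 k.2) ≤
      (⨆ k : ℕ × ℕ, C.spanE K k.1 k.2).comap (LinearMap.mulLeft K a) := by
    refine iSup_le fun k => Submodule.span_le.2 ?_
    rintro _ ⟨U, V, hU, hV, rfl⟩
    exact h _ _ _ _ hU hV
  exact fun b hb => key hb

theorem p_mem_multipliers [IsScalarTower K A A] [SMulCommClass K A A] (hU : IsClopen U) :
    C.p U ∈ C.multipliers K :=
  C.mem_multipliers_of_E fun m n V W hV hW => by
    rw [C.p_mul_E m n hU hV]
    exact C.E_mem_iSup_spanE _ _ (hU.inter hV) hW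

theorem t_mem_multipliers [IsScalarTower K A A] [SMulCommClass K A A] :
    C.t ∈ C.multipliers K :=
  C.mem_multipliers_of_E fun m n V W hV hW => by
    rw [C.t_mul_E m n hV]
    exact C.E_mem_iSup_spanE _ _ (S.isClopen_preimage hV) hW

theorem star_t_mem_multipliers [CompactSpace X] [T2Space X] [IsScalarTower K A A]
    [SMulCommClass K A A] (Q : ClopenPartition X) (hQ : ∀ Z ∈ Q.parts, Set.InjOn S.σ Z) :
    star C.t ∈ C.multipliers K :=
  C.mem_multipliers_of_E fun m n V W hV hW => by
    cases m with
    | zero =>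
      rw [C.star_t_mul_E_zero n hV hW]
      exact C.E_mem_iSup_spanE _ _ isClopen_univ ((S.isClopen_preimage_iterate hV n).inter hW)
    | succ m =>
      rw [C.star_t_mul_E_succ m n hV Q hQ]
      exact Submodule.sum_mem _ fun Z hZ =>
        C.E_mem_iSup_spanE _ _ (S.isClopen_image (hV.inter (Q.isClopen Z hZ))) hW

/-- The span contains $1=p_Xt^0(t^*)^0p_X$, so it contains every $a=a\cdot1$ that multiplies it into
itself. To show that the span is everything it is thus enough to multiply it by $p_U$, $t$ and
$t^*$; products of two general spanning elements are never computed. -/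
theorem mem_iSup_of_mem_multipliers [IsScalarTower K A A] {a : A}
    (ha : a ∈ C.multipliers K) : a ∈ ⨆ k : ℕ × ℕ, C.spanE K k.1 k.2 := by
  have h1 : C.E 0 0 Set.univ Set.univ = 1 := by simp [E, C.p_univ]
  rw [← mul_one a, ← h1]
  exact ha _ (C.E_mem_iSup_spanE 0 0 isClopen_univ isClopen_univ)

end span

/-! ### Detecting zero by characteristic functions -/

section refinement

variable {X : Type u} [MetricSpace X] [CompactSpace X] {S : LHomeo X} {P : ℕ → ClopenPartition X}
variable {A : Type w} [Ring A] [StarRing A] (C : CovRep S A)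
variable {K : Type v} [Field K] [Module K A]

/-- Cutting $U$ and $V$ along $\mathcal P_k$ yields only members of $\mathcal P_k$ and empty sets,
and the terms with an empty set vanish. -/
theorem E_mem_span_parts {m n k : ℕ} {U V : Set X} (hU : IsClopen U) (hV : IsClopen V)
    (hkU : (P k).Saturates U) (hkV : (P k).Saturates V) :
    C.E m n U V ∈ Submodule.span K
      (Set.range fun q : (P k).parts × (P k).parts => C.E m n (q.1 : Set X) q.2) := by
  rw [C.E_eq_sum (P k) m n hU hV]
  have key : ∀ {W Z : Set X}, (P k).Saturates W → Z ∈ (P k).parts → W ∩ Z = Z ∨ W ∩ Z = ∅ := by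
    intro W Z hW hZ
    rcases (W ∩ Z).eq_empty_or_nonempty with h | ⟨x, hx, hx'⟩
    · exact Or.inr h
    · exact Or.inl (Set.inter_eq_right.2 (hW Z hZ x hx' hx))
  refine Submodule.sum_mem _ fun Z hZ => Submodule.sum_mem _ fun Z' hZ' => ?_
  rcases key hkU hZ with h | h
  · rcases key hkV hZ' with h' | h'
    · exact Submodule.subset_span ⟨(⟨Z, hZ⟩, ⟨Z', hZ'⟩), by simp only [h, h']⟩
    · simp [h', E, C.p_empty]
  · simp [h, E, C.p_empty]

/-- Only finitely many clopen sets occur in a given element, and all are unions of members of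
$\mathcal P_k$ for large $k$. The bound holds for all later $k$ so that summands can be brought to a
common level. -/
theorem exists_mem_span_parts (h : SigmaRefined S P) {m n : ℕ} {a : A} (ha : a ∈ C.spanE K m n) :
    ∃ k₀, ∀ k ≥ k₀, a ∈ Submodule.span K
      (Set.range fun q : (P k).parts × (P k).parts => C.E m n (q.1 : Set X) q.2) := by
  induction ha using Submodule.span_induction with
  | mem a ha =>
    obtain ⟨U, V, hU, hV, rfl⟩ := ha
    obtain ⟨k, hk⟩ := h.exists_saturates hU
    obtain ⟨l, hl⟩ := h.exists_saturates hV
    exact ⟨max k l, fun i hi => C.E_mem_span_parts hU hV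
      (h.saturates_mono (le_of_max_le_left hi) hk) (h.saturates_mono (le_of_max_le_right hi) hl)⟩
  | zero => exact ⟨0, fun _ _ => Submodule.zero_mem _⟩
  | add a b _ _ iha ihb =>
    obtain ⟨k, hk⟩ := iha
    obtain ⟨l, hl⟩ := ihb
    exact ⟨max k l, fun i hi => Submodule.add_mem _ (hk i (le_of_max_le_left hi))
      (hl i (le_of_max_le_right hi))⟩
  | smul c a _ ih =>
    obtain ⟨k, hk⟩ := ih
    exact ⟨k, fun i hi => Submodule.smul_mem _ c (hk i hi)⟩

/-- By `spanE_le_add` the spans with $m-n=d$ form a directed family, so their supremum is a union.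
The alternative `a = 0` spares a proof that the index set is non-empty. -/
theorem exists_mem_spanE_add (h : SigmaRefined S P) {d : ℤ} {a : A}
    (ha : a ∈ ⨆ k : {k : ℕ × ℕ // (k.1 : ℤ) - k.2 = d}, C.spanE K k.1.1 k.1.2) :
    a = 0 ∨ ∃ m n : ℕ, (m : ℤ) - n = d ∧ a ∈ C.spanE K m n := by
  have hdir : Directed (· ≤ ·)
      fun k : {k : ℕ × ℕ // (k.1 : ℤ) - k.2 = d} => C.spanE K k.1.1 k.1.2 := by
    have key : ∀ k l : {k : ℕ × ℕ // (k.1 : ℤ) - k.2 = d}, k.1.1 ≤ l.1.1 →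
        C.spanE K k.1.1 k.1.2 ≤ C.spanE K l.1.1 l.1.2 := by
      rintro ⟨⟨m, n⟩, hk⟩ ⟨⟨m', n'⟩, hl⟩ hle
      obtain ⟨r, rfl⟩ := Nat.exists_eq_add_of_le hle
      obtain rfl : n' = n + r := by push_cast at hl; simp only at hk; omega
      exact C.spanE_le_add (P 0) (h.injOn 0) m n r
    intro k l
    rcases le_total k.1.1 l.1.1 with hle | hle
    · exact ⟨l, key _ _ hle, le_rfl⟩
    · exact ⟨k, le_rfl, key _ _ hle⟩
  rcases isEmpty_or_nonempty {k : ℕ × ℕ // (k.1 : ℤ) - k.2 = d} with hempty | hne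
  · left; rw [iSup_of_empty] at ha; exact (Submodule.mem_bot K).1 ha
  · obtain ⟨k, hk⟩ := (Submodule.mem_iSup_of_directed _ hdir).1 ha
    exact Or.inr ⟨k.1.1, k.1.2, k.2, hk⟩

/-- Write $a$ as a combination of elements $p_Zt^m(t^*)^np_{Z'}$ with $Z,Z'\in\mathcal P_k$. Their
images are characteristic functions of pairwise disjoint sets: evaluating at a point of one of these
isolates its coefficient, and a term with empty set is already zero in $A$. -/
theorem eq_zero_of_mem_spanE [TotallyDisconnectedSpace X] (h : SigmaRefined S P)
    (φ : A →ₗ[K] SteinbergAlgebra K S)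
    (hφ : ∀ m n U V, IsClopen U → IsClopen V →
      (φ (C.E m n U V)).1 = SteinbergAlgebra.ind K (DRGroupoid.Z S U m n V))
    {m n : ℕ} {a : A} (ha : a ∈ C.spanE K m n) (ha0 : φ a = 0) : a = 0 := by
  classical
  obtain ⟨k, hk⟩ := C.exists_mem_span_parts h ha
  obtain ⟨c, rfl⟩ := (Submodule.mem_span_range_iff_exists_fun K).1 (hk k le_rfl)
  have happ : ∀ γ : DRGroupoid S, ∑ q : (P k).parts × (P k).parts,
      c q * SteinbergAlgebra.ind K (DRGroupoid.Z S (q.1 : Set X) m n q.2) γ = 0 := by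
    intro γ
    let ev : SteinbergAlgebra K S →ₗ[K] K :=
      { toFun := fun f => f γ, map_add' := fun _ _ => rfl, map_smul' := fun _ _ => rfl }
    have := congrArg ev ha0
    rw [map_sum, map_sum, map_zero] at this
    rw [← this]
    refine Finset.sum_congr rfl fun q _ => ?_
    rw [map_smul, map_smul, smul_eq_mul]
    congr 1
    exact (congrFun (hφ m n _ _ ((P k).isClopen _ q.1.2) ((P k).isClopen _ q.2.2)) γ).symm
  refine Finset.sum_eq_zero fun q _ => ?_
  rcases (DRGroupoid.Z S (q.1 : Set X) m n (q.2 : Set X)).eq_empty_or_nonempty with hq | ⟨γ, hγ⟩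
  · rw [C.E_eq_zero ((P k).isClopen _ q.1.2) ((P k).isClopen _ q.2.2) hq, smul_zero]
  · have := happ γ
    rw [Finset.sum_eq_single q] at this
    · rw [SteinbergAlgebra.ind, if_pos hγ, mul_one] at this
      rw [this, zero_smul]
    · intro q' _ hne
      rw [SteinbergAlgebra.ind, if_neg, mul_zero]
      intro hγ'
      -- Disjointness: the range and the source of $\gamma$ determine the members of $\mathcal P_k$
      -- in which they lie.
      exact hne (Prod.ext
        (Subtype.ext ((P k).eq_of_mem q'.1.2 q.1.2 hγ'.2.1 hγ.2.1))
        (Subtype.ext ((P k).eq_of_mem q'.2.2 q.2.2 hγ'.2.2.1 hγ.2.2.1)))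
    · simp

theorem map_mem_component [TotallyDisconnectedSpace X]
    (φ : A →ₗ[K] SteinbergAlgebra K S)
    (hφ : ∀ m n U V, IsClopen U → IsClopen V →
      (φ (C.E m n U V)).1 = SteinbergAlgebra.ind K (DRGroupoid.Z S U m n V))
    {m n : ℕ} {a : A} (ha : a ∈ C.spanE K m n) :
    φ a ∈ SteinbergAlgebra.component K S (m - n) := by
  classical
  have key : C.spanE K m n ≤ (SteinbergAlgebra.component K S (m - n)).comap φ := by
    refine Submodule.span_le.2 ?_
    rintro _ ⟨U, V, hU, hV, rfl⟩ γ hγ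
    rw [hφ m n U V hU hV, SteinbergAlgebra.ind] at hγ
    by_contra hne
    exact hγ (if_neg fun h => hne h.1)
  exact key ha

end refinement

end CovRep

namespace SteinbergAlgebra

variable {X : Type u} [TopologicalSpace X] {K : Type v} [Field K] {S : LHomeo X}

/-- At $\gamma$ only the summand of index $\deg\gamma$ can be non-zero, so a homogeneous sum equals
its summand in that degree. It serves for injectivity, with $g=0$, and for the grading. -/
theorem eq_of_sum_mem_component (s : Finset ℤ) (f : ℤ → SteinbergAlgebra K S)
    (hf : ∀ d, f d ∈ component K S d) {d : ℤ} {g : SteinbergAlgebra K S} (hg : g ∈ component K S d)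
    (hs : ∑ i ∈ s, f i = g) (hd : d ∉ s → f d = 0) : f d = g := by
  ext γ
  have ev : ∀ t : Finset ℤ, (∑ i ∈ t, f i) γ = ∑ i ∈ t, f i γ := fun t => by
    let e : SteinbergAlgebra K S →ₗ[K] K :=
      { toFun := fun f => f γ, map_add' := fun _ _ => rfl, map_smul' := fun _ _ => rfl }
    exact map_sum e f t
  by_cases hγ : γ.deg = d
  · rw [← hs, ev, Finset.sum_eq_single d]
    · intro i _ hi
      by_contra h
      exact hi ((hf i γ h).symm.trans hγ)
    · intro h
      rw [hd h, zero_apply]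
  · rw [not_imp_comm.1 (hf d γ) hγ, not_imp_comm.1 (hg γ) hγ]

end SteinbergAlgebra

namespace CovRep

variable {X : Type u} [MetricSpace X] [CompactSpace X] [TotallyDisconnectedSpace X]
variable {S : LHomeo X} {P : ℕ → ClopenPartition X}
variable {A : Type w} [Ring A] [StarRing A] (C : CovRep S A)
variable {K : Type v} [Field K] [Module K A]

/-- Collect the spanning elements by $d=m-n$. The images of the collected parts lie in different
homogeneous components, so each image vanishes; each part lies in the span for one pair $(m,n)$,
where `eq_zero_of_mem_spanE` applies. -/
theorem eq_zero_of_mem_iSup_spanE (h : SigmaRefined S P)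
    (φ : A →ₗ[K] SteinbergAlgebra K S)
    (hφ : ∀ m n U V, IsClopen U → IsClopen V →
      (φ (C.E m n U V)).1 = SteinbergAlgebra.ind K (DRGroupoid.Z S U m n V))
    {a : A} (ha : a ∈ ⨆ k : ℕ × ℕ, C.spanE K k.1 k.2) (ha0 : φ a = 0) : a = 0 := by
  have hle : (⨆ k : ℕ × ℕ, C.spanE K k.1 k.2) ≤
      ⨆ d : ℤ, ⨆ k : {k : ℕ × ℕ // (k.1 : ℤ) - k.2 = d}, C.spanE K k.1.1 k.1.2 :=
    iSup_le fun k => (le_iSup (fun l : {l : ℕ × ℕ // (l.1 : ℤ) - l.2 = k.1 - k.2} =>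
      C.spanE K l.1.1 l.1.2) ⟨k, rfl⟩).trans (le_iSup (fun d : ℤ =>
        ⨆ k : {k : ℕ × ℕ // (k.1 : ℤ) - k.2 = d}, C.spanE K k.1.1 k.1.2) _)
  obtain ⟨f, hf, rfl⟩ := (Submodule.mem_iSup_iff_exists_finsupp _ _).1 (hle ha)
  have hcomp : ∀ d, φ (f d) ∈ SteinbergAlgebra.component K S d := by
    intro d
    rcases C.exists_mem_spanE_add h (hf d) with h0 | ⟨m, n, rfl, hmn⟩
    · rw [h0, map_zero]; exact Submodule.zero_mem _
    · exact C.map_mem_component φ hφ hmn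
  refine Finset.sum_eq_zero fun d _ => ?_
  have hzero : φ (f d) = 0 := by
    refine SteinbergAlgebra.eq_of_sum_mem_component f.support (fun d => φ (f d)) hcomp
      (Submodule.zero_mem _) ?_ fun hd => ?_
    · rw [← map_sum]; exact ha0
    · rw [Finsupp.notMem_support_iff.1 hd, map_zero]
  rcases C.exists_mem_spanE_add h (hf d) with h0 | ⟨m, n, rfl, hmn⟩
  · exact h0
  · exact C.eq_zero_of_mem_spanE h φ hφ hmn hzero

end CovRep

/-! ### The covariant representation in the Steinberg algebra -/

namespace SteinbergAlgebra

open DRGroupoid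

section unital

variable {X : Type u} [TopologicalSpace X] {K : Type v} [Field K] {S : LHomeo X}
variable [CompactSpace X] [T2Space X] {U V W : Set X}

theorem ind_Z_mem (hU : IsClopen U) (hV : IsClopen V) (m n : ℕ) :
    ind K (Z S U m n V) ∈ steinberg K S :=
  have hc := isCompact_Z hU.isClosed hV.isClosed m n
  ind_mem ⟨hc.isClosed, isOpen_Z hU.isOpen hV.isOpen m n⟩ hc

open Classical in
variable (K) in
/-- The characteristic function of a set `B` as an element of the Steinberg algebra, if it is
one. -/
noncomputable def indSet (B : Set (DRGroupoid S)) : SteinbergAlgebra K S :=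
  -- The default `0` makes this total in `B`, so that equal sets give equal elements without
  -- carrying membership proofs.
  if h : ind K B ∈ steinberg K S then ⟨ind K B, h⟩ else 0

theorem coe_indSet {B : Set (DRGroupoid S)} (h : ind K B ∈ steinberg K S) :
    (indSet K B).1 = ind K B := by
  exact congrArg Subtype.val (dif_pos h)

theorem coe_indSet_Z (hU : IsClopen U) (hV : IsClopen V) (m n : ℕ) :
    (indSet K (Z S U m n V)).1 = ind K (Z S U m n V) :=
  coe_indSet (ind_Z_mem hU hV m n)

variable [TotallyDisconnectedSpace X]

/-- When the source map is injective on the second factor, each convolution sum has at most one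
non-zero term, and products become products of sets. Membership of the result in the Steinberg
algebra comes for free from that of the product. -/
theorem indSet_mul {B B' B'' : Set (DRGroupoid S)} (hB : ind K B ∈ steinberg K S)
    (hB' : ind K B' ∈ steinberg K S) (hinj : Set.InjOn DRGroupoid.s B') (h : setMul B B' = B'') :
    indSet K B * indSet K B' = indSet K B'' := by
  have hmul : (indSet K B * indSet K B').1 = ind K B'' := by
    change conv (indSet K B).1 (indSet K B').1 = _
    rw [coe_indSet hB, coe_indSet hB', conv_ind hinj, h]
  have hmem : ind K B'' ∈ steinberg K S := hmul ▸ (indSet K B * indSet K B').2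
  exact Subtype.ext (hmul.trans (coe_indSet hmem).symm)

theorem star_indSet_Z [StarRing K] (hU : IsClopen U) (hV : IsClopen V) (m n : ℕ) :
    star (indSet K (Z S U m n V)) = indSet K (Z S V n m U) := by
  refine Subtype.ext ?_
  rw [coe_indSet_Z hV hU]
  change invol (indSet K (Z S U m n V)).1 = _
  rw [coe_indSet_Z hU hV, invol_ind, inv_preimage_Z]

/-- An element $(x,-n,y)$ of this set has $x=\sigma^n(y)$. -/
theorem injOn_s_Z_zero (n : ℕ) : Set.InjOn DRGroupoid.s (Z S U 0 n V) := by
  rintro γ ⟨h₁, _, _, h₄⟩ γ' ⟨h₁', _, _, h₄'⟩ h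
  exact DRGroupoid.ext (h₄.trans ((congrArg _ h).trans h₄'.symm)) (h₁.trans h₁'.symm) h

theorem indSet_mul_indSet_diag (hU : IsClopen U) (hV : IsClopen V) (hW : IsClopen W) (m n : ℕ) :
    indSet K (Z S U m n V) * indSet K (Z S W 0 0 W) = indSet K (Z S U m n (V ∩ W)) := by
  refine indSet_mul (ind_Z_mem hU hV m n) (ind_Z_mem hW hW 0 0) (injOn_s_Z_zero 0) ?_
  ext γ
  constructor
  · rintro ⟨α, ⟨h₁, h₂, h₃, h₄⟩, β, ⟨h₅, h₆, h₇, h₈⟩, h, rfl⟩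
    have hs : α.s = β.s := h.trans h₈
    refine ⟨?_, h₂, ⟨?_, h₇⟩, ?_⟩
    · simp only [mul, h₁, h₅]; simp
    · exact hs ▸ h₃
    · exact h₄.trans (congrArg _ hs)
  · rintro ⟨h₁, h₂, ⟨h₃, h₃'⟩, h₄⟩
    exact ⟨γ, ⟨h₁, h₂, h₃, h₄⟩, ⟨γ.s, 0, γ.s, 0, 0, by simp, rfl⟩, ⟨by simp, h₃', h₃', rfl⟩, rfl,
      DRGroupoid.ext rfl (add_zero _).symm rfl⟩

/-- An element $(x,m-n,y)$ factors through the point $\sigma^m(x)=\sigma^n(y)$. -/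
theorem indSet_mul_indSet_zero (hU : IsClopen U) (hV : IsClopen V) (m n : ℕ) :
    indSet K (Z S U m 0 Set.univ) * indSet K (Z S Set.univ 0 n V) = indSet K (Z S U m n V) := by
  refine indSet_mul (ind_Z_mem hU isClopen_univ m 0) (ind_Z_mem isClopen_univ hV 0 n)
    (injOn_s_Z_zero n) ?_
  ext γ
  constructor
  · rintro ⟨α, ⟨h₁, h₂, h₃, h₄⟩, β, ⟨h₅, h₆, h₇, h₈⟩, h, rfl⟩
    refine ⟨?_, h₂, h₇, h₄.trans (h.trans h₈)⟩
    simp only [mul, h₁, h₅]; push_cast; ring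
  · rintro ⟨h₁, h₂, h₃, h₄⟩
    refine ⟨⟨γ.r, m - (0 : ℕ), S.σ^[m] γ.r, m, 0, rfl, rfl⟩, ⟨rfl, h₂, trivial, rfl⟩,
      ⟨S.σ^[m] γ.r, (0 : ℕ) - n, γ.s, 0, n, rfl, h₄⟩, ⟨rfl, trivial, h₃, h₄⟩, rfl, ?_⟩
    refine DRGroupoid.ext rfl ?_ rfl
    simp only [mul, h₁]; push_cast; ring

theorem indSet_zero_mul_indSet_zero (hV : IsClopen V) (m n : ℕ) :
    indSet K (Z S Set.univ 0 m Set.univ) * indSet K (Z S Set.univ 0 n V) =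
      indSet K (Z S Set.univ 0 (m + n) V) := by
  refine indSet_mul (ind_Z_mem isClopen_univ isClopen_univ 0 m) (ind_Z_mem isClopen_univ hV 0 n)
    (injOn_s_Z_zero n) ?_
  ext γ
  constructor
  · rintro ⟨α, ⟨h₁, h₂, h₃, h₄⟩, β, ⟨h₅, h₆, h₇, h₈⟩, h, rfl⟩
    refine ⟨?_, trivial, h₇, ?_⟩
    · simp only [mul, h₁, h₅]; push_cast; ring
    · change α.r = S.σ^[m + n] β.s
      rw [Function.iterate_add_apply]
      exact h₄.trans (congrArg _ (h.trans h₈))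
  · rintro ⟨h₁, h₂, h₃, h₄⟩
    have h₅ : γ.r = S.σ^[m] (S.σ^[n] γ.s) := by rw [← Function.iterate_add_apply]; exact h₄
    refine ⟨⟨γ.r, (0 : ℕ) - m, S.σ^[n] γ.s, 0, m, rfl, h₅⟩, ⟨rfl, trivial, trivial, h₅⟩,
      ⟨S.σ^[n] γ.s, (0 : ℕ) - n, γ.s, 0, n, rfl, rfl⟩, ⟨rfl, trivial, h₃, rfl⟩, rfl, ?_⟩
    refine DRGroupoid.ext rfl ?_ rfl
    simp only [mul, h₁]; push_cast; ring

/-- A unit over $y\in\sigma(U)$ factors through the preimage of $y$ in $U$, which is unique because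
$\sigma$ is injective on $U$. -/
theorem indSet_mul_indSet_image (hU : IsClopen U) (hinj : Set.InjOn S.σ U) :
    indSet K (Z S Set.univ 0 1 U) * indSet K (Z S U 1 0 Set.univ) =
      indSet K (Z S (S.σ '' U) 0 0 (S.σ '' U)) := by
  refine indSet_mul (ind_Z_mem isClopen_univ hU 0 1) (ind_Z_mem hU isClopen_univ 1 0) ?_ ?_
  · rintro γ ⟨h₁, h₂, _, h₄⟩ γ' ⟨h₁', h₂', _, h₄'⟩ h
    exact DRGroupoid.ext (hinj h₂ h₂' (h₄.trans (h.trans h₄'.symm))) (h₁.trans h₁'.symm) h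
  · ext γ
    constructor
    · rintro ⟨α, ⟨h₁, h₂, h₃, h₄⟩, β, ⟨h₅, h₆, h₇, h₈⟩, h, rfl⟩
      have h₄' : α.r = S.σ α.s := h₄
      have h₈' : S.σ β.r = β.s := h₈
      refine ⟨?_, ⟨α.s, h₃, h₄'.symm⟩, ⟨β.r, h₆, h₈'⟩, ?_⟩
      · simp only [mul, h₁, h₅]; simp
      · exact h₄'.trans ((congrArg _ h).trans h₈')
    · rintro ⟨h₁, ⟨x, hx, hxr⟩, _, h₄⟩
      have h₄' : γ.r = γ.s := h₄
      refine ⟨⟨γ.r, (0 : ℕ) - (1 : ℕ), x, 0, 1, rfl, hxr.symm⟩, ⟨rfl, trivial, hx, hxr.symm⟩,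
        ⟨x, (1 : ℕ) - (0 : ℕ), γ.s, 1, 0, rfl, hxr.trans h₄'⟩,
        ⟨rfl, hx, trivial, hxr.trans h₄'⟩, rfl, ?_⟩
      refine DRGroupoid.ext rfl ?_ rfl
      simp only [mul, h₁]; simp

theorem diag_mul_indSet (hU : IsClopen U) (hV : IsClopen V) (hW : IsClopen W) (m n : ℕ)
    (hinj : Set.InjOn DRGroupoid.s (Z S U m n V)) :
    indSet K (Z S W 0 0 W) * indSet K (Z S U m n V) = indSet K (Z S (W ∩ U) m n V) := by
  refine indSet_mul (ind_Z_mem hW hW 0 0) (ind_Z_mem hU hV m n) hinj ?_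
  ext γ
  constructor
  · rintro ⟨α, ⟨h₁, h₂, h₃, h₄⟩, β, ⟨h₅, h₆, h₇, h₈⟩, h, rfl⟩
    have hs : α.r = β.r := Eq.trans h₄ h
    refine ⟨?_, ⟨h₂, hs ▸ h₆⟩, h₇, Eq.trans (congrArg _ hs) h₈⟩
    simp only [mul, h₁, h₅]; simp
  · rintro ⟨h₁, ⟨h₂, h₂'⟩, h₃, h₄⟩
    exact ⟨⟨γ.r, 0, γ.r, 0, 0, by simp, rfl⟩, ⟨by simp, h₂, h₂, rfl⟩, γ, ⟨h₁, h₂', h₃, h₄⟩, rfl,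
      DRGroupoid.ext rfl (zero_add _).symm rfl⟩

theorem cyl_eq_indSet {B : Set (DRGroupoid S)} (hB : IsCyl B) : cyl (K := K) B hB = indSet K B :=
  Subtype.ext (coe_indSet (ind_mem_of_isCyl hB)).symm

/-- The Steinberg algebra of a groupoid with compact unit space is unital. -/
noncomputable abbrev unitalRing : Ring (SteinbergAlgebra K S) where
  -- Extending the given non-unital ring leaves the product unchanged, so the existing star and
  -- module structures still apply.
  __ := (inferInstance : NonUnitalRing (SteinbergAlgebra K S))
  one := indSet K (Z S Set.univ 0 0 Set.univ)
  one_mul f := by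
    induction f using SteinbergAlgebra.induction with
    | h₀ => exact mul_zero _
    | h₁ B hB =>
      have hinj := hB.injOn_s
      rw [cyl_eq_indSet]
      obtain ⟨U, m, n, V, hU, hV, _, _, rfl⟩ := hB
      exact (diag_mul_indSet hU hV isClopen_univ m n hinj).trans (by rw [Set.univ_inter])
    | h₂ f g hf hg => exact (mul_add _ _ _).trans (congrArg₂ _ hf hg)
    | h₃ c f hf => exact (mul_smul_comm _ _ _).trans (congrArg _ hf)
  mul_one f := by
    induction f using SteinbergAlgebra.induction with
    | h₀ => exact zero_mul _
    | h₁ B hB =>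
      rw [cyl_eq_indSet]
      obtain ⟨U, m, n, V, hU, hV, _, _, rfl⟩ := hB
      exact (indSet_mul_indSet_diag hU hV isClopen_univ m n).trans (by rw [Set.inter_univ])
    | h₂ f g hf hg => exact (add_mul _ _ _).trans (congrArg₂ _ hf hg)
    | h₃ c f hf => exact (smul_mul_assoc _ _ _).trans (congrArg _ hf)

attribute [local instance] unitalRing

/-- The unital algebra structure of the Steinberg algebra. -/
noncomputable abbrev unitalAlgebra : Algebra K (SteinbergAlgebra K S) :=
  Algebra.ofModule smul_mul_assoc mul_smul_comm

attribute [local instance] unitalAlgebra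

variable [StarRing K]

/-- The source map need not be injective on $Z(X,1,0,X)$, so `indSet_mul` does not apply directly.
After taking adjoints the second factor is diagonal. -/
theorem diag_mul_indSet_one (hW : IsClopen W) :
    indSet K (Z S W 0 0 W) * indSet K (Z S Set.univ 1 0 Set.univ) =
      indSet K (Z S W 1 0 Set.univ) := by
  refine star_injective ?_
  rw [star_mul, star_indSet_Z hW hW, star_indSet_Z isClopen_univ isClopen_univ,
    star_indSet_Z hW isClopen_univ, indSet_mul_indSet_diag isClopen_univ isClopen_univ hW,
    Set.univ_inter]

variable (K S) in
/-- The canonical covariant representation in the Steinberg algebra. -/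
noncomputable def covRep : CovRep S (SteinbergAlgebra K S) where
  p U := indSet K (Z S U 0 0 U)
  t := indSet K (Z S Set.univ 1 0 Set.univ)
  p_univ := rfl
  star_p hU := star_indSet_Z hU hU 0 0
  p_inter {U V} hU hV := by
    rw [indSet_mul_indSet_diag hU hU hV]
    congr 1
    ext γ
    constructor
    · rintro ⟨h₁, h₂, h₃, h₄⟩
      exact ⟨h₁, h₂.1, h₃, h₄⟩
    · rintro ⟨h₁, h₂, h₃, h₄⟩
      have h₄' : γ.r = γ.s := h₄
      exact ⟨h₁, h₄' ▸ h₃, h₃, h₄⟩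
  p_union {U V} hU hV hd := by
    classical
    ext γ
    rw [add_apply, coe_indSet_Z (hU.union hV) (hU.union hV), coe_indSet_Z hU hU,
      coe_indSet_Z hV hV]
    simp only [ind]
    by_cases h₄ : γ.r = γ.s
    · by_cases hγU : γ.s ∈ U
      · have hγV := Set.disjoint_left.1 hd hγU
        simp [Z, h₄, hγU, hγV]
      · by_cases hγV : γ.s ∈ V <;> simp [Z, h₄, hγU, hγV]
    · simp [Z, h₄]
  t_mul_p {U} hU := by
    rw [indSet_mul_indSet_diag isClopen_univ isClopen_univ hU,
      diag_mul_indSet_one (S.isClopen_preimage hU)]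
    congr 1
    ext γ
    constructor
    · rintro ⟨h₁, h₂, h₃, h₄⟩
      have h₄' : S.σ γ.r = γ.s := h₄
      exact ⟨h₁, show S.σ γ.r ∈ U from h₄' ▸ h₃.2, trivial, h₄⟩
    · rintro ⟨h₁, h₂, h₃, h₄⟩
      have h₄' : S.σ γ.r = γ.s := h₄
      exact ⟨h₁, trivial, ⟨trivial, h₄' ▸ h₂⟩, h₄⟩
  star_t_mul_p_mul_t {U} hU hinj := by
    -- The projection $p_U$ is doubled, $t^*p_Ut=(t^*p_U)(p_Ut)$, so that both factors are
    -- restricted to $U$, where $\sigma$ is injective.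
    have h : indSet K (Z S Set.univ 0 1 U) * indSet K (Z S U 0 0 U) =
        indSet K (Z S Set.univ 0 1 U) := by
      rw [indSet_mul_indSet_diag isClopen_univ hU hU, Set.inter_self]
    rw [star_indSet_Z isClopen_univ isClopen_univ,
      indSet_mul_indSet_diag isClopen_univ isClopen_univ hU, Set.univ_inter, ← h, mul_assoc,
      diag_mul_indSet_one hU, indSet_mul_indSet_image hU hinj]
  p_mul_t_mul_star_t_mul_p {U} hU hinj := by
    rw [diag_mul_indSet_one hU, star_indSet_Z isClopen_univ isClopen_univ,
      indSet_mul_indSet_diag isClopen_univ isClopen_univ hU, Set.univ_inter,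
      indSet_mul_indSet_zero hU hU]
    congr 1
    ext γ
    constructor
    · rintro ⟨h₁, h₂, h₃, h₄⟩
      exact ⟨by simpa using h₁, h₂, h₃, hinj h₂ h₃ h₄⟩
    · rintro ⟨h₁, h₂, h₃, h₄⟩
      exact ⟨by simpa using h₁, h₂, h₃, congrArg S.σ h₄⟩

theorem covRep_p (U : Set X) : (covRep K S).p U = indSet K (Z S U 0 0 U) := rfl

theorem covRep_t : (covRep K S).t = indSet K (Z S Set.univ 1 0 Set.univ) := rfl

theorem star_covRep_t_pow_mul_p (n : ℕ) (hV : IsClopen V) :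
    star (covRep K S).t ^ n * (covRep K S).p V = indSet K (Z S Set.univ 0 n V) := by
  rw [covRep_t, star_indSet_Z isClopen_univ isClopen_univ, covRep_p]
  induction n with
  | zero =>
    rw [pow_zero, one_mul]
    congr 1
    ext γ
    constructor
    · rintro ⟨h₁, _, h₃, h₄⟩
      exact ⟨h₁, trivial, h₃, h₄⟩
    · rintro ⟨h₁, _, h₃, h₄⟩
      exact ⟨h₁, (show γ.r = γ.s from h₄) ▸ h₃, h₃, h₄⟩
  | succ n ih =>
    rw [pow_succ', mul_assoc, ih, indSet_zero_mul_indSet_zero hV, add_comm 1 n]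

theorem covRep_E (m n : ℕ) (hU : IsClopen U) (hV : IsClopen V) :
    (covRep K S).E m n U V = indSet K (Z S U m n V) := by
  -- Computed through the adjoint $(t^*)^mp_U$, since the source map need not be injective on the
  -- set belonging to $t$.
  have h : (covRep K S).p U * (covRep K S).t ^ m = indSet K (Z S U m 0 Set.univ) := by
    rw [← star_star ((covRep K S).p U * (covRep K S).t ^ m), star_mul, star_pow,
      (covRep K S).star_p hU, star_covRep_t_pow_mul_p m hU, star_indSet_Z isClopen_univ hU]
  rw [CovRep.E, h, star_covRep_t_pow_mul_p n hV, indSet_mul_indSet_zero hU hV]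

end unital

end SteinbergAlgebra

/-! ### Projections and edge sums in an even layer -/

section layerAlgebra

open LayerGraph

variable {X : Type u} [MetricSpace X] {S : LHomeo X} {P : ℕ → ClopenPartition X}
variable (K : Type v) [Field K] (h : SigmaRefined S P) (j : ℕ)

section sums

variable {M : Type*} [AddCommMonoid M]

-- This and the next three lemmas replace a sum over a member of a separation by a sum over edges of
-- one colour, in the even layers over those with a given range, so that sums over all ranges can be
-- collected with `Finset.sum_fiberwise`.
open Classical in
theorem sum_evenB (Z : (P (2 * j)).parts) (F : EvenEdge S (P (2 * j + 1)) (P (2 * j)) → M) :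
    ∑ e ∈ evenB S P j Z, F e = ∑ q with q.1.2 = Z, F (Sum.inl q) := by
  have : evenB S P j Z = (Finset.univ.filter fun q : BlueEdge (P (2 * j + 1)) (P (2 * j)) =>
      q.1.2 = Z).map ⟨Sum.inl, Sum.inl_injective⟩ := by
    ext e
    simp only [mem_evenB, Finset.mem_map, Finset.mem_filter, Finset.mem_univ, true_and,
      Function.Embedding.coeFn_mk]
    exact ⟨fun ⟨q, h, h'⟩ => ⟨q, h', h.symm⟩, fun ⟨q, h, h'⟩ => ⟨q, h'.symm, h⟩⟩
  rw [this, Finset.sum_map]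
  rfl

open Classical in
theorem sum_evenR (Z : (P (2 * j)).parts) (F : EvenEdge S (P (2 * j + 1)) (P (2 * j)) → M) :
    ∑ e ∈ evenR S P j Z, F e = ∑ q with q.1.2 = Z, F (Sum.inr q) := by
  have : evenR S P j Z = (Finset.univ.filter fun q : RedEdgeEven S (P (2 * j + 1)) (P (2 * j)) =>
      q.1.2 = Z).map ⟨Sum.inr, Sum.inr_injective⟩ := by
    ext e
    simp only [mem_evenR, Finset.mem_map, Finset.mem_filter, Finset.mem_univ, true_and,
      Function.Embedding.coeFn_mk]
    exact ⟨fun ⟨q, h, h'⟩ => ⟨q, h', h.symm⟩, fun ⟨q, h, h'⟩ => ⟨q, h'.symm, h⟩⟩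
  rw [this, Finset.sum_map]
  rfl

open Classical in
theorem sum_oddB (Z : (P (2 * j + 1)).parts)
    (F : OddEdge S (P (2 * (j + 1))) (P (2 * j + 1)) → M) :
    ∑ e ∈ oddB S P j Z, F e = ∑ q with q.1.2 = Z, F (Sum.inl q) := by
  have : oddB S P j Z = (Finset.univ.filter fun q : BlueEdge (P (2 * (j + 1))) (P (2 * j + 1)) =>
      q.1.2 = Z).map ⟨Sum.inl, Sum.inl_injective⟩ := by
    ext e
    simp only [mem_oddB, Finset.mem_map, Finset.mem_filter, Finset.mem_univ, true_and,
      Function.Embedding.coeFn_mk]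
    exact ⟨fun ⟨q, h, h'⟩ => ⟨q, h', h.symm⟩, fun ⟨q, h, h'⟩ => ⟨q, h'.symm, h⟩⟩
  rw [this, Finset.sum_map]
  rfl

open Classical in
theorem sum_oddR (f : RedEdgeEven S (P (2 * j + 1)) (P (2 * j)))
    (F : OddEdge S (P (2 * (j + 1))) (P (2 * j + 1)) → M) :
    ∑ e ∈ oddR S P j f, F e =
      ∑ q with q.1.2 = f.1.1 ∧ (q.1.1 : Set X) ⊆ f.1.2, F (Sum.inr q) := by
  have : oddR S P j f = (Finset.univ.filter fun q : RedEdgeOdd S (P (2 * (j + 1))) (P (2 * j + 1)) =>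
      q.1.2 = f.1.1 ∧ (q.1.1 : Set X) ⊆ f.1.2).map ⟨Sum.inr, Sum.inr_injective⟩ := by
    ext e
    simp only [mem_oddR, Finset.mem_map, Finset.mem_filter, Finset.mem_univ, true_and,
      Function.Embedding.coeFn_mk]
    exact ⟨fun ⟨q, h, h'⟩ => ⟨q, h', h.symm⟩, fun ⟨q, h, h'⟩ => ⟨q, h'.symm, h⟩⟩
  rw [this, Finset.sum_map]
  rfl

end sums

/-- A blue edge of an even layer, in the Leavitt path algebra. -/
noncomputable def bl (f : BlueEdge (P (2 * j + 1)) (P (2 * j))) : (evenLayer h j).L K :=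
  (evenLayer h j).ed K (Sum.inl f)

/-- A red edge of an even layer, in the Leavitt path algebra. -/
noncomputable def rd (e : RedEdgeEven S (P (2 * j + 1)) (P (2 * j))) : (evenLayer h j).L K :=
  (evenLayer h j).ed K (Sum.inr e)

theorem v₀_mul_bl (f : BlueEdge (P (2 * j + 1)) (P (2 * j))) :
    (evenLayer h j).v₀ K f.1.2 * bl K h j f = bl K h j f :=
  (evenLayer h j).r_mul_ed K (Sum.inl f)

theorem v₀_mul_rd (e : RedEdgeEven S (P (2 * j + 1)) (P (2 * j))) :
    (evenLayer h j).v₀ K e.1.2 * rd K h j e = rd K h j e :=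
  (evenLayer h j).r_mul_ed K (Sum.inr e)

theorem bl_mul_v₁ (f : BlueEdge (P (2 * j + 1)) (P (2 * j))) :
    bl K h j f * (evenLayer h j).v₁ K f.1.1 = bl K h j f :=
  (evenLayer h j).ed_mul_s K (Sum.inl f)

theorem rd_mul_v₁ (e : RedEdgeEven S (P (2 * j + 1)) (P (2 * j))) :
    rd K h j e * (evenLayer h j).v₁ K e.1.1 = rd K h j e :=
  (evenLayer h j).ed_mul_s K (Sum.inr e)

theorem v₀_mul_bl_ne {f : BlueEdge (P (2 * j + 1)) (P (2 * j))} {Z : (P (2 * j)).parts}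
    (hne : Z ≠ f.1.2) : (evenLayer h j).v₀ K Z * bl K h j f = 0 := by
  rw [← v₀_mul_bl, ← mul_assoc, v₀_mul_ne _ _ hne, zero_mul]

theorem v₀_mul_rd_ne {e : RedEdgeEven S (P (2 * j + 1)) (P (2 * j))} {Z : (P (2 * j)).parts}
    (hne : Z ≠ e.1.2) : (evenLayer h j).v₀ K Z * rd K h j e = 0 := by
  rw [← v₀_mul_rd, ← mul_assoc, v₀_mul_ne _ _ hne, zero_mul]

open Classical in
/-- The projection `∑ v`, where `v` runs over the members of `𝒫_{2j}` contained in `U`. -/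
noncomputable def proj (U : Set X) : (evenLayer h j).L K :=
  ∑ Z ∈ Finset.univ.filter fun Z : (P (2 * j)).parts => (Z : Set X) ⊆ U, (evenLayer h j).v₀ K Z

open Classical in
theorem proj_mul_v₀ (U : Set X) (Z : (P (2 * j)).parts) :
    proj K h j U * (evenLayer h j).v₀ K Z =
      if (Z : Set X) ⊆ U then (evenLayer h j).v₀ K Z else 0 := by
  rw [proj, Finset.sum_mul]
  split_ifs with hZ
  · rw [Finset.sum_eq_single_of_mem Z (by simpa using hZ), v₀_mul_self]
    exact fun Z' _ hne => v₀_mul_ne _ _ hne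
  · refine Finset.sum_eq_zero fun Z' hZ' => v₀_mul_ne _ _ ?_
    rintro rfl
    exact hZ (by simpa using hZ')

open Classical in
theorem proj_mul_bl (U : Set X) (f : BlueEdge (P (2 * j + 1)) (P (2 * j))) :
    proj K h j U * bl K h j f = if (f.1.2 : Set X) ⊆ U then bl K h j f else 0 := by
  rw [← v₀_mul_bl, ← mul_assoc, proj_mul_v₀]
  split_ifs <;> simp

open Classical in
theorem proj_mul_rd (U : Set X) (e : RedEdgeEven S (P (2 * j + 1)) (P (2 * j))) :
    proj K h j U * rd K h j e = if (e.1.2 : Set X) ⊆ U then rd K h j e else 0 := by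
  rw [← v₀_mul_rd, ← mul_assoc, proj_mul_v₀]
  split_ifs <;> simp

theorem proj_mul_proj (U V : Set X) : proj K h j U * proj K h j V = proj K h j (U ∩ V) := by
  classical
  conv_lhs => rhs; rw [proj]
  rw [Finset.mul_sum]
  simp only [proj_mul_v₀]
  rw [proj, ← Finset.sum_filter, Finset.filter_filter]
  refine Finset.sum_congr ?_ fun _ _ => rfl
  ext Z
  simp [Set.subset_inter_iff, and_comm]

theorem proj_univ : proj K h j Set.univ = (evenLayer h j).p K := by
  simp [proj, p]

theorem proj_part (Z : (P (2 * j)).parts) :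
    proj K h j (Z : Set X) = (evenLayer h j).v₀ K Z := by
  classical
  rw [proj, Finset.sum_eq_single_of_mem Z (by simp)]
  intro Z' hZ' hne
  obtain ⟨x, hx⟩ := (P (2 * j)).nonempty_of_mem _ Z'.2
  exact absurd (Subtype.ext ((P (2 * j)).eq_of_mem Z'.2 Z.2 hx
    ((Finset.mem_filter.1 hZ').2 hx))) hne

/-- Saturation is essential: otherwise a member of $\mathcal P_{2j}$ could lie in $U\cup V$ without
lying in $U$ or in $V$. -/
theorem proj_union {U V : Set X} (hU : (P (2 * j)).Saturates U) (hV : (P (2 * j)).Saturates V)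
    (hd : Disjoint U V) : proj K h j (U ∪ V) = proj K h j U + proj K h j V := by
  classical
  rw [proj, proj, proj, ← Finset.sum_union]
  · refine Finset.sum_congr ?_ fun _ _ => rfl
    ext Z
    simp only [Finset.mem_filter, Finset.mem_univ, true_and, Finset.mem_union]
    constructor
    · intro hZ
      obtain ⟨x, hx⟩ := (P (2 * j)).nonempty_of_mem _ Z.2
      exact (hZ hx).imp (hU Z Z.2 x hx) (hV Z Z.2 x hx)
    · rintro (hZ | hZ)
      · exact hZ.trans Set.subset_union_left
      · exact hZ.trans Set.subset_union_right
  · rw [Finset.disjoint_left]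
    intro Z hZ hZ'
    obtain ⟨x, hx⟩ := (P (2 * j)).nonempty_of_mem _ Z.2
    exact Set.disjoint_left.1 hd ((Finset.mem_filter.1 hZ).2 hx) ((Finset.mem_filter.1 hZ').2 hx)

open Classical in
/-- The sum of the blue edges. -/
noncomputable def blSum : (evenLayer h j).L K := ∑ f, bl K h j f

open Classical in
/-- The sum of the red edges. -/
noncomputable def rdSum : (evenLayer h j).L K := ∑ e, rd K h j e

/-- Each member of $\mathcal P_{2j+1}$ lies in exactly one member of $\mathcal P_{2j}$. -/
theorem blueEdge_bijective (h : SigmaRefined S P) (j : ℕ) :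
    Function.Bijective fun f : BlueEdge (P (2 * j + 1)) (P (2 * j)) => f.1.1 := by
  constructor
  · rintro ⟨⟨W, Z⟩, hf⟩ ⟨⟨W', Z'⟩, hf'⟩ (rfl : W = W')
    obtain ⟨x, hx⟩ := (P (2 * j + 1)).nonempty_of_mem _ W.2
    obtain rfl : Z = Z' := Subtype.ext ((P (2 * j)).eq_of_mem Z.2 Z'.2 (hf hx) (hf' hx))
    rfl
  · intro W
    obtain ⟨Z, hZ, hsub⟩ := h.finer (2 * j) _ W.2
    exact ⟨⟨(W, ⟨Z, hZ⟩), hsub⟩, rfl⟩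

section star

variable [StarRing K]

theorem star_proj (U : Set X) : star (proj K h j U) = proj K h j U := by
  simp [proj, star_v₀]

theorem star_bl_mul_bl (f : BlueEdge (P (2 * j + 1)) (P (2 * j))) :
    star (bl K h j f) * bl K h j f = (evenLayer h j).v₁ K f.1.1 :=
  (evenLayer h j).star_ed_mul_ed K (Sum.inl f)

theorem star_rd_mul_rd (e : RedEdgeEven S (P (2 * j + 1)) (P (2 * j))) :
    star (rd K h j e) * rd K h j e = (evenLayer h j).v₁ K e.1.1 :=
  (evenLayer h j).star_ed_mul_ed K (Sum.inr e)

theorem star_bl_mul_bl_ne {f f' : BlueEdge (P (2 * j + 1)) (P (2 * j))} (hne : f ≠ f') :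
    star (bl K h j f) * bl K h j f' = 0 := by
  by_cases hr : f.1.2 = f'.1.2
  · exact (evenLayer h j).star_ed_mul_ed_ne K (v := f.1.2) (Y := evenB S P j f.1.2) (Or.inl rfl)
      ((mem_evenB j).2 ⟨f, rfl, rfl⟩) ((mem_evenB j).2 ⟨f', rfl, hr.symm⟩)
      fun h' => hne (Sum.inl_injective h')
  · rw [← v₀_mul_bl K h j f, star_mul, star_v₀, mul_assoc, v₀_mul_bl_ne K h j hr, mul_zero]

/-- For equal ranges both edges belong to the same member of the separation; for different ranges
the vertices are orthogonal. So all red edges, not only those with a common range, are mutually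
orthogonal in this sense. -/
theorem star_rd_mul_rd_ne {e e' : RedEdgeEven S (P (2 * j + 1)) (P (2 * j))} (hne : e ≠ e') :
    star (rd K h j e) * rd K h j e' = 0 := by
  by_cases hr : e.1.2 = e'.1.2
  · exact (evenLayer h j).star_ed_mul_ed_ne K (v := e.1.2) (Y := evenR S P j e.1.2) (Or.inr rfl)
      ((mem_evenR j).2 ⟨e, rfl, rfl⟩) ((mem_evenR j).2 ⟨e', rfl, hr.symm⟩)
      fun h' => hne (Sum.inr_injective h')
  · rw [← v₀_mul_rd K h j e, star_mul, star_v₀, mul_assoc, v₀_mul_rd_ne K h j hr, mul_zero]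

theorem rd_mul_star_bl_ne {e : RedEdgeEven S (P (2 * j + 1)) (P (2 * j))}
    {f : BlueEdge (P (2 * j + 1)) (P (2 * j))} (hne : e.1.1 ≠ f.1.1) :
    rd K h j e * star (bl K h j f) = 0 := by
  rw [← rd_mul_v₁, ← bl_mul_v₁, star_mul, star_v₁, mul_assoc, ← mul_assoc (v₁ _ _ _),
    v₁_mul_ne _ _ hne, zero_mul, mul_zero]

theorem rd_mul_star_rd_ne {e e' : RedEdgeEven S (P (2 * j + 1)) (P (2 * j))}
    (hne : e.1.1 ≠ e'.1.1) : rd K h j e * star (rd K h j e') = 0 := by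
  rw [← rd_mul_v₁, ← rd_mul_v₁ K h j e', star_mul, star_v₁, mul_assoc, ← mul_assoc (v₁ _ _ _),
    v₁_mul_ne _ _ hne, zero_mul, mul_zero]

theorem bl_mul_star_bl_ne {f f' : BlueEdge (P (2 * j + 1)) (P (2 * j))}
    (hne : f.1.1 ≠ f'.1.1) : bl K h j f * star (bl K h j f') = 0 := by
  rw [← bl_mul_v₁, ← bl_mul_v₁ K h j f', star_mul, star_v₁, mul_assoc, ← mul_assoc (v₁ _ _ _),
    v₁_mul_ne _ _ hne, zero_mul, mul_zero]

open Classical in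
theorem sum_bl_mul_star_bl (Z : (P (2 * j)).parts) :
    ∑ f with f.1.2 = Z, bl K h j f * star (bl K h j f) = (evenLayer h j).v₀ K Z :=
  (sum_evenB (S := S) j Z fun e => (evenLayer h j).ed K e * star ((evenLayer h j).ed K e)).symm.trans
    ((evenLayer h j).sum_ed_mul_star K (Or.inl rfl))

open Classical in
theorem sum_rd_mul_star_rd (Z : (P (2 * j)).parts) :
    ∑ e with e.1.2 = Z, rd K h j e * star (rd K h j e) = (evenLayer h j).v₀ K Z :=
  (sum_evenR (S := S) j Z fun e => (evenLayer h j).ed K e * star ((evenLayer h j).ed K e)).symm.trans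
    ((evenLayer h j).sum_ed_mul_star K (Or.inr rfl))

theorem blSum_mul_star_bl (f : BlueEdge (P (2 * j + 1)) (P (2 * j))) :
    blSum K h j * star (bl K h j f) = bl K h j f * star (bl K h j f) := by
  classical
  rw [blSum, Finset.sum_mul, Finset.sum_eq_single_of_mem f (Finset.mem_univ f)]
  exact fun f' _ hne => bl_mul_star_bl_ne K h j fun heq => hne ((blueEdge_bijective h j).1 heq)

/-- Distinct blue edges have distinct sources, so only the diagonal terms $ff^*$ remain. Together
with `star_blSum_mul_blSum`: the sum of the blue edges is a partial isometry from the sum of the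
vertices in $\mathcal P_{2j+1}$ to $p_{2j}$. -/
theorem blSum_mul_star_blSum : blSum K h j * star (blSum K h j) = (evenLayer h j).p K := by
  classical
  conv_lhs => rhs; rw [blSum]
  rw [star_sum, Finset.mul_sum, p]
  simp only [blSum_mul_star_bl, ← sum_bl_mul_star_bl]
  exact (Finset.sum_fiberwise _ _ _).symm

theorem star_blSum_mul_blSum :
    star (blSum K h j) * blSum K h j = ∑ W, (evenLayer h j).v₁ K W := by
  classical
  rw [← (blueEdge_bijective h j).sum_comp]
  conv_lhs => rhs; rw [blSum]
  rw [Finset.mul_sum]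
  refine Finset.sum_congr rfl fun f _ => ?_
  rw [blSum, star_sum, Finset.sum_mul, Finset.sum_eq_single_of_mem f (Finset.mem_univ f),
    star_bl_mul_bl]
  exact fun f' _ hne => star_bl_mul_bl_ne K h j hne

theorem rdSum_mul_star_blSum_mul_blSum :
    rdSum K h j * (star (blSum K h j) * blSum K h j) = rdSum K h j := by
  rw [star_blSum_mul_blSum, rdSum, Finset.sum_mul]
  refine Finset.sum_congr rfl fun e _ => ?_
  rw [Finset.mul_sum, Finset.sum_eq_single_of_mem e.1.1 (Finset.mem_univ _), rd_mul_v₁]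
  intro W _ hne
  rw [← rd_mul_v₁, mul_assoc, v₁_mul_ne _ _ hne.symm, mul_zero]

/-- The element `∑ e f^*`, where `e` runs over the red and `f` over the blue edges. -/
noncomputable def shift : (evenLayer h j).L K := rdSum K h j * star (blSum K h j)

open Classical in
theorem proj_mul_blSum (U : Set X) :
    proj K h j U * blSum K h j = ∑ f with (f.1.2 : Set X) ⊆ U, bl K h j f := by
  rw [blSum, Finset.mul_sum, Finset.sum_filter]
  simp only [proj_mul_bl]

open Classical in
theorem proj_mul_rdSum (U : Set X) :
    proj K h j U * rdSum K h j = ∑ e with (e.1.2 : Set X) ⊆ U, rd K h j e := by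
  rw [rdSum, Finset.mul_sum, Finset.sum_filter]
  simp only [proj_mul_rd]

/-- A term $ef^*$ is non-zero only if $e$ and $f$ have a common source $W$. Then a point of $W$ has
the form $\sigma(x)$ with $x\in r(e)$, and it lies in $r(f)$; by saturation $r(f)\subseteq U$
exactly when $r(e)\subseteq\sigma^{-1}(U)$. -/
theorem shift_mul_proj {U : Set X} (hU : (P (2 * j)).Saturates U)
    (hU' : (P (2 * j)).Saturates (S.σ ⁻¹' U)) :
    shift K h j * proj K h j U = proj K h j (S.σ ⁻¹' U) * shift K h j := by
  classical
  have h₁ : star (blSum K h j) * proj K h j U =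
      ∑ f with (f.1.2 : Set X) ⊆ U, star (bl K h j f) := by
    rw [← star_proj, ← star_mul, proj_mul_blSum, star_sum]
  rw [shift, mul_assoc, h₁, ← mul_assoc, proj_mul_rdSum, rdSum, blSum, star_sum, Finset.sum_mul,
    Finset.sum_mul, Finset.sum_filter, Finset.sum_filter]
  refine Finset.sum_congr rfl fun e _ => ?_
  have key : ∀ f : BlueEdge (P (2 * j + 1)) (P (2 * j)), e.1.1 = f.1.1 →
      ((f.1.2 : Set X) ⊆ U ↔ (e.1.2 : Set X) ⊆ S.σ ⁻¹' U) := by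
    intro f hef
    obtain ⟨y, hy⟩ := (P (2 * j + 1)).nonempty_of_mem _ e.1.1.2
    obtain ⟨x, hx, rfl⟩ := e.2 hy
    have hxf := f.2 (hef ▸ hy)
    exact ⟨fun hf => hU' _ e.1.2.2 x hx (hf hxf), fun he => hU _ f.1.2.2 _ hxf (he hx)⟩
  rw [Finset.mul_sum, Finset.mul_sum]
  split_ifs with he
  · refine Finset.sum_congr rfl fun f _ => ?_
    by_cases hef : e.1.1 = f.1.1
    · rw [if_pos ((key f hef).2 he)]
    · rw [mul_ite, mul_zero, rd_mul_star_bl_ne K h j hef, ite_self]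
  · refine Finset.sum_eq_zero fun f _ => ?_
    by_cases hef : e.1.1 = f.1.1
    · rw [if_neg (mt (key f hef).1 he), mul_zero]
    · rw [mul_ite, mul_zero, rd_mul_star_bl_ne K h j hef, ite_self]

/-- The blue partial isometry cancels, leaving the sum of $e(e')^*$ over red edges with ranges in
$U$. If $e$ and $e'$ have the same source $W$, a point of $W$ has preimages in both ranges, hence
$e=e'$ as $\sigma$ is injective on $U$. The diagonal terms add up to the vertices contained in $U$.
-/
theorem proj_mul_shift_mul_star {U : Set X} (hinj : Set.InjOn S.σ U) :
    proj K h j U * shift K h j * (star (shift K h j) * proj K h j U) = proj K h j U := by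
  classical
  have h₁ : proj K h j U * shift K h j * (star (shift K h j) * proj K h j U) =
      proj K h j U * rdSum K h j * star (proj K h j U * rdSum K h j) := by
    rw [shift, star_mul, star_star, star_mul, star_proj]
    conv_rhs => lhs; rhs; rw [← rdSum_mul_star_blSum_mul_blSum]
    simp only [mul_assoc]
  have h₂ : ∀ Z : (P (2 * j)).parts, (if (Z : Set X) ⊆ U then
      ∑ e with e.1.2 = Z, rd K h j e * star (rd K h j e) else 0) =
      ∑ e with e.1.2 = Z, if (e.1.2 : Set X) ⊆ U then rd K h j e * star (rd K h j e) else 0 := by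
    intro Z
    split_ifs with hZ
    · refine Finset.sum_congr rfl fun e he => ?_
      rw [if_pos ((Finset.mem_filter.1 he).2 ▸ hZ)]
    · refine (Finset.sum_eq_zero fun e he => ?_).symm
      rw [if_neg fun he' => hZ ((Finset.mem_filter.1 he).2 ▸ he')]
  have h₃ : proj K h j U = ∑ e : RedEdgeEven S (P (2 * j + 1)) (P (2 * j)) with
      (e.1.2 : Set X) ⊆ U, rd K h j e * star (rd K h j e) := by
    rw [proj, Finset.sum_filter]
    simp only [← sum_rd_mul_star_rd]
    rw [Finset.sum_congr rfl fun Z _ => h₂ Z, Finset.sum_fiberwise, Finset.sum_filter]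
  rw [h₁, proj_mul_rdSum, h₃, star_sum, Finset.sum_mul]
  refine Finset.sum_congr rfl fun e he => ?_
  rw [Finset.mul_sum, Finset.sum_eq_single_of_mem e he]
  intro e' he' hne
  refine rd_mul_star_rd_ne K h j fun heq => hne ?_
  obtain ⟨y, hy⟩ := (P (2 * j + 1)).nonempty_of_mem _ e.1.1.2
  obtain ⟨x, hx, hxy⟩ := e.2 hy
  obtain ⟨x', hx', hxy'⟩ := e'.2 (heq ▸ hy)
  obtain rfl := hinj ((Finset.mem_filter.1 he).2 hx) ((Finset.mem_filter.1 he').2 hx')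
    (hxy.trans hxy'.symm)
  exact Subtype.ext (Prod.ext heq.symm
    (Subtype.ext ((P (2 * j)).eq_of_mem e'.1.2.2 e.1.2.2 hx' hx)))

-- Orthogonality of the red edges leaves one term for each source. The sources are members of
-- $\mathcal P_{2j+1}$, which need not be unions of members of $\mathcal P_{2j}$, so the result
-- becomes a projection of the form `proj` only in the next layer; see
-- `twoStep_star_shift_mul_proj_mul_shift`.
open Classical in
theorem star_shift_mul_proj_mul_shift (U : Set X) :
    star (shift K h j) * proj K h j U * shift K h j =
      ∑ e : RedEdgeEven S (P (2 * j + 1)) (P (2 * j)) with (e.1.2 : Set X) ⊆ U,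
        blSum K h j * (evenLayer h j).v₁ K e.1.1 * star (blSum K h j) := by
  have h₁ : star (shift K h j) * proj K h j U * shift K h j =
      blSum K h j * (star (rdSum K h j) * (proj K h j U * rdSum K h j)) * star (blSum K h j) := by
    rw [shift, star_mul, star_star]
    simp only [mul_assoc]
  rw [h₁, proj_mul_rdSum, Finset.mul_sum, Finset.mul_sum, Finset.sum_mul]
  refine Finset.sum_congr rfl fun e _ => ?_
  congr 2
  rw [rdSum, star_sum, Finset.sum_mul, Finset.sum_eq_single_of_mem e (Finset.mem_univ e),
    star_rd_mul_rd]
  exact fun e' _ hne => star_rd_mul_rd_ne K h j hne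

theorem blSum_mul_v₁ (f : BlueEdge (P (2 * j + 1)) (P (2 * j))) :
    blSum K h j * (evenLayer h j).v₁ K f.1.1 = bl K h j f := by
  classical
  rw [blSum, Finset.sum_mul, Finset.sum_eq_single_of_mem f (Finset.mem_univ f), bl_mul_v₁]
  intro f' _ hne
  rw [← bl_mul_v₁, mul_assoc, v₁_mul_ne, mul_zero]
  exact fun heq => hne ((blueEdge_bijective h j).1 heq)

end star

end layerAlgebra

/-! ### The connecting maps on projections and edge sums -/

section layerAlgebra

open LayerGraph

variable {X : Type u} [MetricSpace X] {S : LHomeo X} {P : ℕ → ClopenPartition X}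
variable (K : Type v) [Field K] (h : SigmaRefined S P) (j : ℕ)

/-- The hypotheses say that every vertex contained in $U$ is contained in exactly one of the sets
$F_i$, and that these lie in $U$. -/
theorem sum_proj {ι : Type*} (s : Finset ι) (F : ι → Set X) (U : Set X)
    (hsub : ∀ i ∈ s, F i ⊆ U)
    (hinj : ∀ i ∈ s, ∀ i' ∈ s, ∀ x ∈ F i, x ∈ F i' → i = i')
    (hcov : ∀ Z ∈ (P (2 * j)).parts, Z ⊆ U → ∃ i ∈ s, Z ⊆ F i) :
    ∑ i ∈ s, proj K h j (F i) = proj K h j U := by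
  classical
  simp only [proj]
  rw [Finset.sum_sigma']
  refine Finset.sum_bij (fun x _ => x.2) ?_ ?_ ?_ ?_
  · rintro ⟨i, Z⟩ hiZ
    simp only [Finset.mem_sigma, Finset.mem_filter, Finset.mem_univ, true_and] at hiZ ⊢
    exact hiZ.2.trans (hsub i hiZ.1)
  · rintro ⟨i, Z⟩ hiZ ⟨i', Z'⟩ hiZ' (rfl : Z = Z')
    simp only [Finset.mem_sigma, Finset.mem_filter, Finset.mem_univ, true_and] at hiZ hiZ'
    obtain ⟨x, hx⟩ := (P (2 * j)).nonempty_of_mem _ Z.2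
    obtain rfl := hinj i hiZ.1 i' hiZ'.1 x (hiZ.2 hx) (hiZ'.2 hx)
    rfl
  · intro Z hZ
    obtain ⟨i, hi, hZi⟩ := hcov Z Z.2 (Finset.mem_filter.1 hZ).2
    exact ⟨⟨i, Z⟩, by simp [hi, hZi], rfl⟩
  · intros; rfl

variable [StarRing K]

theorem twoStep_v₀ (Z : (P (2 * j)).parts) :
    twoStep K h j ((evenLayer h j).v₀ K Z) = proj K h (j + 1) (Z : Set X) := by
  classical
  have h₁ : (evenMap h j).hom K ((evenLayer h j).v₀ K Z) = (evenMap h j).imV K Z :=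
    (evenMap h j).hom_v₀ K Z
  rw [twoStep, StarAlgHom.comp_apply, h₁, LayerMap.imV_eq, map_sum, proj]
  refine Finset.sum_congr ?_ fun Z' _ => (oddMap h j).hom_v₁ K Z'
  ext Z'
  simp only [Finset.mem_filter, Finset.mem_univ, true_and]
  rfl

theorem twoStep_proj {U : Set X} (hU : (P (2 * j)).Saturates U) :
    twoStep K h j (proj K h j U) = proj K h (j + 1) U := by
  classical
  rw [proj, map_sum]
  simp only [twoStep_v₀]
  refine sum_proj K h (j + 1) _ (fun Z : (P (2 * j)).parts => (Z : Set X)) U ?_ ?_ ?_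
  · exact fun Z hZ => (Finset.mem_filter.1 hZ).2
  · exact fun Z _ Z' _ x hx hx' => Subtype.ext ((P (2 * j)).eq_of_mem Z.2 Z'.2 hx hx')
  · intro Z' hZ' hsub
    obtain ⟨x, hx⟩ := (P (2 * (j + 1))).nonempty_of_mem _ hZ'
    obtain ⟨W, hW, hZ'W⟩ := h.finer (2 * j + 1) _ hZ'
    obtain ⟨Z, hZ, hWZ⟩ := h.finer (2 * j) _ hW
    exact ⟨⟨Z, hZ⟩, by simpa using hU Z hZ x (hWZ (hZ'W hx)) (hsub hx), hZ'W.trans hWZ⟩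

/-- Each step replaces an edge by adjoints of edges, so two steps give edges again: here the blue
edges of the next even layer with range in $W=s(f)$. -/
theorem twoStep_bl (f : BlueEdge (P (2 * j + 1)) (P (2 * j))) :
    twoStep K h j (bl K h j f) = proj K h (j + 1) (f.1.1 : Set X) * blSum K h (j + 1) := by
  classical
  have h₁ : (evenMap h j).hom K (bl K h j f) =
      ∑ q with q.1.2 = f.1.1, star ((oddLayer h j).ed K (Sum.inl q)) :=
    ((evenMap h j).hom_ed K _).trans
      (sum_oddB (S := S) j f.1.1 fun e => star ((oddLayer h j).ed K e))
  have h₂ : ∀ q, (oddMap h j).hom K ((oddLayer h j).ed K (Sum.inl q)) =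
      ∑ k with k.1.2 = q.1.1, star (bl K h (j + 1) k) := fun q =>
    ((oddMap h j).hom_ed K _).trans
      (sum_evenB (S := S) (j + 1) q.1.1 fun e => star ((evenLayer h (j + 1)).ed K e))
  rw [twoStep, StarAlgHom.comp_apply, h₁, map_sum, proj_mul_blSum]
  simp only [map_star, h₂, star_sum, star_star]
  rw [Finset.sum_sigma']
  refine Finset.sum_bij (fun x _ => x.2) ?_ ?_ ?_ ?_
  · rintro ⟨q, k⟩ hqk
    simp only [Finset.mem_sigma, Finset.mem_filter, Finset.mem_univ, true_and] at hqk ⊢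
    rw [← hqk.1, hqk.2]
    exact q.2
  · rintro ⟨⟨⟨W, Z⟩, hq⟩, k⟩ hqk ⟨⟨⟨W', Z'⟩, hq'⟩, k'⟩ hqk' (rfl : k = k')
    simp only [Finset.mem_sigma, Finset.mem_filter, Finset.mem_univ, true_and] at hqk hqk'
    obtain ⟨rfl, rfl⟩ := hqk
    obtain ⟨h₃, rfl⟩ := hqk'
    cases h₃
    rfl
  · intro k hk
    exact ⟨⟨⟨(k.1.2, f.1.1), (Finset.mem_filter.1 hk).2⟩, k⟩, by simp, rfl⟩
  · intros; rfl

/-- The first step restricts to $\mathcal P_{2j+2}$-vertices that lie in $r(e)$ (by the definition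
of $R(e)$) and in $\sigma^{-1}(s(e))$; the second attaches all red edges with these ranges. -/
theorem twoStep_rd (e : RedEdgeEven S (P (2 * j + 1)) (P (2 * j))) :
    twoStep K h j (rd K h j e) =
      proj K h (j + 1) (e.1.2 ∩ S.σ ⁻¹' e.1.1 : Set X) * rdSum K h (j + 1) := by
  classical
  have h₁ : (evenMap h j).hom K (rd K h j e) = ∑ q with q.1.2 = e.1.1 ∧ (q.1.1 : Set X) ⊆ e.1.2,
      star ((oddLayer h j).ed K (Sum.inr q)) :=
    ((evenMap h j).hom_ed K _).trans
      (sum_oddR (S := S) j e fun e => star ((oddLayer h j).ed K e))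
  have h₂ : ∀ q, (oddMap h j).hom K ((oddLayer h j).ed K (Sum.inr q)) =
      ∑ k with k.1.2 = q.1.1, star (rd K h (j + 1) k) := fun q =>
    ((oddMap h j).hom_ed K _).trans
      (sum_evenR (S := S) (j + 1) q.1.1 fun e => star ((evenLayer h (j + 1)).ed K e))
  rw [twoStep, StarAlgHom.comp_apply, h₁, map_sum, proj_mul_rdSum]
  simp only [map_star, h₂, star_sum, star_star]
  rw [Finset.sum_sigma']
  refine Finset.sum_bij (fun x _ => x.2) ?_ ?_ ?_ ?_
  · rintro ⟨q, k⟩ hqk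
    simp only [Finset.mem_sigma, Finset.mem_filter, Finset.mem_univ, true_and] at hqk ⊢
    rw [hqk.2]
    exact Set.subset_inter hqk.1.2 (hqk.1.1 ▸ q.2)
  · rintro ⟨⟨⟨W, Z⟩, hq⟩, k⟩ hqk ⟨⟨⟨W', Z'⟩, hq'⟩, k'⟩ hqk' (rfl : k = k')
    simp only [Finset.mem_sigma, Finset.mem_filter, Finset.mem_univ, true_and] at hqk hqk'
    obtain ⟨⟨rfl, _⟩, rfl⟩ := hqk
    obtain ⟨⟨h₃, _⟩, rfl⟩ := hqk'
    cases h₃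
    rfl
  · intro k hk
    have hk' := Set.subset_inter_iff.1 (Finset.mem_filter.1 hk).2
    exact ⟨⟨⟨(k.1.2, e.1.1), hk'.2⟩, k⟩, by simpa using hk'.1, rfl⟩
  · intros; rfl

theorem p_mul_blSum : (evenLayer h j).p K * blSum K h j = blSum K h j := by
  classical
  rw [blSum, Finset.mul_sum]
  exact Finset.sum_congr rfl fun f _ => (evenLayer h j).p_mul_ed K (Sum.inl f)

theorem p_mul_rdSum : (evenLayer h j).p K * rdSum K h j = rdSum K h j := by
  classical
  rw [rdSum, Finset.mul_sum]
  exact Finset.sum_congr rfl fun f _ => (evenLayer h j).p_mul_ed K (Sum.inr f)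

theorem twoStep_blSum : twoStep K h j (blSum K h j) = blSum K h (j + 1) := by
  classical
  conv_lhs => rw [blSum]
  rw [map_sum]
  simp only [twoStep_bl]
  rw [← Finset.sum_mul, sum_proj K h (j + 1) Finset.univ
    (fun f : BlueEdge (P (2 * j + 1)) (P (2 * j)) => (f.1.1 : Set X)) Set.univ, proj_univ,
    p_mul_blSum]
  · exact fun _ _ => Set.subset_univ _
  · exact fun f _ f' _ x hx hx' => (blueEdge_bijective h j).1
      (Subtype.ext ((P (2 * j + 1)).eq_of_mem f.1.1.2 f'.1.1.2 hx hx'))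
  · intro Z' hZ' _
    obtain ⟨W, hW, hZ'W⟩ := h.finer (2 * j + 1) _ hZ'
    obtain ⟨Z, hZ, hWZ⟩ := h.finer (2 * j) _ hW
    exact ⟨⟨(⟨W, hW⟩, ⟨Z, hZ⟩), hWZ⟩, Finset.mem_univ _, hZ'W⟩

/-- The sets $r(e)\cap\sigma^{-1}(s(e))$, for $e$ red, partition $X$ and are unions of members of
$\mathcal P_{2j+2}$. With the analogous fact for blue edges, the elements `shift` of all layers
define a single element $t$ of the colimit. -/
theorem twoStep_rdSum : twoStep K h j (rdSum K h j) = rdSum K h (j + 1) := by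
  classical
  conv_lhs => rw [rdSum]
  rw [map_sum]
  simp only [twoStep_rd]
  rw [← Finset.sum_mul, sum_proj K h (j + 1) Finset.univ
    (fun e : RedEdgeEven S (P (2 * j + 1)) (P (2 * j)) => (e.1.2 ∩ S.σ ⁻¹' e.1.1 : Set X))
    Set.univ, proj_univ, p_mul_rdSum]
  · exact fun _ _ => Set.subset_univ _
  · exact fun e _ e' _ x hx hx' => Subtype.ext (Prod.ext
      (Subtype.ext ((P (2 * j + 1)).eq_of_mem e.1.1.2 e'.1.1.2 hx.2 hx'.2))
      (Subtype.ext ((P (2 * j)).eq_of_mem e.1.2.2 e'.1.2.2 hx.1 hx'.1)))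
  · intro Z' hZ' _
    obtain ⟨x, hx⟩ := (P (2 * (j + 1))).nonempty_of_mem _ hZ'
    obtain ⟨W, hW, hZ'W⟩ := h.finer (2 * j + 1) _ hZ'
    obtain ⟨Z, hZ, hWZ⟩ := h.finer (2 * j) _ hW
    obtain ⟨W', hW', hxW'⟩ := (P (2 * j + 1)).cover (S.σ x)
    -- The red edge is found from one point $x$: its range contains $x$ and its source contains
    -- $\sigma(x)$.
    exact ⟨⟨(⟨W', hW'⟩, ⟨Z, hZ⟩), h.subset_image hZ hW' hxW' ⟨x, hWZ (hZ'W hx), rfl⟩⟩,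
      Finset.mem_univ _, Set.subset_inter (hZ'W.trans hWZ) (h.subset_preimage hW' hZ' hx hxW')⟩

theorem twoStep_shift : twoStep K h j (shift K h j) = shift K h (j + 1) := by
  rw [shift, map_mul, map_star, twoStep_blSum, twoStep_rdSum, shift]

theorem twoStep_bl_mul_star_bl (f : BlueEdge (P (2 * j + 1)) (P (2 * j))) :
    twoStep K h j (bl K h j f * star (bl K h j f)) = proj K h (j + 1) (f.1.1 : Set X) := by
  rw [map_mul, map_star, twoStep_bl, star_mul, star_proj, mul_assoc,
    ← mul_assoc (blSum _ _ _), blSum_mul_star_blSum, ← proj_univ, proj_mul_proj, proj_mul_proj,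
    Set.univ_inter, Set.inter_self]

theorem twoStep_rd_mul_star_bl (e : RedEdgeEven S (P (2 * j + 1)) (P (2 * j)))
    (f : BlueEdge (P (2 * j + 1)) (P (2 * j))) :
    twoStep K h j (rd K h j e * star (bl K h j f)) =
      proj K h (j + 1) (e.1.2 ∩ S.σ ⁻¹' e.1.1 : Set X) * shift K h (j + 1) *
        proj K h (j + 1) (f.1.1 : Set X) := by
  rw [map_mul, map_star, twoStep_rd, twoStep_bl, star_mul, star_proj, shift]
  simp only [mul_assoc]

/-- In the next layer each term becomes the projection of the source $W$ of a red edge, because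
conjugating the vertex $W$ by the blue partial isometry gives $ff^*$ with $f$ blue. Since $\sigma$
is injective on $U$, the sources of the red edges with range in $U$ are disjoint, and they make up
$\sigma(U)$. -/
theorem twoStep_star_shift_mul_proj_mul_shift {U : Set X} (hU : (P (2 * j)).Saturates U)
    (hinj : Set.InjOn S.σ U) :
    twoStep K h j (star (shift K h j) * proj K h j U * shift K h j) =
      proj K h (j + 1) (S.σ '' U) := by
  classical
  rw [star_shift_mul_proj_mul_shift, map_sum]
  have h₁ : ∀ e : RedEdgeEven S (P (2 * j + 1)) (P (2 * j)),
      twoStep K h j (blSum K h j * (evenLayer h j).v₁ K e.1.1 * star (blSum K h j)) =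
        proj K h (j + 1) (e.1.1 : Set X) := by
    intro e
    obtain ⟨f, hf⟩ := (blueEdge_bijective h j).2 e.1.1
    simp only at hf
    -- The vertex is written as its own square, one factor for each of the two blue sums.
    rw [← hf, ← twoStep_bl_mul_star_bl, ← v₁_mul_self, ← mul_assoc, mul_assoc,
      blSum_mul_v₁, ← blSum_mul_v₁ K h j f, star_mul, star_v₁]
  simp only [h₁]
  refine sum_proj K h (j + 1) _
    (fun e : RedEdgeEven S (P (2 * j + 1)) (P (2 * j)) => (e.1.1 : Set X)) _ ?_ ?_ ?_
  · exact fun e he => e.2.trans (Set.image_mono (Finset.mem_filter.1 he).2)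
  · intro e he e' he' y hy hy'
    obtain ⟨x, hx, rfl⟩ := e.2 hy
    obtain ⟨x', hx', hxx'⟩ := e'.2 hy'
    obtain rfl := hinj ((Finset.mem_filter.1 he').2 hx') ((Finset.mem_filter.1 he).2 hx) hxx'
    exact Subtype.ext (Prod.ext
      (Subtype.ext ((P (2 * j + 1)).eq_of_mem e.1.1.2 e'.1.1.2 hy hy'))
      (Subtype.ext ((P (2 * j)).eq_of_mem e.1.2.2 e'.1.2.2 hx hx')))
  · intro Z' hZ' hsub
    obtain ⟨y, hy⟩ := (P (2 * (j + 1))).nonempty_of_mem _ hZ'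
    obtain ⟨x, hx, rfl⟩ := hsub hy
    obtain ⟨Z, hZ, hxZ⟩ := (P (2 * j)).cover x
    obtain ⟨W, hW, hZ'W⟩ := h.finer (2 * j + 1) _ hZ'
    exact ⟨⟨(⟨W, hW⟩, ⟨Z, hZ⟩), h.subset_image hZ hW (hZ'W hy) ⟨x, hxZ, rfl⟩⟩,
      by simpa using hU Z hZ x hxZ hx, hZ'W⟩

end layerAlgebra

/-! ### The covariant representation in the colimit -/

theorem SigmaRefined.exists_saturates_even {X : Type u} [MetricSpace X] [CompactSpace X]
    {S : LHomeo X} {P : ℕ → ClopenPartition X} (h : SigmaRefined S P) {U : Set X}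
    (hU : IsClopen U) : ∃ j, ∀ k ≥ j, (P (2 * k)).Saturates U := by
  obtain ⟨n, hn⟩ := h.exists_saturates hU
  exact ⟨n, fun k hk => h.saturates_mono (by omega) hn⟩

section colimit

variable {X : Type u} [MetricSpace X] {S : LHomeo X} {P : ℕ → ClopenPartition X}
variable (K : Type v) [Field K] [StarRing K] (h : SigmaRefined S P) (j : ℕ)

variable {K h j} in
theorem CornerAlg.ext {a b : CornerAlg K h j} (hab : a.1 = b.1) : a = b := Subtype.ext hab

/-- The projection `∑ v`, over the members of `𝒫_{2j}` contained in `U`, in the corner. -/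
noncomputable def cornerProj (U : Set X) : CornerAlg K h j :=
  ⟨proj K h j U, LayerGraph.mem_corner K _
    (by rw [← proj_univ, proj_mul_proj, Set.univ_inter])
    (by rw [← proj_univ, proj_mul_proj, Set.inter_univ])⟩

/-- The element `∑ e f^*`, over the red edges `e` and the blue edges `f`, in the corner. -/
noncomputable def cornerShift : CornerAlg K h j :=
  ⟨shift K h j, LayerGraph.mem_corner K _ (by rw [shift, ← mul_assoc, p_mul_rdSum])
    (by rw [shift, mul_assoc, ← LayerGraph.star_p, ← star_mul, p_mul_blSum])⟩

theorem cornerProj_univ_mul (a : CornerAlg K h j) : cornerProj K h j Set.univ * a = a := by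
  obtain ⟨_, b, rfl⟩ := a
  refine CornerAlg.ext ?_
  change proj K h j Set.univ * ((evenLayer h j).p K * b * (evenLayer h j).p K) =
    (evenLayer h j).p K * b * (evenLayer h j).p K
  rw [proj_univ, ← mul_assoc, ← mul_assoc, LayerGraph.p_mul_p]

theorem mul_cornerProj_univ (a : CornerAlg K h j) : a * cornerProj K h j Set.univ = a := by
  obtain ⟨_, b, rfl⟩ := a
  refine CornerAlg.ext ?_
  change (evenLayer h j).p K * b * (evenLayer h j).p K * proj K h j Set.univ =
    (evenLayer h j).p K * b * (evenLayer h j).p K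
  rw [proj_univ, mul_assoc, LayerGraph.p_mul_p]

/-- The canonical *-homomorphism `φ_{j,∞} : 𝒜_{2j} → 𝒜_∞`. -/
noncomputable def toAInfHom : CornerAlg K h j →⋆ₙₐ[K] AInf K h where
  toFun := toAInf j
  map_smul' _ _ := (DirectLimit.smul_def _ _ _).symm
  map_zero' := (DirectLimit.zero_def _).symm
  map_add' _ _ := (DirectLimit.add_def _ _ _).symm
  map_mul' _ _ := (DirectLimit.mul_def _ _ _).symm
  map_star' _ := (DirectLimit.star_def _ _).symm

theorem toAInfHom_connect (a : CornerAlg K h j) :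
    toAInfHom K h (j + 1) (connect K h j a) = toAInfHom K h j a := by
  have h₁ : connect K h j a = transition K h j (j + 1) (Nat.le_succ j) a := by
    rw [transition_succ K h j j le_rfl, transition_self]
    rfl
  rw [h₁]
  exact (DirectLimit.eq_of_le (f := transition K h) ⟨j, a⟩ (j + 1) (Nat.le_succ j)).symm

theorem exists_toAInfHom (x : AInf K h) : ∃ j a, toAInfHom K h j a = x := by
  obtain ⟨j, a, rfl⟩ := DirectLimit.exists_eq_mk (f := transition K h) x
  exact ⟨j, a, rfl⟩

theorem toAInfHom_cornerProj_succ {U : Set X} (hU : (P (2 * j)).Saturates U) :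
    toAInfHom K h (j + 1) (cornerProj K h (j + 1) U) = toAInfHom K h j (cornerProj K h j U) := by
  have h₁ : connect K h j (cornerProj K h j U) = cornerProj K h (j + 1) U :=
    CornerAlg.ext (twoStep_proj K h j hU)
  rw [← h₁, toAInfHom_connect]

theorem toAInfHom_cornerProj_of_le {U : Set X} {i k : ℕ} (hik : i ≤ k)
    (hU : (P (2 * i)).Saturates U) :
    toAInfHom K h k (cornerProj K h k U) = toAInfHom K h i (cornerProj K h i U) := by
  induction k, hik using Nat.le_induction with
  | base => rfl
  | succ k hk ih =>
    rw [toAInfHom_cornerProj_succ K h k (h.saturates_mono (by omega) hU), ih]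

theorem toAInfHom_cornerShift :
    toAInfHom K h j (cornerShift K h j) = toAInfHom K h 0 (cornerShift K h 0) := by
  induction j with
  | zero => rfl
  | succ j ih =>
    have h₁ : connect K h j (cornerShift K h j) = cornerShift K h (j + 1) :=
      CornerAlg.ext (twoStep_shift K h j)
    rw [← ih, ← h₁, toAInfHom_connect]

theorem connect_cornerPair_red_blue (e : RedEdgeEven S (P (2 * j + 1)) (P (2 * j)))
    (f : BlueEdge (P (2 * j + 1)) (P (2 * j))) (hef : e.1.1 = f.1.1) :
    connect K h j (cornerPair K h j (red e) (blue f)) =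
      cornerProj K h (j + 1) (e.1.2 ∩ S.σ ⁻¹' e.1.1) * cornerShift K h (j + 1) *
        cornerProj K h (j + 1) e.1.1 := by
  refine CornerAlg.ext ?_
  rw [hef]
  exact (twoStep_rd_mul_star_bl K h j e f).trans (by rw [hef]; rfl)

/-- The factor $p_{\sigma^{-1}(V)}$ in front of $t$ is the same as $p_V$ behind it. This absorbs the
restriction to $\sigma^{-1}(W)$ that the connecting map puts on a red edge with source $W$. -/
theorem CovRep.p_inter_preimage_mul_t_mul_p {A : Type w} [Ring A] [StarRing A] (C : CovRep S A)
    {U V : Set X} (hU : IsClopen U) (hV : IsClopen V) :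
    C.p (U ∩ S.σ ⁻¹' V) * C.t * C.p V = C.p U * C.t * C.p V := by
  rw [C.p_inter hU (S.isClopen_preimage hV), mul_assoc _ _ C.t, ← C.t_mul_p hV, mul_assoc,
    mul_assoc, C.p_mul_self hV, ← mul_assoc]

theorem SigmaRefined.saturates_inter_preimage (h : SigmaRefined S P) (j : ℕ)
    (Z : (P (2 * j)).parts) (W : (P (2 * j + 1)).parts) :
    (P (2 * (j + 1))).Saturates (Z ∩ S.σ ⁻¹' W : Set X) :=
  (h.saturates_mono (by omega) (ClopenPartition.saturates_part Z.2)).inter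
    fun _ hZ' _ hx hxW => h.subset_preimage W.2 hZ' hx hxW

namespace AInf

theorem toAInfHom_cornerProj_univ : toAInfHom K h 0 (cornerProj K h 0 Set.univ) =
    toAInfHom K h j (cornerProj K h j Set.univ) :=
  (toAInfHom_cornerProj_of_le K h (Nat.zero_le j) ClopenPartition.saturates_univ).symm

/-- The colimit `𝒜_∞` is unital. -/
noncomputable abbrev unitalRing : Ring (AInf K h) where
  __ := (inferInstance : NonUnitalRing (AInf K h))
  one := toAInfHom K h 0 (cornerProj K h 0 Set.univ)
  one_mul x := by
    obtain ⟨j, a, rfl⟩ := exists_toAInfHom K h x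
    exact (congrArg (· * toAInfHom K h j a) (toAInfHom_cornerProj_univ K h j)).trans
      ((map_mul (toAInfHom K h j) _ _).symm.trans (congrArg _ (cornerProj_univ_mul K h j a)))
  mul_one x := by
    obtain ⟨j, a, rfl⟩ := exists_toAInfHom K h x
    exact (congrArg (toAInfHom K h j a * ·) (toAInfHom_cornerProj_univ K h j)).trans
      ((map_mul (toAInfHom K h j) _ _).symm.trans (congrArg _ (mul_cornerProj_univ K h j a)))

attribute [local instance] unitalRing

open Classical in
/-- The projection of `𝒜_∞` determined by a clopen set. -/
noncomputable def clopenProj (U : Set X) : AInf K h :=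
  -- For clopen $U$ in a compact space the default `0` is never taken, by `exists_saturates_even`.
  if hU : ∃ j, (P (2 * j)).Saturates U then toAInfHom K h hU.choose (cornerProj K h _ U) else 0

/-- The level chosen in the definition does not matter: once $U$ is a union of members of the
partition, passing to later levels does not change the class. -/
theorem clopenProj_eq {U : Set X} (hU : (P (2 * j)).Saturates U) :
    clopenProj K h U = toAInfHom K h j (cornerProj K h j U) := by
  have hex : ∃ j, (P (2 * j)).Saturates U := ⟨j, hU⟩
  rw [clopenProj, dif_pos hex]
  rcases le_total hex.choose j with hle | hle
  · exact (toAInfHom_cornerProj_of_le K h hle hex.choose_spec).symm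
  · exact toAInfHom_cornerProj_of_le K h hle hU

/-- The canonical covariant representation in `𝒜_∞`. -/
noncomputable def covRep [CompactSpace X] : CovRep S (AInf K h) where
  p := clopenProj K h
  t := toAInfHom K h 0 (cornerShift K h 0)
  p_univ := clopenProj_eq K h 0 ClopenPartition.saturates_univ
  star_p {U} hU := by
    obtain ⟨j, hj⟩ := h.exists_saturates_even hU
    rw [clopenProj_eq K h j (hj j le_rfl), ← map_star]
    exact congrArg _ (CornerAlg.ext (star_proj K h j U))
  p_inter {U V} hU hV := by
    obtain ⟨i, hi⟩ := h.exists_saturates_even hU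
    obtain ⟨j, hj⟩ := h.exists_saturates_even hV
    have hU' := hi _ (le_max_left i j)
    have hV' := hj _ (le_max_right i j)
    rw [clopenProj_eq K h _ hU', clopenProj_eq K h _ hV', clopenProj_eq K h _ (hU'.inter hV'),
      ← map_mul]
    exact congrArg _ (CornerAlg.ext (proj_mul_proj K h _ U V)).symm
  p_union {U V} hU hV hd := by
    obtain ⟨i, hi⟩ := h.exists_saturates_even hU
    obtain ⟨j, hj⟩ := h.exists_saturates_even hV
    have hU' := hi _ (le_max_left i j)
    have hV' := hj _ (le_max_right i j)
    rw [clopenProj_eq K h _ hU', clopenProj_eq K h _ hV', clopenProj_eq K h _ (hU'.union hV'),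
      ← map_add]
    exact congrArg _ (CornerAlg.ext (proj_union K h _ hU' hV' hd))
  t_mul_p {U} hU := by
    obtain ⟨i, hi⟩ := h.exists_saturates_even hU
    obtain ⟨j, hj⟩ := h.exists_saturates_even (S.isClopen_preimage hU)
    have hU' := hi _ (le_max_left i j)
    have hV' := hj _ (le_max_right i j)
    rw [clopenProj_eq K h _ hU', clopenProj_eq K h _ hV', ← toAInfHom_cornerShift K h (max i j),
      ← map_mul, ← map_mul]
    exact congrArg _ (CornerAlg.ext (shift_mul_proj K h _ hU' hV'))
  star_t_mul_p_mul_t {U} hU hinj := by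
    obtain ⟨i, hi⟩ := h.exists_saturates_even hU
    obtain ⟨j, hj⟩ := h.exists_saturates_even (S.isClopen_image hU)
    have hU' := hi _ (le_max_left i j)
    -- The projection of $\sigma(U)$ is taken one level later, because the relation holds only after
    -- one more connecting map.
    have hV' := hj (max i j + 1) ((le_max_right i j).trans (Nat.le_succ _))
    rw [clopenProj_eq K h _ hU', clopenProj_eq K h _ hV', ← toAInfHom_cornerShift K h (max i j),
      ← map_star, ← map_mul, ← map_mul, ← toAInfHom_connect]
    exact congrArg _ (CornerAlg.ext (twoStep_star_shift_mul_proj_mul_shift K h _ hU' hinj))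
  p_mul_t_mul_star_t_mul_p {U} hU hinj := by
    obtain ⟨i, hi⟩ := h.exists_saturates_even hU
    rw [clopenProj_eq K h _ (hi i le_rfl), ← toAInfHom_cornerShift K h i,
      ← map_star, ← map_mul, ← map_mul, ← map_mul]
    exact congrArg _ (CornerAlg.ext (proj_mul_shift_mul_star K h _ hinj))

variable [CompactSpace X]

theorem covRep_p_eq {U : Set X} (hU : (P (2 * j)).Saturates U) :
    (covRep K h).p U = toAInfHom K h j (cornerProj K h j U) :=
  clopenProj_eq K h j hU

theorem covRep_t_eq : (covRep K h).t = toAInfHom K h j (cornerShift K h j) :=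
  (toAInfHom_cornerShift K h j).symm

theorem toAInfHom_cornerVertex (Z : (P (2 * j)).parts) :
    toAInfHom K h j (cornerVertex K h j Z) = (covRep K h).p (Z : Set X) := by
  rw [covRep_p_eq K h j (ClopenPartition.saturates_part Z.2)]
  exact congrArg _ (CornerAlg.ext (proj_part K h j Z).symm)

theorem part_odd_saturates (h : SigmaRefined S P) (j : ℕ) (W : (P (2 * j + 1)).parts) :
    (P (2 * (j + 1))).Saturates (W : Set X) :=
  h.saturates_mono (by omega) (ClopenPartition.saturates_part W.2)

theorem toAInfHom_cornerPair_blue (f : BlueEdge (P (2 * j + 1)) (P (2 * j))) :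
    toAInfHom K h j (cornerPair K h j (blue f) (blue f)) = (covRep K h).p (f.1.1 : Set X) := by
  rw [covRep_p_eq K h (j + 1) (part_odd_saturates h j f.1.1), ← toAInfHom_connect]
  exact congrArg _ (CornerAlg.ext (twoStep_bl_mul_star_bl K h j f))

theorem toAInfHom_cornerPair_red_blue (e : RedEdgeEven S (P (2 * j + 1)) (P (2 * j)))
    (f : BlueEdge (P (2 * j + 1)) (P (2 * j))) (hef : e.1.1 = f.1.1) :
    toAInfHom K h j (cornerPair K h j (red e) (blue f)) =
      (covRep K h).p (e.1.2 : Set X) * (covRep K h).t * (covRep K h).p (e.1.1 : Set X) := by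
  rw [← (covRep K h).p_inter_preimage_mul_t_mul_p ((P (2 * j)).isClopen _ e.1.2.2)
      ((P (2 * j + 1)).isClopen _ e.1.1.2),
    covRep_p_eq K h (j + 1) (h.saturates_inter_preimage j e.1.2 e.1.1),
    covRep_p_eq K h (j + 1) (part_odd_saturates h j e.1.1), covRep_t_eq K h (j + 1), ← map_mul,
    ← map_mul, ← toAInfHom_connect, connect_cornerPair_red_blue K h j e f hef]

end AInf

end colimit

/-! ### Generators of the corner -/

namespace LayerGraph

variable {V₀ V₁ : Type u} [Fintype V₀] [Fintype V₁] {K : Type v} [Field K] [StarRing K]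
variable (Γ : LayerGraph V₀ V₁)

variable (K) in
/-- The vertices in `V₀` and the edges, as elements of the Leavitt path algebra. -/
noncomputable def leftGen : V₀ ⊕ Γ.E → Γ.L K
  | Sum.inl v => Γ.v₀ K v
  | Sum.inr e => Γ.ed K e

theorem v₀_mul_star_ed (v : V₀) (e : Γ.E) : Γ.v₀ K v * star (Γ.ed K e) = 0 := by
  rw [← s_mul_star_ed, ← mul_assoc, v₀_mul_v₁, zero_mul]

theorem ed_mul_v₀ (e : Γ.E) (v : V₀) : Γ.ed K e * Γ.v₀ K v = 0 := by
  rw [← ed_mul_s, mul_assoc, v₁_mul_v₀, mul_zero]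

theorem ed_mul_star_ed_ne {e f : Γ.E} (h : Γ.s e ≠ Γ.s f) :
    Γ.ed K e * star (Γ.ed K f) = 0 := by
  rw [← ed_mul_s, ← s_mul_star_ed, mul_assoc, ← mul_assoc (Γ.v₁ K _), v₁_mul_ne _ _ h, zero_mul,
    mul_zero]

variable {Γ} (N : NonUnitalSubalgebra K (Γ.L K))

theorem leftGen_mul_star_mem (hv : ∀ v, Γ.v₀ K v ∈ N)
    (he : ∀ e f, Γ.s e = Γ.s f → Γ.ed K e * star (Γ.ed K f) ∈ N) (l m : V₀ ⊕ Γ.E) :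
    Γ.leftGen K l * star (Γ.leftGen K m) ∈ N := by
  rcases l with v | e <;> rcases m with v' | f <;> simp only [leftGen]
  · by_cases h : v = v'
    · rw [h, star_v₀, v₀_mul_self]
      exact hv v'
    · rw [star_v₀, v₀_mul_ne _ _ h]
      exact zero_mem N
  · rw [v₀_mul_star_ed]
    exact zero_mem N
  · rw [star_v₀, ed_mul_v₀]
    exact zero_mem N
  · by_cases h : Γ.s e = Γ.s f
    · exact he e f h
    · rw [ed_mul_star_ed_ne Γ h]
      exact zero_mem N

/-- Induction on $a$, for all outer factors at once. For a product $ab$ one inserts the sum of all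
vertices between $a$ and $b$. Each vertex has the form $k^*k$ with $k$ again a vertex of $V_0$ or an
edge (for $V_1$ because every such vertex is a source), so $l\,ab\,m^*$ becomes a sum of products
$(l\,ak^*)(kb\,m^*)$. -/
theorem leftGen_mul_mul_star_mem (hv : ∀ v, Γ.v₀ K v ∈ N)
    (he : ∀ e f, Γ.s e = Γ.s f → Γ.ed K e * star (Γ.ed K f) ∈ N) (a : Γ.L K)
    (l m : V₀ ⊕ Γ.E) : Γ.leftGen K l * a * star (Γ.leftGen K m) ∈ N := by
  have hA := leftGen_mul_star_mem N hv he
  have key : ∀ k k' l m, Γ.leftGen K l * (star (Γ.leftGen K k) * Γ.leftGen K k') *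
      star (Γ.leftGen K m) ∈ N := by
    intro k k' l m
    have := mul_mem (hA l k) (hA k' m)
    simpa only [mul_assoc] using this
  have hv₁ : ∀ w, ∃ e, Γ.v₁ K w = star (Γ.leftGen K (Sum.inr e)) * Γ.leftGen K (Sum.inr e) := by
    intro w
    obtain ⟨e, rfl⟩ := Γ.s_surjective w
    exact ⟨e, (Γ.star_ed_mul_ed K e).symm⟩
  have hv₀ : ∀ v, Γ.v₀ K v = star (Γ.leftGen K (Sum.inl v)) * Γ.leftGen K (Sum.inl v) := by
    intro v
    simp only [leftGen]
    rw [star_v₀, v₀_mul_self]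
  have hed : ∀ e l m, Γ.leftGen K l * Γ.ed K e * star (Γ.leftGen K m) ∈ N := by
    intro e l m
    rw [← r_mul_ed, ← star_v₀]
    exact key (Sum.inl (Γ.r e)) (Sum.inr e) l m
  have hgh : ∀ e l m, Γ.leftGen K l * star (Γ.ed K e) * star (Γ.leftGen K m) ∈ N := by
    intro e l m
    rw [← star_ed_mul_r]
    exact key (Sum.inr e) (Sum.inl (Γ.r e)) l m
  induction a using LPA.ind generalizing l m with
  | h0 c =>
    rw [Algebra.algebraMap_eq_smul_one, mul_smul_comm, smul_mul_assoc, mul_one]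
    exact SMulMemClass.smul_mem c (hA l m)
  | h1 x =>
    cases x with
    | vertex v =>
      cases v with
      | inl v =>
        change Γ.leftGen K l * Γ.v₀ K v * _ ∈ N
        rw [hv₀]
        exact key _ _ _ _
      | inr w =>
        change Γ.leftGen K l * Γ.v₁ K w * _ ∈ N
        obtain ⟨e, he⟩ := hv₁ w
        rw [he]
        exact key _ _ _ _
    | edge e =>
      exact hed e l m
    | ghost e =>
      have hg : LPA.gen K Γ.toSepGraph (SepGraph.Gen.ghost e) = star (Γ.ed K e) :=
        (LPA.star_edg (G := Γ.toSepGraph) e).symm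
      rw [hg]
      exact hgh e l m
  | h2 a b iha ihb =>
    have hins : ∀ k, Γ.leftGen K l * (a * (star (Γ.leftGen K k) * Γ.leftGen K k) * b) *
        star (Γ.leftGen K m) ∈ N := by
      intro k
      have := mul_mem (iha l k) (ihb k m)
      simpa only [mul_assoc] using this
    have h₁ : a * b = ∑ v, a * Γ.v₀ K v * b + ∑ w, a * Γ.v₁ K w * b := by
      rw [← Finset.sum_mul, ← Finset.sum_mul, ← Finset.mul_sum, ← Finset.mul_sum, ← add_mul,
        ← mul_add, sum_v₀_add_sum_v₁, mul_one]
    rw [h₁, mul_add, add_mul, Finset.mul_sum, Finset.mul_sum, Finset.sum_mul, Finset.sum_mul]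
    refine add_mem (sum_mem fun v _ => ?_) (sum_mem fun w _ => ?_)
    · rw [hv₀]
      exact hins _
    · obtain ⟨e, he⟩ := hv₁ w
      rw [he]
      exact hins _
  | h3 a b iha ihb =>
    rw [mul_add, add_mul]
    exact add_mem (iha l m) (ihb l m)

/-- The corner is generated by the vertices in `V₀` and the products `e f^*`, where `e` and `f` are
edges with the same source. -/
theorem corner_le (hv : ∀ v, Γ.v₀ K v ∈ N)
    (he : ∀ e f, Γ.s e = Γ.s f → Γ.ed K e * star (Γ.ed K f) ∈ N) {a : Γ.L K}
    (ha : a ∈ Γ.corner K) : a ∈ N := by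
  obtain ⟨b, rfl⟩ := ha
  simp only [p]
  rw [Finset.sum_mul, Finset.sum_mul]
  refine sum_mem fun v _ => ?_
  rw [Finset.mul_sum]
  refine sum_mem fun v' _ => ?_
  have := leftGen_mul_mul_star_mem N hv he b (Sum.inl v) (Sum.inl v')
  simpa only [leftGen, star_v₀] using this

end LayerGraph

section corner

variable {X : Type u} [MetricSpace X] {S : LHomeo X} {P : ℕ → ClopenPartition X}
variable {K : Type v} [Field K] [StarRing K] {h : SigmaRefined S P} {j : ℕ}

/-- Of the products of two edges with a common source few need checking: two blue ones coincide, and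
two red ones give $e(e')^*=(ef^*)(f(e')^*)$ with $f$ the blue edge with that source. -/
theorem CornerAlg.eq_top_of_mem (M : NonUnitalSubalgebra K (CornerAlg K h j))
    (hv : ∀ Z, cornerVertex K h j Z ∈ M)
    (hbb : ∀ f, cornerPair K h j (blue f) (blue f) ∈ M)
    (hrb : ∀ (e : RedEdgeEven S (P (2 * j + 1)) (P (2 * j)))
      (f : BlueEdge (P (2 * j + 1)) (P (2 * j))), e.1.1 = f.1.1 →
      cornerPair K h j (red e) (blue f) ∈ M)
    (hbr : ∀ (e : RedEdgeEven S (P (2 * j + 1)) (P (2 * j)))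
      (f : BlueEdge (P (2 * j + 1)) (P (2 * j))), e.1.1 = f.1.1 →
      cornerPair K h j (blue f) (red e) ∈ M) (a : CornerAlg K h j) : a ∈ M := by
  let N : NonUnitalSubalgebra K ((evenLayer h j).L K) :=
    { carrier := {x | ∃ c ∈ M, c.1 = x}
      zero_mem' := ⟨0, zero_mem M, rfl⟩
      add_mem' := by
        rintro _ _ ⟨a, ha, rfl⟩ ⟨b, hb, rfl⟩
        exact ⟨a + b, add_mem ha hb, rfl⟩
      mul_mem' := by
        rintro _ _ ⟨a, ha, rfl⟩ ⟨b, hb, rfl⟩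
        exact ⟨a * b, mul_mem ha hb, rfl⟩
      smul_mem' := by
        rintro c _ ⟨a, ha, rfl⟩
        exact ⟨c • a, SMulMemClass.smul_mem c ha, rfl⟩ }
  obtain ⟨c, hc, hca⟩ := LayerGraph.corner_le N (fun v => ⟨_, hv v, rfl⟩) (by
    rintro (f | e) (f' | e') hs
    · obtain rfl := (blueEdge_bijective h j).1 hs
      exact ⟨_, hbb f, rfl⟩
    · exact ⟨_, hbr e' f hs.symm, rfl⟩
    · exact ⟨_, hrb e f' hs, rfl⟩
    · obtain ⟨f, hf⟩ := (blueEdge_bijective h j).2 e.1.1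
      refine ⟨_, mul_mem (hrb e f hf.symm) (hbr e' f (hs.symm.trans hf.symm)), ?_⟩
      change rd K h j e * star (bl K h j f) * (bl K h j f * star (rd K h j e')) =
        rd K h j e * star (rd K h j e')
      rw [mul_assoc, ← mul_assoc (star (bl K h j f)), star_bl_mul_bl, ← mul_assoc]
      simp only at hf
      rw [hf, rd_mul_v₁]) a.2
  rwa [← CornerAlg.ext hca]

end corner

/-! ### Representing the corners by a covariant representation -/

section representation

variable {X : Type u} [MetricSpace X] [CompactSpace X] {S : LHomeo X} {P : ℕ → ClopenPartition X}
variable {A : Type w} [Ring A] [StarRing A]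

namespace CovRep

variable (C : CovRep S A)

/-- The element of `A` associated with an edge of an even layer. -/
def edgeCoeff {Q R : ClopenPartition X} : EvenEdge S Q R → A :=
  Sum.elim (fun f => C.p (f.1.1 : Set X)) fun e =>
    C.p (e.1.2 : Set X) * C.t * C.p (e.1.1 : Set X)

theorem edgeCoeff_blue {j : ℕ} (f : BlueEdge (P (2 * j + 1)) (P (2 * j))) :
    C.edgeCoeff (blue f : EvenEdge S _ _) = C.p (f.1.1 : Set X) := rfl

theorem edgeCoeff_red {j : ℕ} (e : RedEdgeEven S (P (2 * j + 1)) (P (2 * j))) :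
    C.edgeCoeff (red e) = C.p (e.1.2 : Set X) * C.t * C.p (e.1.1 : Set X) := rfl

theorem sum_p_coe (Q : ClopenPartition X) : ∑ Z : Q.parts, C.p (Z : Set X) = 1 := by
  rw [Finset.sum_coe_sort Q.parts C.p, C.sum_p_parts]

open Classical in
theorem sum_p_of_saturates (Q : ClopenPartition X) {U : Set X} (hU : Q.Saturates U) :
    ∑ Z ∈ Finset.univ.filter fun Z : Q.parts => (Z : Set X) ⊆ U, C.p (Z : Set X) = C.p U := by
  rw [← C.p_biUnion]
  · congr 1
    ext x
    simp only [Finset.mem_filter, Finset.mem_univ, true_and, Set.mem_iUnion, exists_prop]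
    constructor
    · rintro ⟨Z, hZ, hx⟩
      exact hZ hx
    · intro hx
      obtain ⟨Z, hZ, hxZ⟩ := Q.cover x
      exact ⟨⟨Z, hZ⟩, hU Z hZ x hxZ hx, hxZ⟩
  · exact fun Z _ => Q.isClopen _ Z.2
  · exact fun Z _ Z' _ hne => Q.pairwiseDisjoint Z.2 Z'.2 fun h => hne (Subtype.ext h)

open Classical in
theorem sum_p_blue (h : SigmaRefined S P) (j : ℕ) (Z : (P (2 * j)).parts) :
    ∑ f : BlueEdge (P (2 * j + 1)) (P (2 * j)) with f.1.2 = Z, C.p (f.1.1 : Set X) =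
      C.p (Z : Set X) := by
  have hZ := h.saturates_mono (Nat.le_succ (2 * j)) (ClopenPartition.saturates_part Z.2)
  rw [← C.sum_p_of_saturates (P (2 * j + 1)) hZ]
  refine Finset.sum_bij (fun f _ => f.1.1) ?_ ?_ ?_ ?_
  · intro f hf
    obtain rfl := (Finset.mem_filter.1 hf).2
    exact Finset.mem_filter.2 ⟨Finset.mem_univ _, f.2⟩
  · exact fun f _ f' _ hff' => (blueEdge_bijective h j).1 hff'
  · intro W hW
    exact ⟨⟨(W, Z), (Finset.mem_filter.1 hW).2⟩, by simp, rfl⟩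
  · intros; rfl

-- The sources of the red edges with range $Z$ are exactly the members of $\mathcal P_{2j+1}$
-- contained in $\sigma(Z)$, and by refinement $\sigma(Z)$ is their union.
open Classical in
theorem sum_p_red (h : SigmaRefined S P) (j : ℕ) (Z : (P (2 * j)).parts) :
    ∑ e : RedEdgeEven S (P (2 * j + 1)) (P (2 * j)) with e.1.2 = Z, C.p (e.1.1 : Set X) =
      C.p (S.σ '' Z) := by
  have hZ : (P (2 * j + 1)).Saturates (S.σ '' Z) :=
    fun W hW y hy hyZ => h.subset_image Z.2 hW hy hyZ
  rw [← C.sum_p_of_saturates (P (2 * j + 1)) hZ]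
  refine Finset.sum_bij (fun f _ => f.1.1) ?_ ?_ ?_ ?_
  · intro f hf
    obtain rfl := (Finset.mem_filter.1 hf).2
    exact Finset.mem_filter.2 ⟨Finset.mem_univ _, f.2⟩
  · rintro f hf f' hf' hff'
    exact Subtype.ext (Prod.ext hff'
      ((Finset.mem_filter.1 hf).2.trans (Finset.mem_filter.1 hf').2.symm))
  · intro W hW
    exact ⟨⟨(W, Z), (Finset.mem_filter.1 hW).2⟩, by simp, rfl⟩
  · intros; rfl

theorem p_mul_t_mul_p_image {U : Set X} (hU : IsClopen U) :
    C.p U * C.t * C.p (S.σ '' U) = C.p U * C.t := by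
  have hU' := S.isClopen_image hU
  rw [mul_assoc, C.t_mul_p hU', ← mul_assoc,
    C.p_mul_of_subset hU (S.isClopen_preimage hU') (Set.subset_preimage_image _ _)]

theorem star_p_mul_t_mul_p {U V : Set X} (hU : IsClopen U) (hV : IsClopen V) :
    star (C.p U * C.t * C.p V) = C.p V * (star C.t * C.p U) := by
  rw [star_mul, star_mul, C.star_p hU, C.star_p hV]

theorem isClopen_part {n : ℕ} (Z : (P n).parts) : IsClopen (Z : Set X) := (P n).isClopen _ Z.2

theorem p_part_mul_ne {n : ℕ} {Z Z' : (P n).parts} (hne : Z ≠ Z') :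
    C.p (Z : Set X) * C.p (Z' : Set X) = 0 :=
  C.p_mul_of_disjoint (isClopen_part Z) (isClopen_part Z')
    ((P n).pairwiseDisjoint Z.2 Z'.2 fun h => hne (Subtype.ext h))

/-- The middle factor is $t^*p_Zt=p_{\sigma(Z)}$, and it is absorbed by $p_W$ since
$W\subseteq\sigma(Z)$. -/
theorem star_red_mul_red (h : SigmaRefined S P) (j : ℕ) {Z : (P (2 * j)).parts} {W W' : (P (2 * j + 1)).parts}
    (hW : (W : Set X) ⊆ S.σ '' Z) :
    star (C.p (Z : Set X) * C.t * C.p (W : Set X)) * (C.p (Z : Set X) * C.t * C.p (W' : Set X)) =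
      C.p (W : Set X) * C.p (W' : Set X) := by
  have hZc := isClopen_part Z
  have hWc := isClopen_part W
  have h₁ : star C.t * C.p (Z : Set X) * (C.p (Z : Set X) * C.t) = C.p (S.σ '' Z) := by
    rw [← mul_assoc, mul_assoc (star C.t), C.p_mul_self hZc,
      C.star_t_mul_p_mul_t hZc (h.injOn _ _ Z.2)]
  calc _ = C.p (W : Set X) * (star C.t * C.p (Z : Set X) * (C.p (Z : Set X) * C.t)) *
        C.p (W' : Set X) := by
        rw [C.star_p_mul_t_mul_p hZc hWc]
        simp only [mul_assoc]
    _ = _ := by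
        rw [h₁, C.p_mul_of_subset hWc (S.isClopen_image hZc) hW]

theorem edgeCoeff_red_mul_star (j : ℕ) {Z : (P (2 * j)).parts} {W : (P (2 * j + 1)).parts} :
    C.p (Z : Set X) * C.t * C.p (W : Set X) * star (C.p (Z : Set X) * C.t * C.p (W : Set X)) =
      C.p (Z : Set X) * C.t * C.p (W : Set X) * (star C.t * C.p (Z : Set X)) := by
  rw [C.star_p_mul_t_mul_p (isClopen_part Z) (isClopen_part W),
    ← mul_assoc (C.p (Z : Set X) * C.t * _), mul_assoc (C.p (Z : Set X) * C.t),
    C.p_mul_self (isClopen_part W)]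

theorem single_edgeCoeff_mul_star (j : ℕ) (e : EvenEdge S (P (2 * j + 1)) (P (2 * j))) :
    Matrix.single (0 : Fin 2) (1 : Fin 2) (C.edgeCoeff e) *
      star (Matrix.single 0 1 (C.edgeCoeff e)) =
      (Matrix.singleAddMonoidHom 0 0 : A →+ Matrix (Fin 2) (Fin 2) A)
        (C.edgeCoeff e * star (C.edgeCoeff e)) := by
  rw [Matrix.star_eq_conjTranspose, Matrix.conjTranspose_single, Matrix.single_mul_single_same]
  rfl

/-- The family of `2 × 2`-matrices determined by a covariant representation. -/
noncomputable def family (h : SigmaRefined S P) (j : ℕ) :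
    LPA.Family (evenLayer h j).toSepGraph (Matrix (Fin 2) (Fin 2) A) where
  -- The vertices of both levels must be orthogonal with total sum $1$, whereas the $p_Z$ of each
  -- level already sum to $1$ in $A$. Hence two diagonal positions, with the edges off the diagonal.
  p := Sum.elim (fun Z => Matrix.single 0 0 (C.p (Z : Set X)))
    fun W => Matrix.single 1 1 (C.p (W : Set X))
  x e := Matrix.single 0 1 (C.edgeCoeff e)
  star_p v := by
    rw [Matrix.star_eq_conjTranspose]
    rcases v with Z | W <;> simp only [Sum.elim_inl, Sum.elim_inr] <;>
      rw [Matrix.conjTranspose_single, C.star_p (isClopen_part _)]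
  p_mul_self v := by
    rcases v with Z | W <;> simp only [Sum.elim_inl, Sum.elim_inr] <;>
      rw [Matrix.single_mul_single_same, C.p_mul_self (isClopen_part _)]
  p_mul_ne v v' hne := by
    rcases v with Z | W <;> rcases v' with Z' | W' <;> simp only [Sum.elim_inl, Sum.elim_inr]
    · rw [Matrix.single_mul_single_same, C.p_part_mul_ne fun h => hne (congrArg _ h),
        Matrix.single_zero]
    · exact Matrix.single_mul_single_of_ne _ _ _ _ zero_ne_one _
    · exact Matrix.single_mul_single_of_ne _ _ _ _ one_ne_zero _
    · rw [Matrix.single_mul_single_same, C.p_part_mul_ne fun h => hne (congrArg _ h),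
        Matrix.single_zero]
  range_mul e := by
    refine (Matrix.single_mul_single_same _ _ _ _ _).trans (congrArg _ ?_)
    rcases e with f | e
    · exact C.p_mul_of_superset (isClopen_part f.1.2) (isClopen_part f.1.1) f.2
    · change C.p (e.1.2 : Set X) * (C.p (e.1.2 : Set X) * C.t * C.p (e.1.1 : Set X)) = _
      rw [← mul_assoc, ← mul_assoc, C.p_mul_self (isClopen_part _)]
      rfl
  mul_source e := by
    refine (Matrix.single_mul_single_same _ _ _ _ _).trans (congrArg _ ?_)
    rcases e with f | e
    · exact C.p_mul_self (isClopen_part f.1.1)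
    · change C.p (e.1.2 : Set X) * C.t * C.p (e.1.1 : Set X) * C.p (e.1.1 : Set X) = _
      rw [mul_assoc, C.p_mul_self (isClopen_part _)]
      rfl
  star_mul_self e := by
    rw [Matrix.star_eq_conjTranspose, Matrix.conjTranspose_single, Matrix.single_mul_single_same]
    refine congrArg _ ?_
    rcases e with f | e
    · change star (C.p (f.1.1 : Set X)) * C.p (f.1.1 : Set X) = C.p (f.1.1 : Set X)
      rw [C.star_p (isClopen_part _), C.p_mul_self (isClopen_part _)]
    · refine (C.star_red_mul_red h j e.2).trans ?_
      exact C.p_mul_self (isClopen_part e.1.1)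
  star_mul_ne v Y hY e he e' he' hne := by
    rw [Matrix.star_eq_conjTranspose, Matrix.conjTranspose_single, Matrix.single_mul_single_same,
      ← Matrix.single_zero (1 : Fin 2) (1 : Fin 2)]
    refine congrArg _ ?_
    rcases v with Z | W
    · rcases hY with rfl | rfl
      · obtain ⟨f, rfl, hf⟩ := (mem_evenB j).1 he
        obtain ⟨f', rfl, hf'⟩ := (mem_evenB j).1 he'
        change star (C.p (f.1.1 : Set X)) * C.p (f'.1.1 : Set X) = 0
        rw [C.star_p (isClopen_part _)]
        exact C.p_part_mul_ne fun heq => hne (congrArg _ ((blueEdge_bijective h j).1 heq))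
      · obtain ⟨⟨⟨W, Z⟩, hf⟩, rfl, rfl⟩ := (mem_evenR j).1 he
        obtain ⟨⟨⟨W', Z'⟩, hf'⟩, rfl, hZ'⟩ := (mem_evenR j).1 he'
        obtain rfl : Z' = Z := hZ'
        refine (C.star_red_mul_red h j hf).trans (C.p_part_mul_ne ?_)
        rintro rfl
        exact hne rfl
    · exact absurd hY (Set.notMem_empty _)
  sum_mul_star v Y hY := by
    classical
    refine (Finset.sum_congr rfl fun e _ => C.single_edgeCoeff_mul_star j e).trans ?_
    refine (map_sum (Matrix.singleAddMonoidHom 0 0 : A →+ Matrix (Fin 2) (Fin 2) A)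
      _ Y).symm.trans ?_
    rcases v with Z | W
    · refine congrArg (Matrix.single 0 0) ?_
      have hZc := isClopen_part Z
      rcases hY with rfl | rfl
      · refine (sum_evenB j Z _).trans ?_
        rw [← C.sum_p_blue h j Z]
        refine Finset.sum_congr rfl fun f _ => ?_
        change C.p (f.1.1 : Set X) * star (C.p (f.1.1 : Set X)) = _
        rw [C.star_p (isClopen_part _), C.p_mul_self (isClopen_part _)]
      · refine (sum_evenR j Z _).trans ?_
        -- Uses $p_Z=p_Ztt^*p_Z$ and $p_Zt=p_Ztp_{\sigma(Z)}=\sum_Wp_Ztp_W$, with $W$ running over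
        -- the sources of the red edges with range $Z$.
        rw [← C.p_mul_t_mul_star_t_mul_p hZc (h.injOn _ _ Z.2),
          ← C.p_mul_t_mul_p_image hZc, ← C.sum_p_red h j Z, Finset.mul_sum, Finset.sum_mul]
        refine Finset.sum_congr rfl fun e he => ?_
        obtain rfl := (Finset.mem_filter.1 he).2
        exact C.edgeCoeff_red_mul_star j
    · exact absurd hY (Set.notMem_empty _)
  sum_p := by
    refine (Fintype.sum_sum_type _).trans ?_
    simp only [Sum.elim_inl, Sum.elim_inr]
    have h₁ : ∀ (i : Fin 2) (n : ℕ), ∑ Z : (P n).parts, Matrix.single i i (C.p (Z : Set X)) =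
        Matrix.single i i (1 : A) := fun i n => by
      rw [← C.sum_p_coe (P n)]
      exact (map_sum (Matrix.singleAddMonoidHom i i : A →+ Matrix (Fin 2) (Fin 2) A) _ _).symm
    rw [h₁, h₁, ← Matrix.sum_single_one, Fin.sum_univ_two]

end CovRep

end representation

section representation

variable {X : Type u} [MetricSpace X] [CompactSpace X] {S : LHomeo X} {P : ℕ → ClopenPartition X}
variable {A : Type w} [Ring A] [StarRing A] {K : Type v} [Field K] [StarRing K] [Algebra K A]
  [StarModule K A]

namespace CovRep

variable (C : CovRep S A) (h : SigmaRefined S P) (j : ℕ)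

variable (K) in
/-- The homomorphism into `2 × 2`-matrices determined by a covariant representation. -/
noncomputable def matrixHom : (evenLayer h j).L K →⋆ₐ[K] Matrix (Fin 2) (Fin 2) A :=
  (C.family h j).hom

theorem matrixHom_v₀ (Z : (P (2 * j)).parts) :
    C.matrixHom K h j ((evenLayer h j).v₀ K Z) = Matrix.single 0 0 (C.p (Z : Set X)) :=
  (C.family h j).hom_vtx _

theorem matrixHom_ed (e : EvenEdge S (P (2 * j + 1)) (P (2 * j))) :
    C.matrixHom K h j ((evenLayer h j).ed K e) = Matrix.single 0 1 (C.edgeCoeff e) :=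
  (C.family h j).hom_edg _

theorem matrixHom_proj {U : Set X} (hU : (P (2 * j)).Saturates U) :
    C.matrixHom K h j (proj K h j U) = Matrix.single 0 0 (C.p U) := by
  classical
  rw [proj, map_sum, ← C.sum_p_of_saturates _ hU]
  simp only [matrixHom_v₀]
  exact (map_sum (Matrix.singleAddMonoidHom 0 0 : A →+ Matrix (Fin 2) (Fin 2) A) _ _).symm

theorem matrixHom_p :
    C.matrixHom K h j ((evenLayer h j).p K) = Matrix.single 0 0 1 := by
  rw [← proj_univ, C.matrixHom_proj h j ClopenPartition.saturates_univ, C.p_univ]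

open Classical in
theorem sum_edgeCoeff_blue (h : SigmaRefined S P) (j : ℕ) : ∑ f : BlueEdge (P (2 * j + 1)) (P (2 * j)),
    C.edgeCoeff (blue f : EvenEdge S _ _) = 1 := by
  rw [← C.sum_p_coe (P (2 * j + 1))]
  exact (blueEdge_bijective h j).sum_comp fun W => C.p (W : Set X)

open Classical in
theorem sum_edgeCoeff_red (h : SigmaRefined S P) (j : ℕ) : ∑ e : RedEdgeEven S (P (2 * j + 1)) (P (2 * j)),
    C.edgeCoeff (red e) = C.t := by
  classical
  rw [← Finset.sum_fiberwise Finset.univ fun e => e.1.2]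
  calc _ = ∑ Z : (P (2 * j)).parts, C.p (Z : Set X) * C.t := by
        refine Finset.sum_congr rfl fun Z _ => ?_
        rw [← C.p_mul_t_mul_p_image (isClopen_part Z), ← C.sum_p_red h j Z, Finset.mul_sum]
        refine Finset.sum_congr rfl fun e he => ?_
        obtain rfl := (Finset.mem_filter.1 he).2
        rfl
    _ = C.t := by rw [← Finset.sum_mul, C.sum_p_coe, one_mul]

theorem matrixHom_shift : C.matrixHom K h j (shift K h j) = Matrix.single 0 0 C.t := by
  classical
  have hb : C.matrixHom K h j (blSum K h j) = Matrix.single 0 1 1 := by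
    rw [blSum, map_sum, ← C.sum_edgeCoeff_blue h j]
    exact (Finset.sum_congr rfl fun f _ => C.matrixHom_ed h j (blue f)).trans
      (map_sum (Matrix.singleAddMonoidHom 0 1 : A →+ Matrix (Fin 2) (Fin 2) A) _ _).symm
  have hr : C.matrixHom K h j (rdSum K h j) = Matrix.single 0 1 C.t := by
    rw [rdSum, map_sum, ← C.sum_edgeCoeff_red h j]
    exact (Finset.sum_congr rfl fun f _ => C.matrixHom_ed h j (red f)).trans
      (map_sum (Matrix.singleAddMonoidHom 0 1 : A →+ Matrix (Fin 2) (Fin 2) A) _ _).symm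
  rw [shift, map_mul, map_star, hb, hr, Matrix.star_eq_conjTranspose,
    Matrix.conjTranspose_single, Matrix.single_mul_single_same, star_one, mul_one]

/-- The unit of the corner goes to the matrix unit in position $(0,0)$, so compressed elements have
no other entry. Hence taking that entry is multiplicative on the corner. -/
theorem matrixHom_corner (a : CornerAlg K h j) :
    C.matrixHom K h j a.1 = Matrix.single 0 0 (C.matrixHom K h j a.1 0 0) := by
  obtain ⟨_, b, rfl⟩ := a
  simp only [map_mul, matrixHom_p]
  rw [Matrix.single_mul_mul_single]
  simp

variable (K) in
/-- The *-homomorphism on the corner determined by a covariant representation. -/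
noncomputable def cornerRep : CornerAlg K h j →⋆ₙₐ[K] A where
  toFun a := C.matrixHom K h j a.1 0 0
  map_smul' c a := by
    change C.matrixHom K h j (c • a.1) 0 0 = _
    rw [map_smul]
    rfl
  map_zero' := by
    change C.matrixHom K h j 0 0 0 = _
    rw [map_zero]
    rfl
  map_add' a b := by
    change C.matrixHom K h j (a.1 + b.1) 0 0 = _
    rw [map_add]
    rfl
  map_mul' a b := by
    change C.matrixHom K h j (a.1 * b.1) 0 0 = _
    rw [map_mul, matrixHom_corner C h j a, Matrix.mul_apply, Fin.sum_univ_two]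
    simp
  map_star' a := by
    change C.matrixHom K h j (star a.1) 0 0 = _
    rw [map_star]
    rfl

theorem cornerRep_eq_of_matrixHom {a : CornerAlg K h j} {x : A}
    (hx : C.matrixHom K h j a.1 = Matrix.single 0 0 x) : C.cornerRep K h j a = x := by
  change C.matrixHom K h j a.1 0 0 = x
  rw [hx]
  exact Matrix.single_apply_same _ _ _

theorem cornerRep_cornerProj {U : Set X} (hU : (P (2 * j)).Saturates U) :
    C.cornerRep K h j (cornerProj K h j U) = C.p U :=
  C.cornerRep_eq_of_matrixHom h j (C.matrixHom_proj h j hU)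

theorem cornerRep_cornerVertex (Z : (P (2 * j)).parts) :
    C.cornerRep K h j (cornerVertex K h j Z) = C.p (Z : Set X) :=
  C.cornerRep_eq_of_matrixHom h j (C.matrixHom_v₀ h j Z)

theorem cornerRep_cornerShift : C.cornerRep K h j (cornerShift K h j) = C.t :=
  C.cornerRep_eq_of_matrixHom h j (C.matrixHom_shift h j)

theorem cornerRep_cornerPair (e f : EvenEdge S (P (2 * j + 1)) (P (2 * j))) :
    C.cornerRep K h j (cornerPair K h j e f) = C.edgeCoeff e * star (C.edgeCoeff f) := by
  refine C.cornerRep_eq_of_matrixHom h j ?_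
  change C.matrixHom K h j ((evenLayer h j).ed K e * star ((evenLayer h j).ed K f)) = _
  rw [map_mul, map_star, matrixHom_ed, matrixHom_ed, Matrix.star_eq_conjTranspose,
    Matrix.conjTranspose_single, Matrix.single_mul_single_same]

theorem star_cornerPair (e f : EvenEdge S (P (2 * j + 1)) (P (2 * j))) :
    star (cornerPair K h j e f) = cornerPair K h j f e :=
  CornerAlg.ext ((star_mul _ _).trans (by rw [star_star]; rfl))

/-- Two homomorphisms on the corner are compared on its generators. The decisive one is $ef^*$ with
$e$ red and $f$ blue, where both sides are $p_Utp_W$; its adjoint follows by applying the star. -/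
theorem cornerRep_connect (a : CornerAlg K h j) :
    C.cornerRep K h (j + 1) (connect K h j a) = C.cornerRep K h j a := by
  let M : NonUnitalSubalgebra K (CornerAlg K h j) := NonUnitalAlgHom.equalizer
    ((C.cornerRep K h (j + 1)).comp (connect K h j)) (C.cornerRep K h j)
  have hrb : ∀ (e : RedEdgeEven S (P (2 * j + 1)) (P (2 * j)))
      (f : BlueEdge (P (2 * j + 1)) (P (2 * j))), e.1.1 = f.1.1 →
      C.cornerRep K h (j + 1) (connect K h j (cornerPair K h j (red e) (blue f))) =
        C.cornerRep K h j (cornerPair K h j (red e) (blue f)) := by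
    intro e f hef
    rw [connect_cornerPair_red_blue K h j e f hef, map_mul, map_mul, cornerRep_cornerShift,
      C.cornerRep_cornerProj h (j + 1) (h.saturates_inter_preimage j e.1.2 e.1.1),
      C.cornerRep_cornerProj h (j + 1) (AInf.part_odd_saturates h j e.1.1),
      C.p_inter_preimage_mul_t_mul_p (isClopen_part _) (isClopen_part _), cornerRep_cornerPair,
      edgeCoeff_red, edgeCoeff_blue, C.star_p (isClopen_part _), ← hef,
      mul_assoc (C.p (e.1.2 : Set X) * C.t), C.p_mul_self (isClopen_part _)]
  have : a ∈ M := by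
    refine CornerAlg.eq_top_of_mem M ?_ ?_ hrb ?_ a
    · intro Z
      change C.cornerRep K h (j + 1) (connect K h j (cornerVertex K h j Z)) =
        C.cornerRep K h j (cornerVertex K h j Z)
      have h₁ : connect K h j (cornerVertex K h j Z) = cornerProj K h (j + 1) Z :=
        CornerAlg.ext (twoStep_v₀ K h j Z)
      rw [h₁, cornerRep_cornerVertex, cornerRep_cornerProj]
      exact h.saturates_mono (by omega) (ClopenPartition.saturates_part Z.2)
    · intro f
      change C.cornerRep K h (j + 1) (connect K h j (cornerPair K h j (blue f) (blue f))) =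
        C.cornerRep K h j (cornerPair K h j (blue f) (blue f))
      have h₁ : connect K h j (cornerPair K h j (blue f) (blue f)) =
          cornerProj K h (j + 1) f.1.1 :=
        CornerAlg.ext (twoStep_bl_mul_star_bl K h j f)
      rw [h₁, cornerRep_cornerPair, cornerRep_cornerProj, edgeCoeff_blue,
        C.star_p (isClopen_part _), C.p_mul_self (isClopen_part _)]
      exact AInf.part_odd_saturates h j f.1.1
    · intro e f hef
      change C.cornerRep K h (j + 1) (connect K h j (cornerPair K h j (blue f) (red e))) =
        C.cornerRep K h j (cornerPair K h j (blue f) (red e))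
      rw [← star_cornerPair, map_star, map_star, map_star, hrb e f hef]
  exact this

end CovRep

end representation

/-! ### The homomorphism from the colimit -/

section lift

attribute [local instance] AInf.unitalRing

variable {X : Type u} [MetricSpace X] [CompactSpace X] {S : LHomeo X} {P : ℕ → ClopenPartition X}
variable {A : Type w} [Ring A] [StarRing A] {K : Type v} [Field K] [StarRing K] [Algebra K A]
  [StarModule K A]

namespace CovRep

variable (C : CovRep S A) (h : SigmaRefined S P)

theorem cornerRep_transition {i k : ℕ} (hik : i ≤ k) (a : CornerAlg K h i) :
    C.cornerRep K h k (transition K h i k hik a) = C.cornerRep K h i a := by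
  induction k, hik using Nat.le_induction with
  | base => rw [transition_self]; rfl
  | succ k hk ih =>
    rw [transition_succ K h i k hk, NonUnitalStarAlgHom.comp_apply, cornerRep_connect, ih]

variable (K) in
/-- The *-homomorphism on `𝒜_∞` determined by a covariant representation. -/
noncomputable def lift : AInf K h →⋆ₙₐ[K] A where
  toFun := DirectLimit.lift (transition K h) (fun j a => C.cornerRep K h j a)
    fun _ _ hik a => (C.cornerRep_transition h hik a).symm
  map_smul' c x := by
    obtain ⟨j, a, rfl⟩ := exists_toAInfHom K h x
    rw [← map_smul]
    exact map_smul (C.cornerRep K h j) c a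
  map_zero' := by
    rw [← map_zero (toAInfHom K h 0)]
    exact map_zero (C.cornerRep K h 0)
  map_add' x y := by
    obtain ⟨j, a, b, rfl, rfl⟩ := DirectLimit.exists_eq_mk₂ (transition K h) x y
    change DirectLimit.lift (transition K h) _ _ (toAInfHom K h j a + toAInfHom K h j b) = _
    rw [← map_add]
    exact map_add (C.cornerRep K h j) a b
  map_mul' x y := by
    obtain ⟨j, a, b, rfl, rfl⟩ := DirectLimit.exists_eq_mk₂ (transition K h) x y
    change DirectLimit.lift (transition K h) _ _ (toAInfHom K h j a * toAInfHom K h j b) = _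
    rw [← map_mul]
    exact map_mul (C.cornerRep K h j) a b
  map_star' x := by
    obtain ⟨j, a, rfl⟩ := exists_toAInfHom K h x
    rw [← map_star]
    exact map_star (C.cornerRep K h j) a

theorem lift_toAInfHom (j : ℕ) (a : CornerAlg K h j) :
    C.lift K h (toAInfHom K h j a) = C.cornerRep K h j a := rfl

theorem lift_p {U : Set X} (hU : IsClopen U) :
    C.lift K h ((AInf.covRep K h).p U) = C.p U := by
  obtain ⟨j, hj⟩ := h.exists_saturates_even hU
  rw [AInf.covRep_p_eq K h j (hj j le_rfl), lift_toAInfHom, C.cornerRep_cornerProj h j (hj j le_rfl)]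

theorem lift_t : C.lift K h (AInf.covRep K h).t = C.t := by
  rw [AInf.covRep_t_eq K h 0, lift_toAInfHom, cornerRep_cornerShift]

theorem lift_one : C.lift K h 1 = 1 := by
  rw [← (AInf.covRep K h).p_univ, C.lift_p h isClopen_univ, C.p_univ]

theorem lift_pow (x : AInf K h) (n : ℕ) : C.lift K h (x ^ n) = C.lift K h x ^ n := by
  induction n with
  | zero => rw [pow_zero, pow_zero, lift_one]
  | succ n ih => rw [pow_succ, pow_succ, map_mul, ih]

theorem lift_E (m n : ℕ) {U V : Set X} (hU : IsClopen U) (hV : IsClopen V) :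
    C.lift K h ((AInf.covRep K h).E m n U V) = C.E m n U V := by
  rw [E, E, map_mul, map_mul, map_mul, lift_pow, lift_pow, map_star, lift_t, C.lift_p h hU,
    C.lift_p h hV]

end CovRep

namespace AInf

/-- Every generator of a corner is a product of elements $p_U$, $t$, $t^*$, each of which multiplies
the span into itself; such multipliers lie in the span. -/
theorem mem_iSup_spanE (h : SigmaRefined S P) (x : AInf K h) :
    x ∈ ⨆ k : ℕ × ℕ, (covRep K h).spanE K k.1 k.2 := by
  obtain ⟨j, a, rfl⟩ := exists_toAInfHom K h x
  refine (covRep K h).mem_iSup_of_mem_multipliers ?_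
  have ht := (covRep K h).t_mem_multipliers (K := K)
  have hts := (covRep K h).star_t_mem_multipliers (K := K) (P 0) fun Z hZ => h.injOn 0 Z hZ
  have hp : ∀ {n : ℕ} (Z : (P n).parts), (covRep K h).p (Z : Set X) ∈ (covRep K h).multipliers K :=
    fun {n} Z => (covRep K h).p_mem_multipliers ((P n).isClopen _ Z.2)
  refine CornerAlg.eq_top_of_mem (((covRep K h).multipliers K).comap (toAInfHom K h j)) ?_ ?_ ?_ ?_ a
  · intro Z
    change toAInfHom K h j _ ∈ (covRep K h).multipliers K
    rw [toAInfHom_cornerVertex]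
    exact hp Z
  · intro f
    change toAInfHom K h j _ ∈ (covRep K h).multipliers K
    rw [toAInfHom_cornerPair_blue]
    exact hp f.1.1
  · intro e f hef
    change toAInfHom K h j _ ∈ (covRep K h).multipliers K
    rw [toAInfHom_cornerPair_red_blue K h j e f hef]
    exact mul_mem (mul_mem (hp e.1.2) ht) (hp e.1.1)
  · intro e f hef
    change toAInfHom K h j _ ∈ (covRep K h).multipliers K
    rw [← CovRep.star_cornerPair, map_star, toAInfHom_cornerPair_red_blue K h j e f hef,
      (covRep K h).star_p_mul_t_mul_p (CovRep.isClopen_part _) (CovRep.isClopen_part _)]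
    exact mul_mem (hp e.1.1) (mul_mem hts (hp e.1.2))

end AInf

end lift

/-! ### The canonical isomorphism -/

section canonical

attribute [local instance] AInf.unitalRing SteinbergAlgebra.unitalRing
  SteinbergAlgebra.unitalAlgebra

variable {X : Type u} [MetricSpace X] [CompactSpace X] [TotallyDisconnectedSpace X]
variable {S : LHomeo X} {P : ℕ → ClopenPartition X} {K : Type v} [Field K] [StarRing K]

open SteinbergAlgebra DRGroupoid

variable (K) in
/-- The canonical homomorphism into the Steinberg algebra. -/
noncomputable def canonicalHom (h : SigmaRefined S P) : AInf K h →⋆ₙₐ[K] SteinbergAlgebra K S :=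
  (SteinbergAlgebra.covRep K S).lift K h

variable (h : SigmaRefined S P)

theorem canonicalHom_E (m n : ℕ) {U V : Set X} (hU : IsClopen U) (hV : IsClopen V) :
    canonicalHom K h ((AInf.covRep K h).E m n U V) = indSet K (Z S U m n V) := by
  rw [canonicalHom, CovRep.lift_E _ h m n hU hV, covRep_E m n hU hV]

theorem canonicalHom_injective : Function.Injective (canonicalHom K h) := by
  refine (injective_iff_map_eq_zero (canonicalHom K h)).2 fun a ha => ?_
  refine (AInf.covRep K h).eq_zero_of_mem_iSup_spanE h
    (canonicalHom K h : AInf K h →ₗ[K] SteinbergAlgebra K S) ?_ (AInf.mem_iSup_spanE h a) ha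
  intro m n U V hU hV
  exact (congrArg Subtype.val (canonicalHom_E h m n hU hV)).trans (coe_indSet_Z hU hV m n)

theorem canonicalHom_surjective : Function.Surjective (canonicalHom K h) := by
  intro f
  induction f using SteinbergAlgebra.induction with
  | h₀ => exact ⟨0, map_zero _⟩
  | h₁ B hB =>
    obtain ⟨U, m, n, V, hU, hV, -, -, rfl⟩ := hB
    exact ⟨_, (canonicalHom_E h m n hU hV).trans (cyl_eq_indSet _).symm⟩
  | h₂ f g hf hg =>
    obtain ⟨a, rfl⟩ := hf
    obtain ⟨b, rfl⟩ := hg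
    exact ⟨a + b, map_add _ _ _⟩
  | h₃ c f hf =>
    obtain ⟨a, rfl⟩ := hf
    exact ⟨c • a, map_smul _ _ _⟩

/-- Two homomorphisms on `𝒜_∞` with the same values on the generators of the corners agree. -/
theorem IsCanonical.eq {φ ψ : AInf K h →⋆ₙₐ[K] SteinbergAlgebra K S} (hφ : IsCanonical φ)
    (hψ : IsCanonical ψ) (x : AInf K h) : φ x = ψ x := by
  obtain ⟨j, a, rfl⟩ := exists_toAInfHom K h x
  have key : ∀ {f g : SteinbergAlgebra K S} {B : Set (DRGroupoid S)}, ⇑f = ind K B →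
      ⇑g = ind K B → f = g := fun hf hg => Subtype.ext (hf.trans hg.symm)
  refine CornerAlg.eq_top_of_mem (NonUnitalAlgHom.equalizer (φ.comp (toAInfHom K h j))
    (ψ.comp (toAInfHom K h j))) ?_ ?_ ?_ ?_ a
  · exact fun Z => key (hφ.vertex j Z) (hψ.vertex j Z)
  · exact fun f => key (hφ.blue_blue j f.1.1 f.1.2 f.1.2 f f rfl rfl)
      (hψ.blue_blue j f.1.1 f.1.2 f.1.2 f f rfl rfl)
  · exact fun e f hef => key (hφ.red_blue j e.1.1 e.1.2 f.1.2 e f rfl (Prod.ext hef.symm rfl))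
      (hψ.red_blue j e.1.1 e.1.2 f.1.2 e f rfl (Prod.ext hef.symm rfl))
  · exact fun e f hef => key (hφ.blue_red j e.1.1 f.1.2 e.1.2 f e (Prod.ext hef.symm rfl) rfl)
      (hψ.blue_red j e.1.1 f.1.2 e.1.2 f e (Prod.ext hef.symm rfl) rfl)

theorem CovRep.p_mul_t_mul_p {A : Type w} [Ring A] [StarRing A] (C : CovRep S A) {U W : Set X}
    (hU : IsClopen U) (hW : IsClopen W) : C.p U * C.t * C.p W = C.p (U ∩ S.σ ⁻¹' W) * C.t := by
  rw [C.p_inter hU (S.isClopen_preimage hW), mul_assoc, C.t_mul_p hW, mul_assoc]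

/-- With $p_Utp_W=p_{U\cap\sigma^{-1}(W)}t$ each product $ef^*$ is sent to some
$p_{U'}t^m(t^*)^np_{V'}$, where $m$ and $n$ are $1$ or $0$ according to whether $e$ and $f$ are red
or blue. -/
theorem isCanonical_canonicalHom : IsCanonical (canonicalHom K h) := by
  have hind : ∀ {j : ℕ} {a : CornerAlg K h j} (m n : ℕ) {U V : Set X}, IsClopen U → IsClopen V →
      (SteinbergAlgebra.covRep K S).cornerRep K h j a =
        (SteinbergAlgebra.covRep K S).E m n U V →
      ⇑(canonicalHom K h (toAInf j a)) = ind K (Z S U m n V) := by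
    intro j a m n U V hU hV ha
    have : canonicalHom K h (toAInf j a) = indSet K (Z S U m n V) :=
      (ha.trans (covRep_E m n hU hV))
    rw [this]
    exact coe_indSet_Z hU hV m n
  have hc : ∀ {n : ℕ} (Z : (P n).parts), IsClopen (Z : Set X) := fun Z => (P _).isClopen _ Z.2
  have hc' : ∀ {m n : ℕ} (Z : (P m).parts) (W : (P n).parts), IsClopen (Z ∩ S.σ ⁻¹' W : Set X) :=
    fun Z W => (hc Z).inter (S.isClopen_preimage (hc W))
  constructor
  · intro j U
    refine hind 0 0 (hc U) (hc U) ?_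
    rw [CovRep.cornerRep_cornerVertex, CovRep.E, pow_zero, pow_zero, mul_one, one_mul,
      CovRep.p_mul_self _ (hc U)]
  · rintro j W U V ⟨_, he⟩ ⟨_, hf⟩ rfl rfl
    refine hind 0 0 (hc W) (hc W) ?_
    rw [CovRep.cornerRep_cornerPair, CovRep.edgeCoeff_blue, CovRep.edgeCoeff_blue,
      CovRep.star_p _ (hc W), CovRep.E, pow_zero, pow_zero, mul_one, one_mul]
  · rintro j W U V ⟨_, he⟩ ⟨_, hf⟩ rfl rfl
    refine hind 1 1 (hc' U W) (hc' V W) ?_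
    rw [CovRep.cornerRep_cornerPair, CovRep.edgeCoeff_red, CovRep.edgeCoeff_red,
      CovRep.p_mul_t_mul_p _ (hc U) (hc W), CovRep.p_mul_t_mul_p _ (hc V) (hc W), star_mul,
      CovRep.star_p _ (hc' V W), CovRep.E, pow_one, pow_one]
  · rintro j W U V ⟨_, he⟩ ⟨_, hf⟩ rfl rfl
    refine hind 1 0 (hc' U W) (hc W) ?_
    rw [CovRep.cornerRep_cornerPair, CovRep.edgeCoeff_red, CovRep.edgeCoeff_blue,
      CovRep.p_mul_t_mul_p _ (hc U) (hc W), CovRep.star_p _ (hc W), CovRep.E, pow_one, pow_zero,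
      one_mul]
  · rintro j W U V ⟨_, he⟩ ⟨_, hf⟩ rfl rfl
    refine hind 0 1 (hc W) (hc' V W) ?_
    rw [CovRep.cornerRep_cornerPair, CovRep.edgeCoeff_red, CovRep.edgeCoeff_blue,
      CovRep.p_mul_t_mul_p _ (hc V) (hc W), star_mul, CovRep.star_p _ (hc' V W), CovRep.E, pow_one,
      pow_zero, mul_one]

end canonical

/-! ### The grading -/

namespace LPA

variable {K : Type v} [Field K] {G : SepGraph.{u}} [Fintype G.V] {deg : G.E → ℤ}

theorem gen_mem_component (x : G.Gen) : gen K G x ∈ component K G deg (genDeg deg x) :=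
  Submodule.subset_span ⟨[x], by simp, by simp⟩

theorem mul_mem_component {d d' : ℤ} {a b : LPA K G} (ha : a ∈ component K G deg d)
    (hb : b ∈ component K G deg d') : a * b ∈ component K G deg (d + d') := by
  have h₁ := Submodule.mul_mem_mul ha hb
  rw [component, component, Submodule.span_mul_span] at h₁
  refine Submodule.span_mono ?_ h₁
  rintro _ ⟨_, ⟨l, hl, rfl⟩, _, ⟨l', hl', rfl⟩, rfl⟩
  exact ⟨l ++ l', by rw [List.map_append, List.sum_append, hl, hl'],
    by rw [List.map_append, List.prod_append]⟩

/-- The algebra is spanned by words in the generators, and every word is homogeneous. -/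
theorem mem_iSup_component (a : LPA K G) : a ∈ ⨆ d, component K G deg d := by
  have h₁ : a ∈ Algebra.adjoin K (Set.range (gen K G)) := by
    induction a using LPA.ind with
    | h0 c => exact Subalgebra.algebraMap_mem _ c
    | h1 x => exact Algebra.subset_adjoin ⟨x, rfl⟩
    | h2 a b ha hb => exact mul_mem ha hb
    | h3 a b ha hb => exact add_mem ha hb
  rw [← Subalgebra.mem_toSubmodule, Algebra.adjoin_eq_span] at h₁
  refine (Submodule.span_le.2 fun x hx => ?_ : Submodule.span K _ ≤ _) h₁
  have h₂ : Submonoid.closure (Set.range (gen K G)) ≤ MonoidHom.mrange (FreeMonoid.lift (gen K G)) :=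
    Submonoid.closure_le.2 (by
      rintro _ ⟨x, rfl⟩
      exact ⟨FreeMonoid.of x, FreeMonoid.lift_eval_of _ _⟩)
  obtain ⟨l, rfl⟩ := h₂ hx
  refine Submodule.mem_iSup_of_mem ((l.toList.map (genDeg deg)).sum) (Submodule.subset_span ?_)
  exact ⟨l.toList, rfl, (FreeMonoid.lift_apply _ _).symm⟩

end LPA

namespace SteinbergAlgebra

variable {X : Type u} [TopologicalSpace X] {K : Type v} [Field K] {S : LHomeo X}
variable [CompactSpace X] [T2Space X] [TotallyDisconnectedSpace X]

theorem mul_mem_component {d d' : ℤ} {f g : SteinbergAlgebra K S} (hf : f ∈ component K S d)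
    (hg : g ∈ component K S d') : f * g ∈ component K S (d + d') := by
  intro γ hγ
  rw [mul_apply] at hγ
  obtain ⟨α, hα⟩ : ∃ α, f (divR γ α) * g α ≠ 0 := by
    by_contra! h
    exact hγ (finsum_eq_zero_of_forall_eq_zero h)
  have h₁ := hf _ (left_ne_zero_of_mul hα)
  have h₂ := hg _ (right_ne_zero_of_mul hα)
  simp only [divR, DRGroupoid.mul, DRGroupoid.inv] at h₁
  omega

theorem star_mem_component [StarRing K] {d : ℤ} {f : SteinbergAlgebra K S}
    (hf : f ∈ component K S d) : star f ∈ component K S (-d) := by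
  intro γ hγ
  rw [star_apply] at hγ
  have h₁ := hf γ.inv fun h => hγ (by rw [h, star_zero])
  simp only [DRGroupoid.inv] at h₁
  omega

theorem indSet_Z_mem_component (m n : ℕ) {U V : Set X} (hU : IsClopen U) (hV : IsClopen V) :
    indSet K (DRGroupoid.Z S U m n V) ∈ component K S (m - n) := by
  classical
  intro γ hγ
  have h₁ : ind K (DRGroupoid.Z S U m n V) γ ≠ 0 := by
    rw [← coe_indSet_Z hU hV m n]
    exact hγ
  by_contra hd
  refine h₁ ?_
  exact if_neg fun hmem => hd hmem.1

end SteinbergAlgebra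

section grading

attribute [local instance] AInf.unitalRing SteinbergAlgebra.unitalRing
  SteinbergAlgebra.unitalAlgebra

variable {X : Type u} [MetricSpace X] [CompactSpace X] [TotallyDisconnectedSpace X]
variable {S : LHomeo X} {P : ℕ → ClopenPartition X} {K : Type v} [Field K] [StarRing K]
variable (h : SigmaRefined S P) (j : ℕ)

open SteinbergAlgebra

theorem edgeCoeff_mem_component (e : EvenEdge S (P (2 * j + 1)) (P (2 * j))) :
    (SteinbergAlgebra.covRep K S).edgeCoeff e ∈ SteinbergAlgebra.component K S (edgeDeg e) := by
  have hp : ∀ {n : ℕ} (Z : (P n).parts),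
      (SteinbergAlgebra.covRep K S).p (Z : Set X) ∈ SteinbergAlgebra.component K S 0 :=
    fun Z => indSet_Z_mem_component 0 0 ((P _).isClopen _ Z.2) ((P _).isClopen _ Z.2)
  have ht : (SteinbergAlgebra.covRep K S).t ∈ SteinbergAlgebra.component K S 1 :=
    indSet_Z_mem_component 1 0 isClopen_univ isClopen_univ
  rcases e with f | e
  · exact hp f.1.1
  · exact SteinbergAlgebra.mul_mem_component (d := 0 + 1) (d' := 0)
      (SteinbergAlgebra.mul_mem_component (hp e.1.2) ht) (hp e.1.1)

theorem single_mem_component {d : ℤ} {f : SteinbergAlgebra K S}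
    (hf : f ∈ SteinbergAlgebra.component K S d) (i k i' k' : Fin 2) :
    Matrix.single i k f i' k' ∈ SteinbergAlgebra.component K S d := by
  rw [Matrix.single_apply]
  split_ifs
  · exact hf
  · exact Submodule.zero_mem _

theorem matrixHom_gen_mem_component (x : (evenLayer h j).toSepGraph.Gen) (i k : Fin 2) :
    (SteinbergAlgebra.covRep K S).matrixHom K h j (LPA.gen K _ x) i k ∈
      SteinbergAlgebra.component K S (LPA.genDeg edgeDeg x) := by
  have hgen : (SteinbergAlgebra.covRep K S).matrixHom K h j (LPA.gen K _ x) =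
    ((SteinbergAlgebra.covRep K S).family h j).onGen x :=
    LPA.Family.algHom_gen _ _
  rw [hgen]
  cases x with
  | vertex v =>
    rcases v with Z | W
    · exact single_mem_component (indSet_Z_mem_component 0 0 ((P _).isClopen _ Z.2)
        ((P _).isClopen _ Z.2)) _ _ _ _
    · exact single_mem_component (indSet_Z_mem_component 0 0 ((P _).isClopen _ W.2)
        ((P _).isClopen _ W.2)) _ _ _ _
  | edge e => exact single_mem_component (edgeCoeff_mem_component j e) _ _ _ _
  | ghost e =>
    exact star_mem_component (single_mem_component (edgeCoeff_mem_component j e) _ _ _ _)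

/-- All four entries are treated together, since the entries of a product mix them; for words this
is induction on the length. -/
theorem matrixHom_mem_component {d : ℤ} {a : (evenLayer h j).L K}
    (ha : a ∈ LPA.component K (evenLayer h j).toSepGraph edgeDeg d) (i k : Fin 2) :
    (SteinbergAlgebra.covRep K S).matrixHom K h j a i k ∈ SteinbergAlgebra.component K S d := by
  induction ha using Submodule.span_induction with
  | mem a ha =>
    obtain ⟨l, rfl, rfl⟩ := ha
    induction l generalizing i k with
    | nil =>
      rw [List.map_nil, List.map_nil, List.prod_nil, List.sum_nil, map_one, Matrix.one_apply]
      split_ifs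
      · exact indSet_Z_mem_component 0 0 isClopen_univ isClopen_univ
      · exact Submodule.zero_mem _
    | cons x l ih =>
      rw [List.map_cons, List.map_cons, List.prod_cons, List.sum_cons, map_mul, Matrix.mul_apply]
      exact Submodule.sum_mem _ fun m _ => SteinbergAlgebra.mul_mem_component
        (matrixHom_gen_mem_component h j x i m) (ih m k)
  | zero =>
    rw [map_zero]
    exact Submodule.zero_mem _
  | add a b _ _ iha ihb =>
    rw [map_add]
    exact Submodule.add_mem _ iha ihb
  | smul c a _ ih =>
    rw [map_smul]
    exact Submodule.smul_mem _ c ih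

theorem canonicalHom_mem_component {d : ℤ} {a : CornerAlg K h j}
    (ha : a.1 ∈ LPA.component K (evenLayer h j).toSepGraph edgeDeg d) :
    canonicalHom K h (toAInfHom K h j a) ∈ SteinbergAlgebra.component K S d :=
  matrixHom_mem_component h j ha 0 0

/-- Every element of a corner is a sum of homogeneous elements of the corner. -/
theorem CornerAlg.exists_sum_mem_component (a : CornerAlg K h j) :
    ∃ (s : Finset ℤ) (f : ℤ → CornerAlg K h j),
      (∀ d, (f d).1 ∈ LPA.component K (evenLayer h j).toSepGraph edgeDeg d) ∧
      (∀ d ∉ s, f d = 0) ∧ ∑ d ∈ s, f d = a := by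
  obtain ⟨f, hf, hsum⟩ := (Submodule.mem_iSup_iff_exists_finsupp _ _).1
    (LPA.mem_iSup_component (deg := edgeDeg) a.1)
  -- As $p$ has degree $0$, compression by $p$ preserves degrees, so the homogeneous parts found in
  -- the whole algebra can be moved into the corner.
  have hp : (evenLayer h j).p K ∈ LPA.component K (evenLayer h j).toSepGraph edgeDeg 0 :=
    Submodule.sum_mem _ fun v _ => LPA.gen_mem_component (SepGraph.Gen.vertex _)
  let c : (evenLayer h j).L K →+ CornerAlg K h j :=
    { toFun := fun b => ⟨(evenLayer h j).p K * b * (evenLayer h j).p K, b, rfl⟩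
      map_zero' := CornerAlg.ext (by
        change _ * (0 : (evenLayer h j).L K) * _ = 0
        rw [mul_zero, zero_mul])
      map_add' := fun x y => CornerAlg.ext (by
        change _ * (x + y) * _ = _ * x * _ + _ * y * _
        rw [mul_add, add_mul]) }
  have hca : c a.1 = a := by
    obtain ⟨_, b, rfl⟩ := a
    refine CornerAlg.ext ?_
    change (evenLayer h j).p K * ((evenLayer h j).p K * b * (evenLayer h j).p K) *
      (evenLayer h j).p K = (evenLayer h j).p K * b * (evenLayer h j).p K
    rw [← mul_assoc, ← mul_assoc, LayerGraph.p_mul_p, mul_assoc, LayerGraph.p_mul_p]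
  refine ⟨f.support, fun d => c (f d), fun d => ?_, fun d hd => ?_, ?_⟩
  · have := LPA.mul_mem_component (LPA.mul_mem_component hp (hf d)) hp
    rwa [zero_add, add_zero] at this
  · simp only [Finsupp.notMem_support_iff.1 hd, map_zero]
  · rw [← map_sum]
    exact (congrArg c hsum).trans hca

/-- For the converse, split a representative into homogeneous parts. The images of these are
homogeneous and sum to an element of degree $d$, so that sum equals the image of the part of degree
$d$; by injectivity that part already represents the given element. -/
theorem mem_component_iff (d : ℤ) (a : AInf K h) :
    a ∈ AInf.component K h d ↔ canonicalHom K h a ∈ SteinbergAlgebra.component K S d := by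
  constructor
  · rintro ⟨j, b, hb, rfl⟩
    exact canonicalHom_mem_component h j hb
  · intro ha
    obtain ⟨j, b, rfl⟩ := exists_toAInfHom K h a
    obtain ⟨s, f, hf, hfs, rfl⟩ := b.exists_sum_mem_component
    refine ⟨j, f d, hf d, canonicalHom_injective h ?_⟩
    refine eq_of_sum_mem_component s (fun d => canonicalHom K h (toAInfHom K h j (f d)))
      (fun d => canonicalHom_mem_component h j (hf d)) ha ?_ fun hd => ?_
    · rw [map_sum, map_sum]
    · rw [hfs d hd, map_zero, map_zero]

end grading

theorem theorem6p14 {X : Type u} [MetricSpace X] [CompactSpace X] [TotallyDisconnectedSpace X]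
    (S : LHomeo X) (P : ℕ → ClopenPartition X) (h : SigmaRefined S P)
    (K : Type v) [Field K] [StarRing K] :
    ∃ φ : AInf K h ≃⋆ₐ[K] SteinbergAlgebra K S,
      IsCanonical φ ∧
      (∀ ψ : AInf K h →⋆ₙₐ[K] SteinbergAlgebra K S, IsCanonical ψ → ∀ a, ψ a = φ a) ∧
      ∀ (d : ℤ) (a : AInf K h),
        a ∈ AInf.component K h d ↔ φ a ∈ SteinbergAlgebra.component K S d :=
  ⟨StarAlgEquiv.ofBijective (canonicalHom K h)
      ⟨canonicalHom_injective h, canonicalHom_surjective h⟩,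
    isCanonical_canonicalHom h, fun _ hψ a => hψ.eq h (isCanonical_canonicalHom h) a,
    mem_component_iff h⟩
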